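/- Let $q$ be an odd prime power, and let the points of $\mathrm{PG}(3,q^2)$ be the nonzero matrices $M=\begin{pmatrix}\alpha&\beta\\ \gamma&\delta\end{pmatrix}$ over $\mathbb F_{q^2}$ up to scalars. Put $Q(M)=\alpha\delta-\beta\gamma$ and $H(M)=\alpha^{q+1}-\beta^{q+1}-\gamma^{q+1}+\delta^{q+1}$, with zero loci $\mathcal Q$ and $\mathcal H$; let $\perp$ be the polarity of $\mathcal H$; let $\Sigma\cong\mathrm{PG}(3,q)$ be the set of points fixed by $(\alpha,\beta,\gamma,\delta)\mapsto(\delta^q,\gamma^q,\beta^q,\alpha^q)$, and $\mathcal Q_0=\mathcal Q\cap\Sigma$. A $\Sigma$-line is a line of $\mathrm{PG}(3,q^2)$ with exactly $q+1$ points in $\Sigma$; it is an extended generator of $\mathcal Q_0$ if all these points are in $\mathcal Q_0$, and an extended tangent if exactly one of them is. A point $\langle M\rangle$ is nonsingular if $\alpha xy+\beta xy^q+\gamma x^qy+\delta x^qy^q\ne0$ for all nonzero $x,y\in\mathbb F_{q^2}$, and singular otherwise. Define: - $\tilde\Sigma=\Sigma\setminus\mathcal Q_0$, $\tilde{\mathcal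 Q}=\mathcal Q\setminus\mathcal H$; - $\mathcal T$: the points on extended generators of $\mathcal Q_0$ that are not in $\mathcal Q_0$; - $\tilde{\mathcal D}$: the points on extended tangents of $\mathcal Q_0$ that are not in $\Sigma$; - $\mathcal H_1$, $\mathcal H_2$: the nonsingular, respectively singular, points of $\mathcal H\setminus\mathcal Q$; - for $\xi\in\mathbb F_{q^2}$, $\tilde S_\xi$: the points with $H=2\xi Q^{(q+1)/2}$ that are not in $\mathcal H$; - $\mathcal Z_1$ (respectively $\mathcal Z_2$): the $\xi\in\mathbb F_{q^2}\setminus\{0,\pm1\}$ such that $1-1/\xi^2$ is a nonzero square (respectively a nonsquare) of $\mathbb F_q$; $\tilde{\mathcal S}^i=\{\tilde S_\xi:\xi\in\mathcal Z_i\}$. Let $\xi\in\mathcal Z_1$ and $P\in\tilde S_\xi$. Let $\xi^*=-\xi$ if $1-\xi^2$ is a square in $\mathbb F_q$, and $\xi^*=\xi$ otherwise. Then - $|P^\perp\cap\mathcal Q_0|=0$, $\ |P^\perp\cap\tilde\Sigma|=q+1$, $\ |P^\perp\cap\mathcal T|=2(q+1)$; - $|P^\perp\cap\tilde{\mathcal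 Q}|=q^2-2q-1$, $\ |P^\perp\cap\tilde{\mathcal D}|=(q-2)(q+1)^2$; - $|P^\perp\cap\mathcal H_1|=(q+1)(q^2-2q-1)/2$, $\ |P^\perp\cap\mathcal H_2|=(q-1)(q+1)^2/2$; - $|P^\perp\cap\tilde S_{\xi^*}|=(q+1)(q^2-2q-1)/2+q^2$; - $|P^\perp\cap\tilde S_\eta|=(q+1)(q^2-2q-1)/2$ for every $\eta\in\mathcal Z_1$ with $\eta\ne\xi^*$; - $|P^\perp\cap\tilde S'|=(q-1)(q+1)^2/2$ for every $\tilde S'\in\tilde{\mathcal S}^2$. -/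

import Mathlib

/-- Points of `PG(3, q²)`, represented by nonzero `2 × 2` matrices over `K = 𝔽_{q²}` up to scalars. -/
abbrev Pt (K : Type*) [Field K] : Type _ := Projectivization K (Matrix (Fin 2) (Fin 2) K)

namespace Tensor

section Forms

variable (F : Type*) {K : Type*} [Field F] [Fintype F] [Field K] [Algebra F K]

/-- The semilinear map `σ` with `(σ M) i j = (M (i-1) (j-1)) ^ q`, indices modulo `2`. -/
def sigmaMap : Matrix (Fin 2) (Fin 2) K →ₛₗ[(FiniteField.frobeniusAlgHom F K : K →+* K)]
    Matrix (Fin 2) (Fin 2) K where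
  toFun M := Matrix.of fun i j => FiniteField.frobeniusAlgHom F K (M (i - 1) (j - 1))
  map_add' M N := by ext i j; simp only [Matrix.add_apply, Matrix.of_apply, map_add]
  map_smul' c M := by
    ext i j
    simp only [Matrix.smul_apply, Matrix.of_apply, smul_eq_mul, map_mul]
    rfl

theorem sigmaMap_injective : Function.Injective (sigmaMap F (K := K)) := by
  intro M N h
  ext i j
  have h2 := congrFun (congrFun h (i + 1)) (j + 1)
  exact (FiniteField.frobeniusAlgHom F K).injective (by
    simpa [sigmaMap] using h2)

/-- The collineation `σ` of `PG(3, q²)`. -/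
def sigma : Pt K → Pt K := Projectivization.map (sigmaMap F) (sigmaMap_injective F)

/-- The quadratic form `Q(M) = αδ - βγ`. -/
def quad (M : Matrix (Fin 2) (Fin 2) K) : K := M 0 0 * M 1 1 - M 0 1 * M 1 0

/-- The Hermitian sesquilinear form
`α α'^q - β β'^q - γ γ'^q + δ δ'^q`. -/
def hermForm (M N : Matrix (Fin 2) (Fin 2) K) : K :=
  M 0 0 * N 0 0 ^ Fintype.card F - M 0 1 * N 0 1 ^ Fintype.card F
    - M 1 0 * N 1 0 ^ Fintype.card F + M 1 1 * N 1 1 ^ Fintype.card F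

/-- The Hermitian form `H(M) = α^(q+1) - β^(q+1) - γ^(q+1) + δ^(q+1)`. -/
def herm (M : Matrix (Fin 2) (Fin 2) K) : K :=
  M 0 0 ^ (Fintype.card F + 1) - M 0 1 ^ (Fintype.card F + 1)
    - M 1 0 ^ (Fintype.card F + 1) + M 1 1 ^ (Fintype.card F + 1)

/-- The `𝔽_q`-bilinear multiplication `∑ c_{ij} x^(q^i) y^(q^j)` of the tensor with matrix `M`. -/
def mult (M : Matrix (Fin 2) (Fin 2) K) (x y : K) : K :=
  ∑ i : Fin 2, ∑ j : Fin 2,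
    M i j * x ^ (Fintype.card F ^ (i : ℕ)) * y ^ (Fintype.card F ^ (j : ℕ))

/-- A tensor is nonsingular when its algebra has no zero divisors (it is a semifield). -/
def Nonsingular (M : Matrix (Fin 2) (Fin 2) K) : Prop :=
  ∀ x y : K, x ≠ 0 → y ≠ 0 → mult F M x y ≠ 0

end Forms

section PointSets

/- All conditions below on a representative `P.rep` are invariant under nonzero scalars. -/

variable (F K : Type*) [Field F] [Fintype F] [Field K] [Algebra F K]

/-- The subgeometry `Σ ≅ PG(3, q)` of points fixed by `σ`. -/
def subgeometry : Set (Pt K) := {P | sigma F P = P}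

/-- The quadric `𝒬 : Q = 0` of `PG(3, q²)`. -/
def quadric : Set (Pt K) := {P | quad P.rep = 0}

/-- The Hermitian surface `ℋ : H = 0`. -/
def hermitian : Set (Pt K) := {P | herm F P.rep = 0}

/-- The plane `P^⊥`, where `⊥` is the polarity of `ℋ`. -/
def perp {K : Type*} [Field K] [Algebra F K] (P : Pt K) : Set (Pt K) :=
  {R | hermForm F R.rep P.rep = 0}

/-- The quadric `𝒬₀ = 𝒬 ∩ Σ` of the subgeometry. -/
def Q0 : Set (Pt K) := quadric K ∩ subgeometry F K

/-- The points on the projective subspace given by a linear subspace `L`. -/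
def pts {K : Type*} [Field K] (L : Submodule K (Matrix (Fin 2) (Fin 2) K)) : Set (Pt K) :=
  {P | P.submodule ≤ L}

/-- A (extended) `Σ`-line: a line of `PG(3, q²)` meeting `Σ` in a subline (`q + 1` points). -/
def IsSigmaLine {K : Type*} [Field K] [Algebra F K]
    (L : Submodule K (Matrix (Fin 2) (Fin 2) K)) : Prop :=
  Module.finrank K L = 2 ∧ (pts L ∩ subgeometry F K).ncard = Fintype.card F + 1

/-- Extended generators of `𝒬₀`. -/
def IsExtGenerator {K : Type*} [Field K] [Algebra F K]
    (L : Submodule K (Matrix (Fin 2) (Fin 2) K)) : Prop :=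
  IsSigmaLine F L ∧ pts L ∩ subgeometry F K ⊆ Q0 F K

/-- Extended tangent lines of `𝒬₀`: `Σ`-lines meeting `𝒬₀` in exactly one point. -/
def IsExtTangent {K : Type*} [Field K] [Algebra F K]
    (L : Submodule K (Matrix (Fin 2) (Fin 2) K)) : Prop :=
  IsSigmaLine F L ∧ (pts L ∩ Q0 F K).ncard = 1

/-- `Σ̃ = Σ \ 𝒬₀`. -/
def sigmaTilde : Set (Pt K) := subgeometry F K \ Q0 F K

/-- `𝒯`: points on extended generators of `𝒬₀` that are not on `𝒬₀`. -/
def T : Set (Pt K) := {P | ∃ L, IsExtGenerator F L ∧ P ∈ pts L} \ Q0 F K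

/-- `𝒬̃ = 𝒬 \ ℋ`. -/
def quadricTilde : Set (Pt K) := quadric K \ hermitian F K

/-- `𝒟̃`: points on extended tangent lines of `𝒬₀` that are not in `Σ`. -/
def DTilde : Set (Pt K) := {P | ∃ L, IsExtTangent F L ∧ P ∈ pts L} \ subgeometry F K

/-- `ℋ₁`: the nonsingular points of `ℋ \ 𝒬`. -/
def H1 : Set (Pt K) := {P | P ∈ hermitian F K \ quadric K ∧ Nonsingular F P.rep}

/-- `ℋ₂`: the singular points of `ℋ \ 𝒬`. -/
def H2 : Set (Pt K) := {P | P ∈ hermitian F K \ quadric K ∧ ¬ Nonsingular F P.rep}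

/-- The surface `S_ξ : H - 2 ξ Q^((q+1)/2) = 0`, for `q` odd. -/
def S {K : Type*} [Field K] [Algebra F K] (ξ : K) : Set (Pt K) :=
  {P | herm F P.rep - 2 * ξ * quad P.rep ^ ((Fintype.card F + 1) / 2) = 0}

/-- `S̃_ξ = S_ξ \ ℋ`. -/
def STilde {K : Type*} [Field K] [Algebra F K] (ξ : K) : Set (Pt K) := S F ξ \ hermitian F K

/-- `𝒵₁`: the `ξ ≠ 0, ±1` such that `1 - 1/ξ²` is a nonzero square of `𝔽_q`. -/
def Z1 : Set K :=
  {ξ | ξ ≠ 0 ∧ ξ ≠ 1 ∧ ξ ≠ -1 ∧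
    ∃ s : F, s ≠ 0 ∧ IsSquare s ∧ 1 - 1 / ξ ^ 2 = algebraMap F K s}

/-- `𝒵₂`: the `ξ ≠ 0` such that `1 - 1/ξ²` is a nonsquare of `𝔽_q`. -/
def Z2 : Set K :=
  {ξ | ξ ≠ 0 ∧ ∃ s : F, ¬ IsSquare s ∧ 1 - 1 / ξ ^ 2 = algebraMap F K s}

open Classical in
/-- The member `±ξ` for which the plane `P^⊥`, `P ∈ S̃_ξ`, is exceptional:
`-ξ` if `1 - ξ²` is a square of `𝔽_q`, and `ξ` otherwise. -/
noncomputable def special {K : Type*} [Field K] [Algebra F K] (ξ : K) : K :=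
  if ∃ s : F, IsSquare s ∧ 1 - ξ ^ 2 = algebraMap F K s then -ξ else ξ

end PointSets

end Tensor

/-!
Write `N` and `Tr` for norm and trace from `K = 𝔽_{q²}` to `F = 𝔽_q`. The form `H` takes values in
`F` (`hermVal`), and under scaling by `a` the pair `(Q, H)` becomes `(a² Q, N(a) H)`. Every point set
in question is described by a condition on `(Q, H)`, together with membership in `Σ`. This is
immediate for `S̃_ξ`. Since `H(M)` is the value of the polar form of `Q` on `M` and `σ(M)`, the type
of the `Σ`-line joining a point to its image under `σ` depends only on `H² - 4 N(Q)`, which gives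
descriptions of the points on extended generators and on extended tangents (`mem_T_iff`,
`mem_DTilde_iff`). A point is nonsingular if and only if a certain binary quadratic form with
discriminant `H² - 4 N(Q)` is anisotropic (`nonsingular_iff`).

For `P ∈ S̃_ξ` with `ξ ∈ 𝒵₁` the discriminant `H² - 4 N(Q)` is a nonzero square. Multiplication from
both sides by `σ`-fixed matrices of determinant one preserves `Q`, `H` and `σ` and takes `P` to
`(1, 0, 0, d)`, where `D = N(d)` differs from `0`, `1` and `-1` (`exists_planeCoordinates`). So `P^⊥`
consists of the vectors `(-dᵠ δ, β, γ, δ)`, on which `Q = -dᵠ δ² - β γ` and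
`H = (1 + D) N(δ) - N(β) - N(γ)`; the `σ`-fixed ones have `δ = 0` and `γ = βᵠ`. This gives the
intersections with `Σ` and, by direct counts, those with `𝒯` and `𝒬`.

The main count (`card_plane_vectors`) is that of the vectors of `P^⊥` with given values `Q = c ≠ 0`
and `H = h`. For fixed `δ`, the pairs `(β, γ)` are counted by the values of `y = N(β) - N(γ)`, which
satisfy `y² = ((1 + D) N(δ) - h)² - 4 N(c + dᵠ δ²)`. The substitution `y = s + (1 - D) N(δ)` cancels
the terms of degree four in `δ`, and for fixed `s` leaves the equation
`2 ((1 - D) s + (1 + D) h) N(δ) + Tr(4 (c d)ᵠ δ²) = h² - 4 N(c) - s²` given by a binary quadratic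
form in `δ`. The numbers of solutions are known, and their sum over `s` is a sum of quadratic
characters of quadratic polynomials. The result is
`(q + 1) (q² - q - 1 - q χ(h² - 4 N(c)))`, with `χ` the quadratic character, except that each vector
with `β = γ = 0` adds `q²`.

It remains to sum over the pairs `(c, h)` belonging to a point set, on which the character is
constant, and to divide by `q² - 1`. The vectors with `β = γ = 0` represent the point where `P^⊥`
meets the line joining `P` to its image under `σ`. This point lies on the surface `S̃_{ξ*}` and in no
other set counted in this way (`special_eq_iff`), which explains the additional `q²` there.
-/

namespace Tensor

open Finset

/-! ### Quadratic characters and binary quadratic forms -/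

section Counting

theorem card_filter_prod_eq_sum {A B : Type*} [Fintype A] [Fintype B] (P : A → B → Prop)
    [∀ a, DecidablePred (P a)] [DecidablePred fun p : A × B => P p.1 p.2] :
    #{p : A × B | P p.1 p.2} = ∑ a, #{b | P a b} := by
  simp only [Finset.card_filter, Fintype.sum_prod_type]
  refine sum_congr rfl fun a _ => sum_congr rfl fun b _ => ?_
  split_ifs <;> rfl

end Counting

section QuadraticForms

variable {F : Type*} [Field F] [Fintype F] [DecidableEq F]

theorem card_sq_eq (hF : ringChar F ≠ 2) (a : F) :
    (#{x : F | x ^ 2 = a} : ℤ) = 1 + quadraticChar F a := by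
  rw [add_comm, ← quadraticChar_card_sqrts hF a]
  congr 2
  ext x
  simp

theorem card_mul_eq {c : F} (hc : c ≠ 0) :
    #{p : F × F | p.1 * p.2 = c} = Fintype.card F - 1 := by
  rw [← Finset.card_univ, ← Finset.card_erase_of_mem (mem_univ (0 : F))]
  refine Finset.card_nbij' (fun p => p.1) (fun u => (u, c / u)) ?_ ?_ ?_ ?_
  · rintro ⟨u, v⟩ h
    have h : u * v = c := by simpa using h
    have : u ≠ 0 := by rintro rfl; simp at h; exact hc h.symm
    simpa using this
  · intro u hu
    have hu : u ≠ 0 := by simpa using hu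
    simp; field_simp
  · rintro ⟨u, v⟩ h
    have h : u * v = c := by simpa using h
    have : u ≠ 0 := by rintro rfl; simp at h; exact hc h.symm
    simp [← h]; field_simp
  · intro u hu; rfl

theorem sum_quadraticChar_sq_sub (hF : ringChar F ≠ 2) {c : F} (hc : c ≠ 0) :
    ∑ y : F, quadraticChar F (y ^ 2 - c) = -1 := by
  have h2 : (2 : F) ≠ 0 := Ring.two_ne_zero hF
  have h1 : (#{p : F × F | p.2 ^ 2 = p.1 ^ 2 - c} : ℤ) =
      Fintype.card F + ∑ y : F, quadraticChar F (y ^ 2 - c) := by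
    rw [card_filter_prod_eq_sum (fun y x : F => x ^ 2 = y ^ 2 - c)]
    push_cast
    simp_rw [card_sq_eq hF, sum_add_distrib]
    simp
  have h3 : #{p : F × F | p.2 ^ 2 = p.1 ^ 2 - c} = #{p : F × F | p.1 * p.2 = c} := by
    refine Finset.card_nbij' (fun p => (p.1 - p.2, p.1 + p.2))
      (fun p => ((p.1 + p.2) / 2, (p.2 - p.1) / 2)) ?_ ?_ ?_ ?_
    · rintro ⟨y, x⟩ h
      have h : x ^ 2 = y ^ 2 - c := by simpa using h
      simp
      linear_combination -h
    · rintro ⟨u, v⟩ h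
      have h : u * v = c := by simpa using h
      simp
      field_simp
      linear_combination -4 * h
    · rintro ⟨y, x⟩ h
      ext <;> (simp; field_simp; ring)
    · rintro ⟨y, x⟩ h
      ext <;> (simp; field_simp; ring)
  rw [h3, card_mul_eq hc, Nat.cast_sub Fintype.card_pos] at h1
  push_cast at h1
  linarith

theorem sum_quadraticChar_affine_sq_sub (hF : ringChar F ≠ 2) {a c : F} (ha : a ≠ 0) (b : F)
    (hc : c ≠ 0) : ∑ s : F, quadraticChar F ((a * s + b) ^ 2 - c) = -1 := by
  rw [← sum_quadraticChar_sq_sub hF hc]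
  exact Equiv.sum_comp ((Equiv.mulLeft₀ a ha).trans (Equiv.addRight b))
    (fun y => quadraticChar F (y ^ 2 - c))

theorem sum_quadraticChar_add_mul_sq (hF : ringChar F ≠ 2) {D : F} (hD : D ≠ 0) (R : F) :
    ∑ y : F, quadraticChar F (R + D * y ^ 2) =
      if R = 0 then (Fintype.card F - 1) * quadraticChar F D else - quadraticChar F D := by
  split_ifs with hR
  · subst hR
    simp only [zero_add, map_mul, ← mul_sum]
    rw [mul_comm, ← Finset.add_sum_erase _ _ (mem_univ (0 : F))]
    rw [Finset.sum_congr rfl (g := fun _ => (1 : ℤ))]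
    · simp [Finset.card_univ, Nat.cast_sub (Fintype.card_pos (α := F))]
    · intro y hy
      have : y ≠ 0 := by simpa using hy
      exact quadraticChar_sq_one' this
  · have : ∀ y : F, quadraticChar F (R + D * y ^ 2) =
        quadraticChar F D * quadraticChar F (y ^ 2 - (- R / D)) := by
      intro y
      rw [← map_mul]; congr 1; field_simp; ring
    simp_rw [this, ← mul_sum]
    rw [sum_quadraticChar_sq_sub hF (by simp [hR, hD])]
    ring

theorem card_sq_sub_mul_sq (hF : ringChar F ≠ 2) {D : F} (hD : D ≠ 0) (R : F) :
    (#{p : F × F | p.1 ^ 2 - D * p.2 ^ 2 = R} : ℤ) = Fintype.card F - quadraticChar F D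
      + if R = 0 then Fintype.card F * quadraticChar F D else 0 := by
  have : #{p : F × F | p.1 ^ 2 - D * p.2 ^ 2 = R} =
      ∑ y : F, #{x : F | x ^ 2 = R + D * y ^ 2} := by
    rw [← card_filter_prod_eq_sum (fun y x : F => x ^ 2 = R + D * y ^ 2)]
    refine Finset.card_equiv (Equiv.prodComm _ _) ?_
    simp [sub_eq_iff_eq_add]
  rw [this]
  push_cast
  simp_rw [card_sq_eq hF, sum_add_distrib, sum_quadraticChar_add_mul_sq hF hD]
  split_ifs <;> simp <;> ring

/-- The number of representations of `r` by a nondegenerate binary quadratic form over a finite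
field of odd characteristic. -/
theorem card_binary_form (hF : ringChar F ≠ 2) {a b c : F} (hD : b ^ 2 - 4 * a * c ≠ 0) (r : F) :
    (#{p : F × F | a * p.1 ^ 2 + b * p.1 * p.2 + c * p.2 ^ 2 = r} : ℤ) =
      Fintype.card F - quadraticChar F (b ^ 2 - 4 * a * c)
      + if r = 0 then Fintype.card F * quadraticChar F (b ^ 2 - 4 * a * c) else 0 := by
  have h2 : (2 : F) ≠ 0 := Ring.two_ne_zero hF
  -- a shear makes the coefficient of `x²` nonzero, and then completing the square applies
  obtain ⟨t, ht⟩ : ∃ t : F, a + b * t + c * t ^ 2 ≠ 0 := by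
    by_contra! h
    have h0 := h 0
    have h1 := h 1
    have h3 := h (-1)
    have ha : a = 0 := by simpa using h0
    have hb : b = 0 := by
      have : 2 * b = 0 := by linear_combination h1 - h3
      simpa [h2] using this
    simp [ha, hb] at hD
  have key : #{p : F × F | a * p.1 ^ 2 + b * p.1 * p.2 + c * p.2 ^ 2 = r} =
      #{p : F × F | p.1 ^ 2 - (b ^ 2 - 4 * a * c) * p.2 ^ 2 = 4 * (a + b * t + c * t ^ 2) * r} := by
    set a' := a + b * t + c * t ^ 2 with ha'
    refine Finset.card_nbij'
      (fun p => (2 * a' * p.1 + (b + 2 * c * t) * (p.2 - t * p.1), p.2 - t * p.1))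
      (fun p => ((p.1 - (b + 2 * c * t) * p.2) / (2 * a'),
        p.2 + t * ((p.1 - (b + 2 * c * t) * p.2) / (2 * a')))) ?_ ?_ ?_ ?_
    · rintro ⟨x, y⟩ h
      have h : a * x ^ 2 + b * x * y + c * y ^ 2 = r := by simpa using h
      simp only [coe_filter, mem_univ, true_and, Set.mem_ofPred_eq]
      rw [← h, ha']
      ring
    · rintro ⟨X, Y⟩ h
      have h : X ^ 2 - (b ^ 2 - 4 * a * c) * Y ^ 2 = 4 * a' * r := by simpa using h
      simp only [coe_filter, mem_univ, true_and, Set.mem_ofPred_eq]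
      generalize hx : (X - (b + 2 * c * t) * Y) / (2 * a') = x
      have hX : X = 2 * a' * x + (b + 2 * c * t) * Y := by
        rw [← hx]; field_simp; ring
      have h4 : 4 * a' ≠ 0 := by
        have : (4 : F) = 2 * 2 := by norm_num
        rw [this]; simp [h2, ht]
      apply mul_left_cancel₀ h4
      rw [← h, hX, ha']
      ring
    · rintro ⟨x, y⟩ h
      ext
      · simp; field_simp
      · simp; field_simp; ring
    · rintro ⟨x, y⟩ h
      ext
      · simp; field_simp; ring
      · simp
  rw [key, card_sq_sub_mul_sq hF hD]
  have h4 : (4 : F) ≠ 0 := by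
    have : (4 : F) = 2 * 2 := by norm_num
    rw [this]; simp [h2]
  simp [h4, ht]

end QuadraticForms

/-! ### The quadratic extension `K` of `F` -/

section QuadraticExtension

set_option linter.unusedSectionVars false

variable (F : Type*) {K : Type*} [Field F] [Fintype F] [Field K] [Algebra F K]

/-- The conjugation `x ↦ x ^ q` of `K` over `F`. -/
def conj : K →ₐ[F] K := FiniteField.frobeniusAlgHom F K

theorem conj_apply (x : K) : conj F x = x ^ Fintype.card F := rfl

theorem pow_card_add_one (x : K) : x ^ (Fintype.card F + 1) = x * conj F x := by
  rw [pow_succ', conj_apply]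

variable [hK : Fact (Module.finrank F K = 2)]

include hK in
theorem finite_of_finrank_eq_two : Finite K :=
  have : Module.Finite F K := Module.finite_of_finrank_eq_succ hK.out
  Module.finite_of_finite F

include hK in
theorem natCard_eq_sq : Nat.card K = Fintype.card F ^ 2 := by
  have : Module.Finite F K := Module.finite_of_finrank_eq_succ hK.out
  rw [Module.natCard_eq_pow_finrank (K := F), hK.out, Nat.card_eq_fintype_card]

include hK in
theorem card_eq_sq [Fintype K] : Fintype.card K = Fintype.card F ^ 2 := by
  rw [← natCard_eq_sq F (K := K), Nat.card_eq_fintype_card]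

@[simp]
theorem conj_conj (x : K) : conj F (conj F x) = x := by
  have := finite_of_finrank_eq_two F (K := K)
  have := Fintype.ofFinite K
  rw [conj_apply, conj_apply, ← pow_mul, ← sq, ← card_eq_sq F (K := K), FiniteField.pow_card]

theorem algebraMap_norm (x : K) : algebraMap F K (Algebra.norm F x) = x * conj F x := by
  have := finite_of_finrank_eq_two F (K := K)
  rw [FiniteField.algebraMap_norm_eq_prod_pow, hK.out]
  simp [Finset.prod_range_succ, conj_apply]

theorem algebraMap_trace (x : K) : algebraMap F K (Algebra.trace F K x) = x + conj F x := by
  have := finite_of_finrank_eq_two F (K := K)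
  rw [FiniteField.algebraMap_trace_eq_sum_pow, hK.out]
  simp [Finset.sum_range_succ, conj_apply]

@[simp]
theorem conj_algebraMap (a : F) : conj F (algebraMap F K a) = algebraMap F K a :=
  (conj F).commutes a

theorem conj_ne_zero {x : K} (hx : x ≠ 0) : conj F x ≠ 0 := by
  rw [conj_apply]; exact pow_ne_zero _ hx

@[simp]
theorem norm_conj (x : K) : Algebra.norm F (conj F x) = Algebra.norm F x := by
  apply (algebraMap F K).injective
  rw [algebraMap_norm, algebraMap_norm, conj_conj, mul_comm]

theorem norm_algebraMap_eq (a : F) : Algebra.norm F (algebraMap F K a) = a ^ 2 := by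
  rw [Algebra.norm_algebraMap, hK.out]

include hK in
theorem norm_eq_zero_iff {x : K} : Algebra.norm F x = 0 ↔ x = 0 := by
  have : Module.Finite F K := Module.finite_of_finrank_eq_succ hK.out
  exact Algebra.norm_eq_zero_iff

include hK in
theorem norm_surj (a : F) : ∃ x : K, Algebra.norm F x = a := by
  have := finite_of_finrank_eq_two F (K := K)
  exact FiniteField.norm_surjective F K a

theorem norm_neg (x : K) : Algebra.norm F (-x) = Algebra.norm F x := by
  apply (algebraMap F K).injective
  simp [algebraMap_norm]

include hK in
theorem card_norm_eq [Fintype K] [DecidableEq F] {t : F} (ht : t ≠ 0) :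
    #{x : K | Algebra.norm F x = t} = Fintype.card F + 1 := by
  have heq : ∀ u : F, u ≠ 0 → #{x : K | Algebra.norm F x = u} = #{x : K | Algebra.norm F x = t} := by
    intro u hu
    obtain ⟨y, hy⟩ := norm_surj F (K := K) (t / u)
    have hy0 : y ≠ 0 := by
      rw [Ne, ← norm_eq_zero_iff F, hy]; exact div_ne_zero ht hu
    refine Finset.card_equiv (Equiv.mulLeft₀ y hy0) ?_
    intro x
    simp only [mem_filter, mem_univ, true_and, Equiv.mulLeft₀_apply, map_mul, hy]
    constructor
    · rintro rfl; field_simp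
    · intro h; field_simp at h; exact h
  have hsum : Fintype.card K = ∑ u : F, #{x : K | Algebra.norm F x = u} := by
    rw [← Finset.card_univ]
    exact Finset.card_eq_sum_card_fiberwise (by simp)
  have h0 : #{x : K | Algebra.norm F x = 0} = 1 := by
    classical
    rw [Finset.card_eq_one]
    exact ⟨0, by ext x; simp [norm_eq_zero_iff F]⟩
  rw [← Finset.add_sum_erase _ _ (mem_univ (0 : F)), h0,
    Finset.sum_congr rfl (fun u hu => heq u (by simpa using hu)), card_eq_sq F] at hsum
  simp only [sum_const, card_erase_of_mem (mem_univ _), card_univ, smul_eq_mul] at hsum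
  have hq : 1 < Fintype.card F := Fintype.one_lt_card
  generalize #{x : K | Algebra.norm F x = t} = n at *
  generalize Fintype.card F = q at *
  obtain ⟨r, rfl⟩ : ∃ r, q = r + 2 := ⟨q - 2, by omega⟩
  simp only [show r + 2 - 1 = r + 1 by omega] at hsum
  have : (r + 1) * n = (r + 1) * (r + 2 + 1) := by nlinarith
  exact Nat.eq_of_mul_eq_mul_left (by omega) this

theorem exists_algebraMap_eq {x : K} (hx : conj F x = x) : ∃ a : F, algebraMap F K a = x := by
  classical
  have := finite_of_finrank_eq_two F (K := K)
  have := Fintype.ofFinite K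
  -- the polynomial `X ^ q - X` has at most `q` roots, and the elements of `F` are roots
  have hq : 1 < Fintype.card F := Fintype.one_lt_card
  let p : Polynomial K := Polynomial.X ^ Fintype.card F - Polynomial.X
  have hp : p ≠ 0 := FiniteField.X_pow_card_sub_X_ne_zero K hq
  have hdeg : p.natDegree = Fintype.card F := FiniteField.X_pow_card_sub_X_natDegree_eq K hq
  have hsub : univ.image (algebraMap F K) ⊆ p.roots.toFinset := by
    intro y hy
    obtain ⟨a, -, rfl⟩ := mem_image.1 hy
    rw [Multiset.mem_toFinset, Polynomial.mem_roots hp]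
    simp [p, ← map_pow, FiniteField.pow_card]
  have hcard : #p.roots.toFinset ≤ #(univ.image (algebraMap F K)) := by
    rw [card_image_of_injective _ (algebraMap F K).injective, card_univ, ← hdeg]
    exact (Multiset.toFinset_card_le _).trans p.card_roots'
  have hmem : x ∈ p.roots.toFinset := by
    rw [Multiset.mem_toFinset, Polynomial.mem_roots hp]
    simp [p, ← conj_apply, hx]
  rw [← Finset.eq_of_subset_of_card_le hsub hcard] at hmem
  obtain ⟨a, -, rfl⟩ := mem_image.1 hmem
  exact ⟨a, rfl⟩

theorem exists_conj_ne : ∃ x : K, conj F x ≠ x := by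
  by_contra! h
  have := finite_of_finrank_eq_two F (K := K)
  have := Fintype.ofFinite K
  have hs : Function.Surjective (algebraMap F K) := fun x => exists_algebraMap_eq F (h x)
  have h1 := Fintype.card_le_of_surjective _ hs
  rw [card_eq_sq F (K := K)] at h1
  have hq : 1 < Fintype.card F := Fintype.one_lt_card
  nlinarith

/-- Hilbert 90 for `K` over `F`. -/
theorem exists_conj_eq_mul {c : K} (hc : c * conj F c = 1) : ∃ x : K, x ≠ 0 ∧ conj F x = c * x := by
  -- every element `y + cᵠ yᵠ` has the required property, so it suffices to find a nonzero one
  by_contra! h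
  have h' : ∀ y : K, y + conj F c * conj F y = 0 := by
    intro y
    by_contra hy
    refine h _ hy ?_
    simp only [map_add, map_mul, conj_conj]
    linear_combination (-conj F y) * hc
  have h1 : conj F c = -1 := by
    have := h' 1
    rw [map_one] at this
    linear_combination this
  obtain ⟨y, hy⟩ := exists_conj_ne F (K := K)
  have := h' y
  rw [h1] at this
  exact hy (by linear_combination -this)

theorem exists_conj_eq_neg : ∃ w : K, w ≠ 0 ∧ conj F w = -w := by
  obtain ⟨x, hx⟩ := exists_conj_ne F (K := K)
  exact ⟨conj F x - x, sub_ne_zero.2 hx, by simp⟩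

include hK in
theorem two_ne_zero_ext (hF : ringChar F ≠ 2) : (2 : K) ≠ 0 := by
  have h2 : (2 : F) ≠ 0 := Ring.two_ne_zero hF
  rw [← map_ofNat (algebraMap F K) 2]
  exact (map_ne_zero (algebraMap F K)).2 h2

/-- A square root in `K` of a nonsquare of `F`. -/
theorem exists_sq_eq_nonsquare (hF : ringChar F ≠ 2) :
    ∃ (w : K) (e : F), w ≠ 0 ∧ conj F w = -w ∧ w ^ 2 = algebraMap F K e ∧ ¬ IsSquare e := by
  obtain ⟨w, hw, hc⟩ := exists_conj_eq_neg F (K := K)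
  obtain ⟨e, he⟩ := exists_algebraMap_eq F (x := w ^ 2) (by simp [hc])
  refine ⟨w, e, hw, hc, he.symm, ?_⟩
  rintro ⟨a, rfl⟩
  have h2 := two_ne_zero_ext F (K := K) hF
  have h : (w - algebraMap F K a) * (w + algebraMap F K a) = 0 := by
    rw [map_mul] at he
    linear_combination -he
  have hfix : conj F w = w := by
    rcases mul_eq_zero.1 h with h | h
    · rw [sub_eq_zero.1 h]; simp
    · rw [eq_neg_of_add_eq_zero_left h]; simp
  rw [hc] at hfix
  have : 2 * w = 0 := by linear_combination -hfix
  simp [h2, hw] at this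

include hK in
/-- Every element of `F` is a square in `K`. -/
theorem exists_sq_eq_algebraMap (hF : ringChar F ≠ 2) (a : F) : ∃ x : K, x ^ 2 = algebraMap F K a := by
  classical
  by_cases ha : IsSquare a
  · obtain ⟨b, rfl⟩ := ha
    exact ⟨algebraMap F K b, by simp [sq]⟩
  · obtain ⟨w, e, hw, -, hwe, he⟩ := exists_sq_eq_nonsquare F (K := K) hF
    have he0 : e ≠ 0 := by rintro rfl; simp at he
    have h : IsSquare (a / e) := by
      by_contra hn
      rw [← quadraticChar_neg_one_iff_not_isSquare] at ha he hn
      have h := map_mul (quadraticChar F) (a / e) e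
      rw [div_mul_cancel₀ _ he0, ha, he, hn] at h
      norm_num at h
    obtain ⟨b, hb⟩ := h
    refine ⟨w * algebraMap F K b, ?_⟩
    rw [mul_pow, hwe, ← map_pow, ← map_mul]
    congr 1
    field_simp at hb
    rw [hb]

include hK in
/-- An element of `K` is a square if its norm is. -/
theorem exists_sq_eq_of_isSquare_norm (hF : ringChar F ≠ 2) {x : K}
    (hx : IsSquare (Algebra.norm F x)) : ∃ y : K, y ^ 2 = x := by
  by_cases hx0 : x = 0
  · exact ⟨0, by simp [hx0]⟩
  obtain ⟨n, hn⟩ := hx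
  have hn0 : n ≠ 0 := by
    rintro rfl
    simp [norm_eq_zero_iff F] at hn
    exact hx0 hn
  have hn' : (algebraMap F K n) ≠ 0 := by simpa using hn0
  -- `x / n` has norm one, so `x / n = zᵠ / z` and `n x = (n z)ᵠ⁺¹ / z²`
  have h1 : x * conj F x = algebraMap F K n * algebraMap F K n := by
    rw [← algebraMap_norm, hn, map_mul]
  obtain ⟨z, hz, hzc⟩ := exists_conj_eq_mul F (c := x / algebraMap F K n) (by
    rw [map_div₀, conj_algebraMap]; field_simp; linear_combination h1)
  obtain ⟨s, hs⟩ := exists_sq_eq_algebraMap F (K := K) hF (n * Algebra.norm F z)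
  refine ⟨s / z, ?_⟩
  rw [div_pow, hs, map_mul, algebraMap_norm, hzc]
  field_simp

theorem conj_eq_self_or_neg {x : K} {a : F} (h : x ^ 2 = algebraMap F K a) :
    conj F x = x ∨ conj F x = -x := by
  have h1 : (conj F x) ^ 2 = x ^ 2 := by rw [← map_pow, h, conj_algebraMap]
  exact sq_eq_sq_iff_eq_or_eq_neg.1 h1

end QuadraticExtension

/-! ### Binary quadratic forms on `K` over `F` -/

section ConjForms

set_option linter.unusedSectionVars false

variable (F : Type*) {K : Type*} [Field F] [Fintype F] [Field K] [Algebra F K]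
  [hK : Fact (Module.finrank F K = 2)] [Fintype K] [DecidableEq F]

/-- The coordinates of `K` over `F` with respect to a basis `1, w` with `w ^ q = -w`. -/
theorem exists_coordinates (hF : ringChar F ≠ 2) {w : K} (hw : w ≠ 0) (hc : conj F w = -w) :
    ∃ e : F × F ≃ K, ∀ p, e p = algebraMap F K p.1 + algebraMap F K p.2 * w := by
  have h2 := two_ne_zero_ext F (K := K) hF
  let f : F × F → K := fun p => algebraMap F K p.1 + algebraMap F K p.2 * w
  have hf : Function.Injective f := by
    rintro ⟨a, b⟩ ⟨a', b'⟩ h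
    have h : algebraMap F K a + algebraMap F K b * w = algebraMap F K a' + algebraMap F K b' * w := h
    have h' := congrArg (conj F) h
    simp only [map_add, map_mul, conj_algebraMap, hc] at h'
    have h3 : 2 * w * algebraMap F K b = 2 * w * algebraMap F K b' := by linear_combination h - h'
    have hb := mul_left_cancel₀ (mul_ne_zero h2 hw) h3
    rw [hb] at h
    ext
    · exact (algebraMap F K).injective (by linear_combination h)
    · exact (algebraMap F K).injective hb
  have hcard : Fintype.card (F × F) = Fintype.card K := by
    rw [Fintype.card_prod, card_eq_sq F (K := K), sq]
  exact ⟨Equiv.ofBijective f ((Fintype.bijective_iff_injective_and_card f).2 ⟨hf, hcard⟩),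
    fun p => rfl⟩

/-- The number of representations of `r` by the nondegenerate binary quadratic form
`k N(x) + Tr(m x²)` on `K`. -/
theorem card_norm_add_trace_eq (hF : ringChar F ≠ 2) {k : F} {m : K}
    (hD : k ^ 2 - 4 * Algebra.norm F m ≠ 0) (r : F) :
    (#{x : K | k * Algebra.norm F x + Algebra.trace F K (m * x ^ 2) = r} : ℤ) =
      Fintype.card F + quadraticChar F (k ^ 2 - 4 * Algebra.norm F m)
      - if r = 0 then Fintype.card F * quadraticChar F (k ^ 2 - 4 * Algebra.norm F m) else 0 := by
  obtain ⟨w, e, hw, hc, hwe, he⟩ := exists_sq_eq_nonsquare F (K := K) hF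
  have h2 : (2 : F) ≠ 0 := Ring.two_ne_zero hF
  have he0 : e ≠ 0 := by rintro rfl; simp at he
  obtain ⟨φ, hφ⟩ := exists_coordinates F hF hw hc
  obtain ⟨⟨m₀, m₁⟩, rfl⟩ := φ.surjective m
  have hm : Algebra.norm F (φ (m₀, m₁)) = m₀ ^ 2 - e * m₁ ^ 2 := by
    apply (algebraMap F K).injective
    simp only [algebraMap_norm, hφ, map_add, map_mul, conj_algebraMap, hc, map_sub, map_pow]
    linear_combination (-(algebraMap F K) m₁ ^ 2) * hwe
  have key : #{x : K | k * Algebra.norm F x + Algebra.trace F K (φ (m₀, m₁) * x ^ 2) = r} =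
      #{p : F × F | (k + 2 * m₀) * p.1 ^ 2 + (4 * e * m₁) * p.1 * p.2
        + (e * (2 * m₀ - k)) * p.2 ^ 2 = r} := by
    symm
    refine Finset.card_equiv φ ?_
    rintro ⟨a, b⟩
    simp only [mem_filter, mem_univ, true_and]
    rw [← (algebraMap F K).injective.eq_iff (b := r), ← (algebraMap F K).injective.eq_iff (b := r)]
    simp only [algebraMap_norm, algebraMap_trace, hφ, map_add, map_mul, conj_algebraMap, hc,
      map_sub, map_pow, map_ofNat]
    refine Eq.congr ?_ rfl
    simp only [← hwe]
    ring
  have hdisc : (4 * e * m₁) ^ 2 - 4 * (k + 2 * m₀) * (e * (2 * m₀ - k)) =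
      2 ^ 2 * e * (k ^ 2 - 4 * Algebra.norm F (φ (m₀, m₁))) := by
    rw [hm]; ring
  have hchi : quadraticChar F (2 ^ 2 * e * (k ^ 2 - 4 * Algebra.norm F (φ (m₀, m₁)))) =
      - quadraticChar F (k ^ 2 - 4 * Algebra.norm F (φ (m₀, m₁))) := by
    rw [map_mul, map_mul, quadraticChar_sq_one' h2,
      quadraticChar_neg_one_iff_not_isSquare.2 he]
    ring
  rw [key, card_binary_form hF (by rw [hdisc]; simp [h2, he0, hD]), hdisc, hchi]
  split_ifs <;> ring

theorem card_fst_sq_eq (hF : ringChar F ≠ 2) {a : F} (ha : a ≠ 0) (r : F) :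
    (#{p : F × F | a * p.1 ^ 2 = r} : ℤ) =
      Fintype.card F * (1 + quadraticChar F a * quadraticChar F r) := by
  have h1 : quadraticChar F a * quadraticChar F r = quadraticChar F (r / a) := by
    have h := map_mul (quadraticChar F) (a ^ 2) (r / a)
    rw [quadraticChar_sq_one' ha, one_mul] at h
    rw [← h, ← map_mul]
    congr 1; field_simp
  have h3 : #{p : F × F | a * p.1 ^ 2 = r} = #((univ.filter fun x : F => x ^ 2 = r / a) ×ˢ (univ : Finset F)) := by
    congr 1
    ext p
    simp only [mem_filter, mem_univ, true_and, mem_product, and_true]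
    constructor
    · rintro rfl; field_simp
    · intro h; rw [h]; field_simp
  rw [h3, card_product, h1, Nat.cast_mul, card_sq_eq hF, Finset.card_univ]
  ring

/-- The number of representations of `r` by the rank one form `Tr(v x)²`. -/
theorem card_degenerate_add (hF : ringChar F ≠ 2) {v : K} (hv : v ≠ 0) (r : F) :
    (#{x : K | 2 * Algebra.norm F v * Algebra.norm F x + Algebra.trace F K (v ^ 2 * x ^ 2) = r} : ℤ)
      = Fintype.card F * (1 + quadraticChar F r) := by
  obtain ⟨w, e, hw, hc, hwe, he⟩ := exists_sq_eq_nonsquare F (K := K) hF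
  have h2 : (2 : F) ≠ 0 := Ring.two_ne_zero hF
  obtain ⟨φ, hφ⟩ := exists_coordinates F hF hw hc
  have h := card_fst_sq_eq F hF (pow_ne_zero 2 h2) r
  rw [quadraticChar_sq_one' h2, one_mul] at h
  rw [← h]
  congr 1
  refine Finset.card_equiv ((Equiv.mulLeft₀ v hv).trans φ.symm) ?_
  intro x
  obtain ⟨p, hp⟩ := φ.surjective (v * x)
  simp only [mem_filter, mem_univ, true_and, Equiv.trans_apply, Equiv.mulLeft₀_apply]
  rw [← hp, Equiv.symm_apply_apply, ← mul_pow, ← hp, mul_assoc, ← map_mul, ← hp,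
    ← (algebraMap F K).injective.eq_iff (b := r), ← (algebraMap F K).injective.eq_iff (b := r)]
  simp only [algebraMap_norm, algebraMap_trace, hφ, map_add, map_mul, conj_algebraMap, hc,
      map_pow, map_ofNat]
  refine Eq.congr ?_ rfl
  ring

/-- The number of representations of `r` by the rank one form `(v x - (v x) ^ q)²`, whose values
are the nonsquares of `F` and zero. -/
theorem card_degenerate_sub (hF : ringChar F ≠ 2) {v : K} (hv : v ≠ 0) (r : F) :
    (#{x : K | -2 * Algebra.norm F v * Algebra.norm F x + Algebra.trace F K (v ^ 2 * x ^ 2) = r} : ℤ)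
      = Fintype.card F * (1 - quadraticChar F r) := by
  obtain ⟨w, e, hw, hc, hwe, he⟩ := exists_sq_eq_nonsquare F (K := K) hF
  have h2 : (2 : F) ≠ 0 := Ring.two_ne_zero hF
  have he0 : e ≠ 0 := by rintro rfl; simp at he
  obtain ⟨φ, hφ⟩ := exists_coordinates F hF hw hc
  have h := card_fst_sq_eq F hF (mul_ne_zero (pow_ne_zero 2 h2) he0) r
  rw [map_mul, quadraticChar_sq_one' h2, quadraticChar_neg_one_iff_not_isSquare.2 he] at h
  rw [show 1 - quadraticChar F r = 1 + 1 * (-1) * quadraticChar F r by ring, ← h]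
  congr 1
  refine Finset.card_equiv (((Equiv.mulLeft₀ v hv).trans φ.symm).trans (Equiv.prodComm _ _)) ?_
  intro x
  obtain ⟨p, hp⟩ := φ.surjective (v * x)
  simp only [mem_filter, mem_univ, true_and, Equiv.trans_apply, Equiv.mulLeft₀_apply]
  rw [← hp, Equiv.symm_apply_apply, ← mul_pow, ← hp, mul_assoc, ← map_mul, ← hp,
    ← (algebraMap F K).injective.eq_iff (b := r), ← (algebraMap F K).injective.eq_iff (b := r)]
  simp only [algebraMap_norm, algebraMap_trace, hφ, map_add, map_mul, conj_algebraMap, hc,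
      map_pow, map_ofNat, map_neg, ← hwe, Equiv.prodComm_apply, Prod.fst_swap]
  refine Eq.congr ?_ rfl
  ring

end ConjForms

/-! ### Pairs in `K` with given product and given sum of norms -/

section ProductNormPairs

set_option linter.unusedSectionVars false

variable (F : Type*) {K : Type*} [Field F] [Fintype F] [Field K] [Algebra F K]
  [hK : Fact (Module.finrank F K = 2)] [Fintype K] [DecidableEq F] [DecidableEq K]

theorem card_mul_eq_norm_of_ne (hF : ringChar F ≠ 2) (b : K) {h y : F} (hy : h + y ≠ 0)
    (hb : y ^ 2 = h ^ 2 - 4 * Algebra.norm F b) :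
    #{p : K × K | p.1 * p.2 = b ∧ Algebra.norm F p.1 + Algebra.norm F p.2 = h ∧
      Algebra.norm F p.1 - Algebra.norm F p.2 = y} = Fintype.card F + 1 := by
  have h2 : (2 : F) ≠ 0 := Ring.two_ne_zero hF
  have hu : (h + y) / 2 ≠ 0 := div_ne_zero hy h2
  rw [← card_norm_eq F (K := K) hu]
  refine Finset.card_nbij' (fun p => p.1) (fun β => (β, b / β)) ?_ ?_ ?_ ?_
  · rintro ⟨β, γ⟩ hp
    simp only [coe_filter, mem_univ, true_and, Set.mem_ofPred_eq] at hp ⊢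
    obtain ⟨-, h1, h3⟩ := hp
    rw [← h1, ← h3]; field_simp; ring
  · intro β hβ
    simp only [coe_filter, mem_univ, true_and, Set.mem_ofPred_eq] at hβ ⊢
    have hβ0 : β ≠ 0 := by
      rintro rfl; exact hu (by rw [← hβ, (norm_eq_zero_iff F).2 rfl])
    have hγ : Algebra.norm F (b / β) = (h - y) / 2 := by
      have h3 := map_mul (Algebra.norm F) (b / β) β
      rw [div_mul_cancel₀ _ hβ0, hβ] at h3
      apply mul_right_cancel₀ hu
      rw [← h3]
      field_simp
      linear_combination hb
    rw [hβ, hγ]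
    refine ⟨by field_simp, by field_simp; ring, by field_simp; ring⟩
  · rintro ⟨β, γ⟩ hp
    simp only [coe_filter, mem_univ, true_and, Set.mem_ofPred_eq] at hp
    obtain ⟨h0, h1, h3⟩ := hp
    have hβ0 : β ≠ 0 := by
      rintro rfl
      apply hy
      rw [(norm_eq_zero_iff F).2 rfl] at h1 h3
      linear_combination -h1 - h3
    ext
    · rfl
    · simp [← h0]; field_simp
  · intro β _; rfl

/-- Pairs in `K` with given product, given sum and given difference of norms. -/
theorem card_mul_eq_norm (hF : ringChar F ≠ 2) (b : K) (h y : F) :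
    #{p : K × K | p.1 * p.2 = b ∧ Algebra.norm F p.1 + Algebra.norm F p.2 = h ∧
      Algebra.norm F p.1 - Algebra.norm F p.2 = y} =
    if y ^ 2 = h ^ 2 - 4 * Algebra.norm F b then
      (if h = 0 ∧ y = 0 then 1 else Fintype.card F + 1) else 0 := by
  have h2 : (2 : F) ≠ 0 := Ring.two_ne_zero hF
  split_ifs with hb h0
  · obtain ⟨rfl, rfl⟩ := h0
    have hb0 : b = 0 := by
      rw [← norm_eq_zero_iff F]
      have : (2 * 2) * Algebra.norm F b = 0 := by linear_combination hb
      simpa [h2] using this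
    rw [Finset.card_eq_one]
    refine ⟨(0, 0), ?_⟩
    ext ⟨β, γ⟩
    simp only [mem_filter, mem_univ, true_and, mem_singleton, Prod.mk.injEq]
    constructor
    · rintro ⟨-, h1, h3⟩
      rw [← norm_eq_zero_iff F, ← norm_eq_zero_iff F (x := γ)]
      constructor
      · exact mul_left_cancel₀ h2 (by linear_combination h1 + h3)
      · exact mul_left_cancel₀ h2 (by linear_combination h1 - h3)
    · rintro ⟨rfl, rfl⟩
      simp [hb0, (norm_eq_zero_iff F (K := K)).2 rfl]
  · by_cases hy : h + y = 0
    · have hy' : h + -y ≠ 0 := by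
        intro hy'
        refine h0 ⟨mul_left_cancel₀ h2 (by linear_combination hy + hy'),
          mul_left_cancel₀ h2 (by linear_combination hy - hy')⟩
      rw [← card_mul_eq_norm_of_ne F hF b hy' (by rw [neg_sq, hb])]
      refine Finset.card_equiv (Equiv.prodComm _ _) ?_
      rintro ⟨β, γ⟩
      simp only [mem_filter, mem_univ, true_and, Equiv.prodComm_apply, Prod.fst_swap,
        Prod.snd_swap]
      rw [mul_comm, add_comm, ← neg_sub, neg_eq_iff_eq_neg]
    · exact card_mul_eq_norm_of_ne F hF b hy hb
  · rw [Finset.card_eq_zero, Finset.filter_eq_empty_iff]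
    rintro ⟨β, γ⟩ -
    rintro ⟨rfl, rfl, rfl⟩
    apply hb
    rw [map_mul]; ring

/-- Summation of `card_mul_eq_norm` over the difference of the norms; the correction accounts for
the pair `(0, 0)`, which is alone in its fibre. -/
theorem card_mul_eq_norm_add (hF : ringChar F ≠ 2) (b : K) (h : F) :
    (#{p : K × K | p.1 * p.2 = b ∧ Algebra.norm F p.1 + Algebra.norm F p.2 = h} : ℤ) =
      (Fintype.card F + 1) * #{y : F | y ^ 2 = h ^ 2 - 4 * Algebra.norm F b}
      - if h = 0 ∧ b = 0 then (Fintype.card F : ℤ) else 0 := by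
  have h1 : #{p : K × K | p.1 * p.2 = b ∧ Algebra.norm F p.1 + Algebra.norm F p.2 = h} =
      ∑ y : F, #{p : K × K | p.1 * p.2 = b ∧ Algebra.norm F p.1 + Algebra.norm F p.2 = h ∧
        Algebra.norm F p.1 - Algebra.norm F p.2 = y} := by
    rw [Finset.card_eq_sum_card_fiberwise
      (f := fun p : K × K => Algebra.norm F p.1 - Algebra.norm F p.2) (t := univ) (by simp)]
    simp only [filter_filter, and_assoc]
  have h3 : ∀ y : F, ((if y ^ 2 = h ^ 2 - 4 * Algebra.norm F b then
      (if h = 0 ∧ y = 0 then 1 else Fintype.card F + 1) else 0 : ℕ) : ℤ) =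
      (Fintype.card F + 1) * (if y ^ 2 = h ^ 2 - 4 * Algebra.norm F b then 1 else 0)
      - if y = 0 then (if h = 0 ∧ b = 0 then (Fintype.card F : ℤ) else 0) else 0 := by
    intro y
    have h4 : (2 * 2 : F) ≠ 0 := mul_ne_zero (Ring.two_ne_zero hF) (Ring.two_ne_zero hF)
    have h5 : (4 : F) ≠ 0 := by rw [show (4 : F) = 2 * 2 by norm_num]; exact h4
    by_cases hh : h = 0 <;> by_cases hy : y = 0 <;> by_cases hb : b = 0 <;>
      simp [hh, hy, hb, norm_eq_zero_iff F, h5]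
  rw [h1]
  simp_rw [card_mul_eq_norm F hF]
  rw [Nat.cast_sum]
  simp_rw [h3]
  rw [Finset.sum_sub_distrib, ← Finset.mul_sum, Finset.sum_ite_eq' univ (0 : F)]
  simp

end ProductNormPairs

/-! ### Binary forms on the fibres of the plane -/

section Fibration

set_option linter.unusedSectionVars false

variable (F : Type*) {K : Type*} [Field F] [Fintype F] [Field K] [Algebra F K]
  [hK : Fact (Module.finrank F K = 2)] [Fintype K] [DecidableEq F] [DecidableEq K]

theorem norm_add_mul_sq (d c x : K) :
    Algebra.norm F (c + conj F d * x ^ 2) = Algebra.norm F c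
      + Algebra.norm F d * Algebra.norm F x ^ 2
      + Algebra.trace F K (conj F (c * d) * x ^ 2) := by
  apply (algebraMap F K).injective
  simp only [algebraMap_norm, algebraMap_trace, map_add, map_mul, map_pow, conj_conj]
  ring

/-- The fibres of the function `s = N(β) - N(γ) - (1 - D) N(δ)` turn the count of vectors into a
count of representations by binary quadratic forms in `δ`. -/
theorem card_sqrt_fibration (d c : K) (h D : F) (hD : Algebra.norm F d = D) :
    #{p : K × F | p.2 ^ 2 = ((1 + D) * Algebra.norm F p.1 - h) ^ 2
        - 4 * Algebra.norm F (c + conj F d * p.1 ^ 2)} =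
    ∑ s : F, #{x : K | (2 * ((1 - D) * s + (1 + D) * h)) * Algebra.norm F x
        + Algebra.trace F K ((4 * conj F (c * d)) * x ^ 2)
        = h ^ 2 - 4 * Algebra.norm F c - s ^ 2} := by
  rw [← card_filter_prod_eq_sum (fun (s : F) (x : K) =>
    (2 * ((1 - D) * s + (1 + D) * h)) * Algebra.norm F x
        + Algebra.trace F K ((4 * conj F (c * d)) * x ^ 2)
        = h ^ 2 - 4 * Algebra.norm F c - s ^ 2)]
  refine Finset.card_nbij' (fun p => (p.2 - (1 - D) * Algebra.norm F p.1, p.1))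
      (fun p => (p.2, p.1 + (1 - D) * Algebra.norm F p.2)) ?_ ?_ ?_ ?_
  · rintro ⟨x, y⟩ hp
    simp only [coe_filter, mem_univ, true_and, Set.mem_ofPred_eq] at hp ⊢
    rw [norm_add_mul_sq, hD] at hp
    have h4 : Algebra.trace F K ((4 * conj F (c * d)) * x ^ 2) =
        4 * Algebra.trace F K (conj F (c * d) * x ^ 2) := by
      rw [mul_assoc, ← smul_eq_mul (4 : F), ← map_smul, Algebra.smul_def, map_ofNat]
    rw [h4]
    linear_combination hp
  · rintro ⟨s, x⟩ hp
    simp only [coe_filter, mem_univ, true_and, Set.mem_ofPred_eq] at hp ⊢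
    rw [norm_add_mul_sq, hD]
    have h4 : Algebra.trace F K ((4 * conj F (c * d)) * x ^ 2) =
        4 * Algebra.trace F K (conj F (c * d) * x ^ 2) := by
      rw [mul_assoc, ← smul_eq_mul (4 : F), ← map_smul, Algebra.smul_def, map_ofNat]
    rw [h4] at hp
    linear_combination hp
  · rintro ⟨x, y⟩ -; ext <;> simp
  · rintro ⟨x, y⟩ -; ext <;> simp

theorem four_ne_zero' (hF : ringChar F ≠ 2) : (4 : F) ≠ 0 := by
  have h2 : (2 : F) ≠ 0 := Ring.two_ne_zero hF
  rw [show (4 : F) = 2 * 2 by norm_num]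
  exact mul_ne_zero h2 h2

theorem norm_four_mul (x : K) : Algebra.norm F (4 * x) = 16 * Algebra.norm F x := by
  apply (algebraMap F K).injective
  simp only [algebraMap_norm, map_mul, map_ofNat]
  ring

/-- Summation over `s`: the nondegenerate forms contribute a character sum, and the values of `s`
with degenerate form are kept apart. -/
theorem sum_card_representations (hF : ringChar F ≠ 2) {d c : K} (h : F) {D : F}
    (hD : Algebra.norm F d = D) (hd : D ≠ 0) (hD1 : D ≠ 1) (hc : c ≠ 0) :
    (∑ s : F, #{x : K | (2 * ((1 - D) * s + (1 + D) * h)) * Algebra.norm F x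
        + Algebra.trace F K ((4 * conj F (c * d)) * x ^ 2)
        = h ^ 2 - 4 * Algebra.norm F c - s ^ 2} : ℤ) =
    Fintype.card F ^ 2 - 1
      - Fintype.card F * ∑ s : F with s ^ 2 = h ^ 2 - 4 * Algebra.norm F c,
          quadraticChar F (((1 - D) * s + (1 + D) * h) ^ 2 - 16 * (Algebra.norm F c * D))
      + ∑ s : F with ((1 - D) * s + (1 + D) * h) ^ 2 - 16 * (Algebra.norm F c * D) = 0,
        (#{x : K | (2 * ((1 - D) * s + (1 + D) * h)) * Algebra.norm F x
        + Algebra.trace F K ((4 * conj F (c * d)) * x ^ 2)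
        = h ^ 2 - 4 * Algebra.norm F c - s ^ 2} - (Fintype.card F : ℤ)) := by
  have h2 : (2 : F) ≠ 0 := Ring.two_ne_zero hF
  have h4 := four_ne_zero' F hF
  have h16 : (16 : F) ≠ 0 := by rw [show (16 : F) = 4 * 4 by norm_num]; exact mul_ne_zero h4 h4
  have he : 1 - D ≠ 0 := sub_ne_zero.2 (Ne.symm hD1)
  have hNc : Algebra.norm F c ≠ 0 := by rwa [Ne, norm_eq_zero_iff F]
  have hdisc : ∀ s : F, (2 * ((1 - D) * s + (1 + D) * h)) ^ 2
      - 4 * Algebra.norm F (4 * conj F (c * d)) =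
      2 ^ 2 * (((1 - D) * s + (1 + D) * h) ^ 2 - 16 * (Algebra.norm F c * D)) := by
    intro s
    rw [norm_four_mul, norm_conj, map_mul, hD]; ring
  have hsum := sum_quadraticChar_affine_sq_sub hF he ((1 + D) * h)
    (mul_ne_zero h16 (mul_ne_zero hNc hd))
  have hterm : ∀ s : F, (#{x : K | (2 * ((1 - D) * s + (1 + D) * h)) * Algebra.norm F x
        + Algebra.trace F K ((4 * conj F (c * d)) * x ^ 2)
        = h ^ 2 - 4 * Algebra.norm F c - s ^ 2} : ℤ) =
      Fintype.card F
      + quadraticChar F (((1 - D) * s + (1 + D) * h) ^ 2 - 16 * (Algebra.norm F c * D))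
      - Fintype.card F * (if s ^ 2 = h ^ 2 - 4 * Algebra.norm F c then
          quadraticChar F (((1 - D) * s + (1 + D) * h) ^ 2 - 16 * (Algebra.norm F c * D)) else 0)
      + (if ((1 - D) * s + (1 + D) * h) ^ 2 - 16 * (Algebra.norm F c * D) = 0 then
        (#{x : K | (2 * ((1 - D) * s + (1 + D) * h)) * Algebra.norm F x
        + Algebra.trace F K ((4 * conj F (c * d)) * x ^ 2)
        = h ^ 2 - 4 * Algebra.norm F c - s ^ 2} - (Fintype.card F : ℤ)) else 0) := by
    intro s
    by_cases hs : ((1 - D) * s + (1 + D) * h) ^ 2 - 16 * (Algebra.norm F c * D) = 0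
    · simp [hs]
    · rw [card_norm_add_trace_eq F hF (by rw [hdisc]; exact mul_ne_zero (pow_ne_zero 2 h2) hs),
        hdisc, map_mul, quadraticChar_sq_one' h2, one_mul, if_neg hs]
      have hiff : h ^ 2 - 4 * Algebra.norm F c - s ^ 2 = 0 ↔
          s ^ 2 = h ^ 2 - 4 * Algebra.norm F c := by rw [sub_eq_zero, eq_comm]
      simp only [hiff]
      split_ifs <;> ring
  rw [Finset.sum_congr rfl (fun s _ => hterm s), sum_add_distrib, sum_sub_distrib, sum_add_distrib,
    hsum, ← mul_sum, sum_filter, sum_filter]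
  simp
  ring

/-- On the fibres with `s² = κ` the discriminant is a square. -/
theorem sum_quadraticChar_disc (hF : ringChar F ≠ 2) {c : K} (h : F) {D : F}
    (hA : 1 + D ≠ 0) :
    ∑ s : F with s ^ 2 = h ^ 2 - 4 * Algebra.norm F c,
          quadraticChar F (((1 - D) * s + (1 + D) * h) ^ 2 - 16 * (Algebra.norm F c * D)) =
    1 + quadraticChar F (h ^ 2 - 4 * Algebra.norm F c)
      - if D * h ^ 2 = (1 + D) ^ 2 * Algebra.norm F c then 1 else 0 := by
  have h4 := four_ne_zero' F hF
  have hsq : ∀ s : F, s ^ 2 = h ^ 2 - 4 * Algebra.norm F c →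
      ((1 - D) * s + (1 + D) * h) ^ 2 - 16 * (Algebra.norm F c * D) =
        ((1 + D) * s + (1 - D) * h) ^ 2 := by
    intro s hs
    linear_combination (-4 * D) * hs
  have hroot : ∀ s : F, (s ^ 2 = h ^ 2 - 4 * Algebra.norm F c ∧ (1 + D) * s + (1 - D) * h = 0) ↔
      s = - (1 - D) * h / (1 + D) ∧ D * h ^ 2 = (1 + D) ^ 2 * Algebra.norm F c := by
    intro s
    constructor
    · rintro ⟨hs, h0⟩
      refine ⟨by field_simp; linear_combination h0, mul_left_cancel₀ h4 ?_⟩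
      linear_combination (-(1 + D) ^ 2) * hs + ((1 + D) * s - (1 - D) * h) * h0
    · rintro ⟨rfl, h0⟩
      refine ⟨?_, by field_simp; ring⟩
      field_simp
      linear_combination (-4) * h0
  have hterm : ∀ s ∈ (univ.filter fun s : F => s ^ 2 = h ^ 2 - 4 * Algebra.norm F c),
      quadraticChar F (((1 - D) * s + (1 + D) * h) ^ 2 - 16 * (Algebra.norm F c * D)) =
      1 - if (1 + D) * s + (1 - D) * h = 0 then 1 else 0 := by
    intro s hs
    rw [hsq s (by simpa using hs)]
    split_ifs with h0
    · simp [h0]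
    · rw [quadraticChar_sq_one' h0]; norm_num
  rw [Finset.sum_congr rfl hterm, sum_sub_distrib, ← card_sq_eq hF, ← sum_filter, filter_filter]
  simp only [hroot]
  split_ifs with h0
  · simp [h0, Finset.filter_eq']
  · simp [h0]

end Fibration

/-! ### Degenerate fibres and the number of vectors -/

section DegenerateFibres

set_option linter.unusedSectionVars false

variable (F : Type*) {K : Type*} [Field F] [Fintype F] [Field K] [Algebra F K]
  [hK : Fact (Module.finrank F K = 2)] [Fintype K] [DecidableEq F] [DecidableEq K]

/-- A square root `j` of `-1/D` in `K` has norm `-χ(-D)/D`. -/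
theorem exists_sq_eq_neg_inv (hF : ringChar F ≠ 2) {D : F} (hd : D ≠ 0) :
    ∃ j : K, j ≠ 0 ∧ j ^ 2 = - 1 / algebraMap F K D ∧
      ((quadraticChar F (-D) = 1 ∧ Algebra.norm F j = -1 / D) ∨
        (quadraticChar F (-D) = -1 ∧ Algebra.norm F j = 1 / D)) := by
  obtain ⟨j, hj⟩ := exists_sq_eq_algebraMap F (K := K) hF (-1 / D)
  have hj' : j ^ 2 = - 1 / algebraMap F K D := by rw [hj]; simp
  have hj0 : j ≠ 0 := by
    rintro rfl
    rw [zero_pow two_ne_zero, eq_comm, div_eq_zero_iff] at hj'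
    simp [hd] at hj'
  refine ⟨j, hj0, hj', ?_⟩
  rcases conj_eq_self_or_neg F hj with hc | hc
  · left
    obtain ⟨t, rfl⟩ := exists_algebraMap_eq F hc
    have ht : t ^ 2 = -1 / D := (algebraMap F K).injective (by rw [map_pow, hj])
    refine ⟨?_, by rw [norm_algebraMap_eq, ht]⟩
    have : -D = (D * t) ^ 2 := by rw [mul_pow, ht]; field_simp
    rw [this, quadraticChar_sq_one']
    rintro h0
    rw [h0] at this
    simp [hd] at this
  · right
    refine ⟨?_, (algebraMap F K).injective ?_⟩
    · rw [quadraticChar_neg_one_iff_not_isSquare]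
      rintro ⟨t, ht⟩
      have h1 : j ^ 2 = (algebraMap F K (t / D)) ^ 2 := by
        rw [hj, ← map_pow]
        congr 1
        field_simp
        linear_combination ht
      have h3 : conj F j = j := by
        rcases sq_eq_sq_iff_eq_or_eq_neg.1 h1 with h | h <;> rw [h] <;> simp
      rw [hc] at h3
      have h4 : 2 * j = 0 := by linear_combination -h3
      simp [two_ne_zero_ext F (K := K) hF, hj0] at h4
    · rw [algebraMap_norm, hc, map_div₀, map_one]
      linear_combination -hj'

theorem quadraticChar_neg_mul_sq (D x : F) :
    quadraticChar F (-D * x ^ 2) = if x = 0 then 0 else quadraticChar F (-D) := by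
  split_ifs with h
  · simp [h]
  · rw [map_mul, quadraticChar_sq_one' h, mul_one]

/-- The degenerate forms and the exceptional point together. -/
theorem sum_degenerate (hF : ringChar F ≠ 2) {d c : K} (h : F) {D : F}
    (hD : Algebra.norm F d = D) (hd : D ≠ 0) (hD1 : D ≠ 1) (hA : 1 + D ≠ 0) (hc : c ≠ 0) :
    ∑ s : F with ((1 - D) * s + (1 + D) * h) ^ 2 - 16 * (Algebra.norm F c * D) = 0,
        ((#{x : K | (2 * ((1 - D) * s + (1 + D) * h)) * Algebra.norm F x
        + Algebra.trace F K ((4 * conj F (c * d)) * x ^ 2)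
        = h ^ 2 - 4 * Algebra.norm F c - s ^ 2} : ℤ) - (Fintype.card F : ℤ)) +
      Fintype.card F * (if D * h ^ 2 = (1 + D) ^ 2 * Algebra.norm F c then 1 else 0) =
    Fintype.card F * #{x : K | (1 + D) * Algebra.norm F x - h = 0 ∧ c + conj F d * x ^ 2 = 0} := by
  have h2 : (2 : F) ≠ 0 := Ring.two_ne_zero hF
  have h4 := four_ne_zero' F hF
  have h2K := two_ne_zero_ext F (K := K) hF
  have he : 1 - D ≠ 0 := sub_ne_zero.2 (Ne.symm hD1)
  have hd0 : d ≠ 0 := by rw [Ne, ← norm_eq_zero_iff F, hD]; exact hd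
  have hdD : d * conj F d = algebraMap F K D := by rw [← algebraMap_norm, hD]
  by_cases hsq : IsSquare (Algebra.norm F (c * d))
  · obtain ⟨v, hv⟩ := exists_sq_eq_of_isSquare_norm F hF hsq
    have hv0 : v ≠ 0 := by
      rintro rfl
      exact mul_ne_zero hc hd0 (by rw [← hv]; simp)
    set n := Algebra.norm F v with hn
    have hn0 : n ≠ 0 := by rwa [Ne, hn, norm_eq_zero_iff F]
    have hn2 : Algebra.norm F c * D = n ^ 2 := by rw [hn, ← map_pow, hv, map_mul, hD]
    have hNc' : Algebra.norm F c = n ^ 2 / D := by field_simp; exact hn2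
    obtain ⟨j, hj0, hj, hjN⟩ := exists_sq_eq_neg_inv F (K := K) hF hd
    -- the two values of `s` whose form is degenerate
    set s₁ : F := (4 * n - (1 + D) * h) / (1 - D) with hs₁
    set s₂ : F := (-4 * n - (1 + D) * h) / (1 - D) with hs₂
    have hne : s₁ ≠ s₂ := by
      intro heq
      rw [hs₁, hs₂, div_left_inj' he] at heq
      have : 2 * 4 * n = 0 := by linear_combination heq
      simp [h2, h4, hn0] at this
    have hset : (univ.filter fun s : F =>
        ((1 - D) * s + (1 + D) * h) ^ 2 - 16 * (Algebra.norm F c * D) = 0) = {s₁, s₂} := by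
      ext s
      simp only [mem_filter, mem_univ, true_and, mem_insert, mem_singleton]
      rw [hn2, hs₁, hs₂, eq_div_iff he, eq_div_iff he]
      have : ((1 - D) * s + (1 + D) * h) ^ 2 - 16 * n ^ 2 =
        (s * (1 - D) - (4 * n - (1 + D) * h)) * (s * (1 - D) - (-4 * n - (1 + D) * h)) := by ring
      rw [this, mul_eq_zero, sub_eq_zero, sub_eq_zero]
    have hm : 4 * conj F (c * d) = (2 * conj F v) ^ 2 := by rw [← hv, map_pow]; ring
    have hNv : Algebra.norm F (2 * conj F v) = 4 * n := by
      apply (algebraMap F K).injective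
      simp only [algebraMap_norm, map_mul, map_ofNat, conj_conj, hn]
      ring
    have hv2 : 2 * conj F v ≠ 0 := mul_ne_zero h2K (conj_ne_zero F hv0)
    have hk₁ : 2 * ((1 - D) * s₁ + (1 + D) * h) = 2 * Algebra.norm F (2 * conj F v) := by
      rw [hNv, hs₁]; field_simp; ring
    have hk₂ : 2 * ((1 - D) * s₂ + (1 + D) * h) = -2 * Algebra.norm F (2 * conj F v) := by
      rw [hNv, hs₂]; field_simp; ring
    have hr₁ : h ^ 2 - 4 * Algebra.norm F c - s₁ ^ 2 =
        -D * (2 * (h - (1 + D) * n / D) / (1 - D)) ^ 2 := by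
      rw [hNc', hs₁]; field_simp; ring
    have hr₂ : h ^ 2 - 4 * Algebra.norm F c - s₂ ^ 2 =
        -D * (2 * (h + (1 + D) * n / D) / (1 - D)) ^ 2 := by
      rw [hNc', hs₂]; field_simp; ring
    have hz : ∀ x : F, 2 * x / (1 - D) = 0 ↔ x = 0 := by
      intro x; simp [h2, he]
    have hfac : D * h ^ 2 = (1 + D) ^ 2 * Algebra.norm F c ↔
        (h - (1 + D) * n / D = 0 ∨ h + (1 + D) * n / D = 0) := by
      rw [← mul_eq_zero, hNc']
      constructor
      · intro h0
        apply mul_left_cancel₀ hd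
        field_simp at h0 ⊢
        linear_combination h0
      · intro h0
        field_simp at h0 ⊢
        linear_combination h0
    have hexc : ¬ (h - (1 + D) * n / D = 0 ∧ h + (1 + D) * n / D = 0) := by
      rintro ⟨h0, h1⟩
      have h3 : 2 * ((1 + D) * n / D) = 0 := by linear_combination h1 - h0
      simp [h2, hA, hn0, hd] at h3
    -- the exceptional solutions are `δ = ± j v`
    have hjv : j * v ≠ -(j * v) := by
      intro h0
      have : 2 * (j * v) = 0 := by linear_combination h0
      simp [h2K, hj0, hv0] at this
    have hsol : ∀ x : K, c + conj F d * x ^ 2 = 0 ↔ x = j * v ∨ x = -(j * v) := by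
      intro x
      rw [← sq_eq_sq_iff_eq_or_eq_neg, mul_pow, hj, hv, ← hdD]
      have hcd := conj_ne_zero F hd0
      constructor
      · intro h0
        field_simp
        linear_combination h0
      · intro h0
        rw [h0]
        field_simp
        ring
    have hcount : (#{x : K | (1 + D) * Algebra.norm F x - h = 0 ∧ c + conj F d * x ^ 2 = 0} : ℤ) =
        if (1 + D) * (Algebra.norm F j * n) - h = 0 then 2 else 0 := by
      have : (univ.filter fun x : K => (1 + D) * Algebra.norm F x - h = 0 ∧
          c + conj F d * x ^ 2 = 0) =
          if (1 + D) * (Algebra.norm F j * n) - h = 0 then {j * v, -(j * v)} else ∅ := by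
        ext x
        simp only [mem_filter, mem_univ, true_and, hsol]
        have hN : x = j * v ∨ x = -(j * v) → Algebra.norm F x = Algebra.norm F j * n := by
          rintro (rfl | rfl)
          · rw [map_mul]
          · rw [norm_neg, map_mul]
        split_ifs with h0
        · simp only [mem_insert, mem_singleton]
          exact ⟨fun hx => hx.2, fun hx => ⟨by rw [hN hx, h0], hx⟩⟩
        · simp only [notMem_empty, iff_false]
          rintro ⟨h1, hx⟩
          rw [hN hx] at h1
          exact h0 h1
      rw [this]
      split_ifs
      · rw [card_pair hjv]; rfl
      · rfl
    rw [hset, sum_pair hne, hk₁, hk₂, hm, card_degenerate_add F hF hv2,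
      card_degenerate_sub F hF hv2, hcount, hr₁, hr₂, quadraticChar_neg_mul_sq,
      quadraticChar_neg_mul_sq]
    simp only [hz, hfac]
    rcases hjN with ⟨hchi, hN⟩ | ⟨hchi, hN⟩
    · have h0 : (1 + D) * (Algebra.norm F j * n) - h = 0 ↔ h + (1 + D) * n / D = 0 := by
        rw [hN]
        constructor <;> intro h0 <;> field_simp at h0 ⊢ <;> linear_combination -h0
      rw [hchi]
      simp only [h0]
      by_cases h5 : h - (1 + D) * n / D = 0 <;> by_cases h6 : h + (1 + D) * n / D = 0
      · exact absurd ⟨h5, h6⟩ hexc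
      all_goals simp [h5, h6]; try ring
    · have h0 : (1 + D) * (Algebra.norm F j * n) - h = 0 ↔ h - (1 + D) * n / D = 0 := by
        rw [hN]
        constructor <;> intro h0 <;> field_simp at h0 ⊢ <;> linear_combination -h0
      rw [hchi]
      simp only [h0]
      by_cases h5 : h - (1 + D) * n / D = 0 <;> by_cases h6 : h + (1 + D) * n / D = 0
      · exact absurd ⟨h5, h6⟩ hexc
      all_goals simp [h5, h6]; try ring
  · -- no degenerate form occurs
    rw [map_mul, hD] at hsq
    have h1 : (univ.filter fun s : F =>
        ((1 - D) * s + (1 + D) * h) ^ 2 - 16 * (Algebra.norm F c * D) = 0) = ∅ := by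
      rw [Finset.filter_eq_empty_iff]
      intro s _ hs
      refine hsq ⟨((1 - D) * s + (1 + D) * h) / 4, ?_⟩
      field_simp
      linear_combination -hs
    have h3 : ¬ D * h ^ 2 = (1 + D) ^ 2 * Algebra.norm F c := by
      intro hs
      refine hsq ⟨D * h / (1 + D), ?_⟩
      field_simp
      linear_combination -hs
    have h5 : (univ.filter fun x : K => (1 + D) * Algebra.norm F x - h = 0 ∧
        c + conj F d * x ^ 2 = 0) = ∅ := by
      rw [Finset.filter_eq_empty_iff]
      rintro x _ ⟨-, hx⟩
      refine hsq ⟨D * Algebra.norm F x, ?_⟩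
      have : c = - (conj F d * x ^ 2) := by linear_combination hx
      rw [this, norm_neg, map_mul, norm_conj, hD, map_pow]
      ring
    rw [h1, h5, if_neg h3]
    simp

/-- The number of vectors `(-dᵠ δ, β, γ, δ)` of the plane `P^⊥` with `Q = c ≠ 0` and `H = h`.
The last term stems from the line joining `P` to its image under `σ`, which meets `P^⊥` in the
point with `β = γ = 0`. -/
theorem card_plane_vectors (hF : ringChar F ≠ 2) {d c : K} (h : F) {D : F}
    (hD : Algebra.norm F d = D) (hd : D ≠ 0) (hD1 : D ≠ 1) (hA : 1 + D ≠ 0) (hc : c ≠ 0) :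
    (#{p : K × K × K | -(conj F d * p.1 ^ 2) - p.2.1 * p.2.2 = c ∧
      (1 + D) * Algebra.norm F p.1 - Algebra.norm F p.2.1 - Algebra.norm F p.2.2 = h} : ℤ) =
    (Fintype.card F + 1) * (Fintype.card F ^ 2 - Fintype.card F - 1
      - Fintype.card F * quadraticChar F (h ^ 2 - 4 * Algebra.norm F c))
    + Fintype.card F ^ 2 *
      #{x : K | (1 + D) * Algebra.norm F x - h = 0 ∧ c + conj F d * x ^ 2 = 0} := by
  have h1 : #{p : K × K × K | -(conj F d * p.1 ^ 2) - p.2.1 * p.2.2 = c ∧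
      (1 + D) * Algebra.norm F p.1 - Algebra.norm F p.2.1 - Algebra.norm F p.2.2 = h} =
      ∑ x : K, #{p : K × K | p.1 * p.2 = -(c + conj F d * x ^ 2) ∧
        Algebra.norm F p.1 + Algebra.norm F p.2 = (1 + D) * Algebra.norm F x - h} := by
    rw [← card_filter_prod_eq_sum (fun (x : K) (p : K × K) => p.1 * p.2 = -(c + conj F d * x ^ 2) ∧
        Algebra.norm F p.1 + Algebra.norm F p.2 = (1 + D) * Algebra.norm F x - h)]
    congr 1
    ext ⟨x, β, γ⟩
    simp only [mem_filter, mem_univ, true_and]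
    constructor <;> rintro ⟨h0, h1⟩ <;> constructor
    · linear_combination -h0
    · linear_combination -h1
    · linear_combination -h0
    · linear_combination -h1
  have h3 : (∑ x : K, #{y : F | y ^ 2 = ((1 + D) * Algebra.norm F x - h) ^ 2
        - 4 * Algebra.norm F (c + conj F d * x ^ 2)}) =
      #{p : K × F | p.2 ^ 2 = ((1 + D) * Algebra.norm F p.1 - h) ^ 2
        - 4 * Algebra.norm F (c + conj F d * p.1 ^ 2)} := by
    rw [← card_filter_prod_eq_sum (fun (x : K) (y : F) =>
      y ^ 2 = ((1 + D) * Algebra.norm F x - h) ^ 2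
        - 4 * Algebra.norm F (c + conj F d * x ^ 2))]
  rw [h1, Nat.cast_sum]
  simp_rw [card_mul_eq_norm_add F hF, norm_neg, neg_eq_zero]
  rw [sum_sub_distrib, ← mul_sum, ← Nat.cast_sum, h3, card_sqrt_fibration F d c h D hD,
    Nat.cast_sum, sum_card_representations F hF h hD hd hD1 hc, sum_quadraticChar_disc F hF h hA]
  have h5 := sum_degenerate F hF h hD hd hD1 hA hc
  rw [← eq_sub_iff_add_eq] at h5
  rw [h5, ← sum_filter, sum_const, nsmul_eq_mul]
  ring

end DegenerateFibres

/-! ### The quadratic and the Hermitian form, and the collineation `σ` -/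

section Forms

set_option linter.unusedSectionVars false

variable (F : Type*) {K : Type*} [Field F] [Fintype F] [Field K] [Algebra F K]

/-- The polar form of `quad`. -/
def polar (M N : Matrix (Fin 2) (Fin 2) K) : K :=
  M 0 0 * N 1 1 + M 1 1 * N 0 0 - M 0 1 * N 1 0 - M 1 0 * N 0 1

theorem sigmaMap_smul (c : K) (M : Matrix (Fin 2) (Fin 2) K) :
    sigmaMap F (c • M) = conj F c • sigmaMap F M := (sigmaMap F).map_smulₛₗ c M

theorem sigmaMap_eq (M : Matrix (Fin 2) (Fin 2) K) : sigmaMap F M =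
    !![conj F (M 1 1), conj F (M 1 0); conj F (M 0 1), conj F (M 0 0)] := by
  ext i j
  fin_cases i <;> fin_cases j <;> rfl

theorem quad_smul (c : K) (M : Matrix (Fin 2) (Fin 2) K) : quad (c • M) = c ^ 2 * quad M := by
  simp [quad]; ring

theorem polar_comb_self (x y : K) (M N : Matrix (Fin 2) (Fin 2) K) :
    quad (x • M + y • N) = x ^ 2 * quad M + x * y * polar M N + y ^ 2 * quad N := by
  simp [quad, polar]; ring

theorem hermForm_eq_polar (M N : Matrix (Fin 2) (Fin 2) K) :
    hermForm F M N = polar M (sigmaMap F N) := by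
  simp [hermForm, polar, sigmaMap_eq, conj_apply]; ring

theorem herm_eq_hermForm (M : Matrix (Fin 2) (Fin 2) K) : herm F M = hermForm F M M := by
  simp only [herm, hermForm, pow_succ']

theorem herm_eq_polar (M : Matrix (Fin 2) (Fin 2) K) : herm F M = polar M (sigmaMap F M) := by
  rw [herm_eq_hermForm, hermForm_eq_polar]

theorem polar_self (M : Matrix (Fin 2) (Fin 2) K) : polar M M = 2 * quad M := by
  simp [quad, polar]; ring

theorem polar_comb_comb (x y z w : K) (M N : Matrix (Fin 2) (Fin 2) K) :
    polar (x • M + y • N) (z • M + w • N) =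
      2 * x * z * quad M + (x * w + y * z) * polar M N + 2 * y * w * quad N := by
  simp [quad, polar]; ring

theorem polar_smul_left (c : K) (M N : Matrix (Fin 2) (Fin 2) K) :
    polar (c • M) N = c * polar M N := by
  simp [polar]; ring

theorem polar_smul_right (c : K) (M N : Matrix (Fin 2) (Fin 2) K) :
    polar M (c • N) = c * polar M N := by
  simp [polar]; ring

theorem quad_sigmaMap (M : Matrix (Fin 2) (Fin 2) K) :
    quad (sigmaMap F M) = conj F (quad M) := by
  simp [quad, sigmaMap_eq]; ring

theorem polar_sigmaMap (M N : Matrix (Fin 2) (Fin 2) K) :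
    polar (sigmaMap F M) (sigmaMap F N) = conj F (polar M N) := by
  simp [polar, sigmaMap_eq]; ring

theorem herm_smul (c : K) (M : Matrix (Fin 2) (Fin 2) K) :
    herm F (c • M) = (c * conj F c) * herm F M := by
  rw [herm_eq_polar, herm_eq_polar, sigmaMap_smul, polar_smul_left, polar_smul_right]; ring

theorem hermForm_smul_left (c : K) (M N : Matrix (Fin 2) (Fin 2) K) :
    hermForm F (c • M) N = c * hermForm F M N := by
  rw [hermForm_eq_polar, hermForm_eq_polar, polar_smul_left]

variable [hK : Fact (Module.finrank F K = 2)]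

@[simp]
theorem sigmaMap_sigmaMap (M : Matrix (Fin 2) (Fin 2) K) : sigmaMap F (sigmaMap F M) = M := by
  ext i j
  fin_cases i <;> fin_cases j <;> simp [sigmaMap_eq]

/-- The value of the Hermitian form as an element of `F`. -/
noncomputable def hermVal (M : Matrix (Fin 2) (Fin 2) K) : F :=
  Algebra.norm F (M 0 0) - Algebra.norm F (M 0 1) - Algebra.norm F (M 1 0)
    + Algebra.norm F (M 1 1)

theorem algebraMap_hermVal (M : Matrix (Fin 2) (Fin 2) K) :
    algebraMap F K (hermVal F M) = herm F M := by
  simp [hermVal, herm, algebraMap_norm, pow_card_add_one]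

theorem herm_eq_zero_iff (M : Matrix (Fin 2) (Fin 2) K) : herm F M = 0 ↔ hermVal F M = 0 := by
  rw [← algebraMap_hermVal]; simp

theorem algebraMap_sq_disc (M : Matrix (Fin 2) (Fin 2) K) :
    herm F M ^ 2 = 4 * (quad M * conj F (quad M)) ↔
      hermVal F M ^ 2 = 4 * Algebra.norm F (quad M) := by
  rw [← (algebraMap F K).injective.eq_iff, map_pow, algebraMap_hermVal, map_mul, algebraMap_norm,
    map_ofNat]

/-- The quadratic form on the `σ`-fixed vectors `x M + xᵠ σ(M)` of a line. -/
theorem quad_add_sigmaMap (M : Matrix (Fin 2) (Fin 2) K) (x : K) :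
    quad (x • M + conj F x • sigmaMap F M) = algebraMap F K (hermVal F M * Algebra.norm F x
      + Algebra.trace F K (quad M * x ^ 2)) := by
  rw [polar_comb_self, map_add, map_mul, algebraMap_hermVal, algebraMap_norm, algebraMap_trace,
    quad_sigmaMap, ← herm_eq_polar, map_mul, map_pow]
  ring

end Forms

/-! ### Points and vectors -/

section Points

set_option linter.unusedSectionVars false

variable (F : Type*) {K : Type*} [Field F] [Fintype F] [Field K] [Algebra F K]
  [hK : Fact (Module.finrank F K = 2)]

/-- The number of vectors representing the points with a given scaling invariant property. -/
theorem ncard_vectors {p : Matrix (Fin 2) (Fin 2) K → Prop}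
    (hp : ∀ (c : K) M, c ≠ 0 → (p (c • M) ↔ p M)) :
    {M | M ≠ 0 ∧ p M}.ncard = {P : Pt K | p P.rep}.ncard * (Fintype.card F ^ 2 - 1) := by
  classical
  have := finite_of_finrank_eq_two F (K := K)
  have := Fintype.ofFinite K
  let f : {P : Pt K | p P.rep} × Kˣ → {M | M ≠ 0 ∧ p M} := fun x =>
    ⟨(x.2 : K) • x.1.1.rep, smul_ne_zero x.2.ne_zero x.1.1.rep_nonzero,
      (hp _ _ x.2.ne_zero).2 x.1.2⟩
  have hf : Function.Bijective f := by
    constructor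
    · rintro ⟨⟨P, hP⟩, c⟩ ⟨⟨P', hP'⟩, c'⟩ h
      have h : (c : K) • P.rep = (c' : K) • P'.rep := congrArg Subtype.val h
      have hPP : P = P' := by
        rw [← P.mk_rep, ← P'.mk_rep, Projectivization.mk_eq_mk_iff']
        refine ⟨(c : K)⁻¹ * c', ?_⟩
        rw [mul_smul, ← h, smul_smul, inv_mul_cancel₀ c.ne_zero, one_smul]
      subst hPP
      have : c = c' := Units.ext (smul_left_injective K P.rep_nonzero h)
      rw [this]
    · rintro ⟨M, hM, hpM⟩
      obtain ⟨a, ha⟩ := Projectivization.exists_smul_eq_mk_rep K M hM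
      refine ⟨⟨⟨Projectivization.mk K M hM, ?_⟩, a⁻¹⟩, Subtype.ext ?_⟩
      · change p (Projectivization.mk K M hM).rep
        rw [← ha]; exact (hp a M a.ne_zero).2 hpM
      · change ((a⁻¹ : Kˣ) : K) • (Projectivization.mk K M hM).rep = M
        rw [← ha, Units.smul_def, smul_smul, Units.inv_mul, one_smul]
  have h := Nat.card_congr (Equiv.ofBijective f hf)
  rw [Nat.card_prod, Nat.card_coe_set_eq, Nat.card_coe_set_eq] at h
  rw [← h, Nat.card_eq_fintype_card, Fintype.card_units, card_eq_sq F]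

theorem mem_subgeometry_iff (P : Pt K) :
    P ∈ subgeometry F K ↔ ∃ c : K, sigmaMap F P.rep = c • P.rep := by
  have h0 : sigmaMap F P.rep ≠ 0 := by
    rw [Ne, ← map_zero (sigmaMap F), (sigmaMap_injective F).eq_iff]; exact P.rep_nonzero
  have h : sigma F P = Projectivization.mk K (sigmaMap F P.rep) h0 := by
    conv_lhs => rw [← P.mk_rep]
    rfl
  change sigma F P = P ↔ _
  rw [h]
  conv_lhs => rhs; rw [← P.mk_rep]
  rw [Projectivization.mk_eq_mk_iff']
  exact ⟨fun ⟨c, hc⟩ => ⟨c, hc.symm⟩, fun ⟨c, hc⟩ => ⟨c, hc.symm⟩⟩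

/-- A point of `Σ` is represented by a vector fixed by `σ`. -/
theorem exists_fixed_vector {M : Matrix (Fin 2) (Fin 2) K} (hM : M ≠ 0) {c : K}
    (hc : sigmaMap F M = c • M) :
    ∃ a : K, a ≠ 0 ∧ sigmaMap F (a • M) = a • M := by
  have h1 : conj F c * c = 1 := by
    have h := congrArg (sigmaMap F) hc
    rw [sigmaMap_sigmaMap, sigmaMap_smul, hc, smul_smul] at h
    exact (smul_left_injective K hM (by simpa using h)).symm
  obtain ⟨x, hx, hxc⟩ := exists_conj_eq_mul F (c := conj F c) (by rw [conj_conj, h1])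
  refine ⟨x, hx, ?_⟩
  rw [sigmaMap_smul, hxc, hc, smul_smul]
  congr 1
  linear_combination x * h1

theorem smul_fixed_iff {v : Matrix (Fin 2) (Fin 2) K} (hv : v ≠ 0) (hs : sigmaMap F v = v) (c : K) :
    sigmaMap F (c • v) = c • v ↔ ∃ a : F, algebraMap F K a = c := by
  rw [sigmaMap_smul, hs]
  constructor
  · intro h; exact exists_algebraMap_eq F (smul_left_injective K hv h)
  · rintro ⟨a, rfl⟩; rw [conj_algebraMap]

/-- The number of `σ`-fixed vectors representing the points of `Σ` with a given scaling invariant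
property. -/
theorem ncard_fixed_vectors {p : Matrix (Fin 2) (Fin 2) K → Prop}
    (hp : ∀ (c : K) M, c ≠ 0 → (p (c • M) ↔ p M)) :
    {M | M ≠ 0 ∧ sigmaMap F M = M ∧ p M}.ncard =
      {P : Pt K | P ∈ subgeometry F K ∧ p P.rep}.ncard * (Fintype.card F - 1) := by
  classical
  have hex : ∀ P : Pt K, P ∈ subgeometry F K →
      ∃ a : K, a ≠ 0 ∧ sigmaMap F (a • P.rep) = a • P.rep := by
    intro P hP
    obtain ⟨c, hc⟩ := (mem_subgeometry_iff F P).1 hP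
    exact exists_fixed_vector F P.rep_nonzero hc
  choose! g hg0 hg using hex
  let f : {P : Pt K | P ∈ subgeometry F K ∧ p P.rep} × Fˣ →
      {M | M ≠ 0 ∧ sigmaMap F M = M ∧ p M} := fun x =>
    ⟨(algebraMap F K x.2) • (g x.1.1 • x.1.1.rep),
      smul_ne_zero (by simp) (smul_ne_zero (hg0 _ x.1.2.1) x.1.1.rep_nonzero),
      by rw [sigmaMap_smul, hg _ x.1.2.1, conj_algebraMap],
      (hp _ _ (by simp)).2 ((hp _ _ (hg0 _ x.1.2.1)).2 x.1.2.2)⟩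
  have hf : Function.Bijective f := by
    constructor
    · rintro ⟨⟨P, hP⟩, c⟩ ⟨⟨P', hP'⟩, c'⟩ h
      have h : (algebraMap F K c) • (g P • P.rep) = (algebraMap F K c') • (g P' • P'.rep) :=
        congrArg Subtype.val h
      have hc : algebraMap F K c ≠ 0 := by simp
      have hPP : P = P' := by
        rw [← P.mk_rep, ← P'.mk_rep, Projectivization.mk_eq_mk_iff']
        refine ⟨(g P)⁻¹ * ((algebraMap F K c)⁻¹ * (algebraMap F K c' * g P')), ?_⟩
        rw [mul_smul, mul_smul, mul_smul, ← h, smul_smul (algebraMap F K c)⁻¹, inv_mul_cancel₀ hc,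
          one_smul, smul_smul, inv_mul_cancel₀ (hg0 _ hP.1), one_smul]
      subst hPP
      have h1 := smul_left_injective K (smul_ne_zero (hg0 _ hP.1) P.rep_nonzero) h
      have : c = c' := Units.ext ((algebraMap F K).injective h1)
      rw [this]
    · rintro ⟨M, hM, hs, hpM⟩
      obtain ⟨a, ha⟩ := Projectivization.exists_smul_eq_mk_rep K M hM
      set P := Projectivization.mk K M hM with hPdef
      rw [Units.smul_def] at ha
      have hPS : P ∈ subgeometry F K := by
        rw [mem_subgeometry_iff, ← ha, sigmaMap_smul, hs]
        refine ⟨conj F (a : K) * (a : K)⁻¹, ?_⟩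
        rw [smul_smul, mul_assoc, inv_mul_cancel₀ a.ne_zero, mul_one]
      have hv := hg P hPS
      have hv0 := hg0 P hPS
      rw [← ha, smul_smul] at hv
      obtain ⟨t, ht⟩ := (smul_fixed_iff F hM hs _).1 hv
      have ht0 : t ≠ 0 := by
        rintro rfl
        rw [map_zero, eq_comm, mul_eq_zero] at ht
        exact ht.elim hv0 a.ne_zero
      refine ⟨⟨⟨P, hPS, ?_⟩, (Units.mk0 t ht0)⁻¹⟩, Subtype.ext ?_⟩
      · rw [← ha]; exact (hp a M a.ne_zero).2 hpM
      · change (algebraMap F K ((Units.mk0 t ht0)⁻¹ : Fˣ)) • (g P • P.rep) = M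
        rw [← ha, smul_smul, smul_smul, mul_assoc, ← ht, ← map_mul]
        simp [ht0]
  have h := Nat.card_congr (Equiv.ofBijective f hf)
  rw [Nat.card_prod, Nat.card_coe_set_eq, Nat.card_coe_set_eq] at h
  rw [← h, Nat.card_eq_fintype_card, Fintype.card_units]

end Points

/-! ### Lines spanned by a point and its image under `σ` -/

section Lines

set_option linter.unusedSectionVars false

variable (F : Type*) {K : Type*} [Field F] [Fintype F] [Field K] [Algebra F K]
  [hK : Fact (Module.finrank F K = 2)]

theorem mem_pts_iff {L : Submodule K (Matrix (Fin 2) (Fin 2) K)} {P : Pt K} :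
    P ∈ pts L ↔ P.rep ∈ L := by
  rw [pts, Set.mem_ofPred_eq, Projectivization.submodule_eq, Submodule.span_singleton_le_iff_mem]

theorem exists_rep_eq_smul {v : Matrix (Fin 2) (Fin 2) K} (hv : v ≠ 0) :
    ∃ (P : Pt K) (a : K), a ≠ 0 ∧ P.rep = a • v := by
  obtain ⟨a, ha⟩ := Projectivization.exists_smul_eq_mk_rep K v hv
  exact ⟨Projectivization.mk K v hv, a, a.ne_zero, ha.symm⟩

theorem eq_of_rep_eq_smul {P R : Pt K} {c : K} (h : P.rep = c • R.rep) : P = R := by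
  rw [← P.mk_rep, ← R.mk_rep, Projectivization.mk_eq_mk_iff']
  exact ⟨c, h.symm⟩

theorem mem_subgeometry_of_rep {P : Pt K} {v : Matrix (Fin 2) (Fin 2) K}
    (hs : sigmaMap F v = v) {a : K} (ha : a ≠ 0) (h : P.rep = a • v) : P ∈ subgeometry F K := by
  rw [mem_subgeometry_iff, h, sigmaMap_smul, hs]
  exact ⟨conj F a * a⁻¹, by rw [smul_smul, mul_assoc, inv_mul_cancel₀ ha, mul_one]⟩

theorem exists_rep_eq_fixed {P : Pt K} (hP : P ∈ subgeometry F K) :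
    ∃ (v : Matrix (Fin 2) (Fin 2) K) (a : K), a ≠ 0 ∧ v ≠ 0 ∧ sigmaMap F v = v ∧
      P.rep = a • v := by
  obtain ⟨c, hc⟩ := (mem_subgeometry_iff F P).1 hP
  obtain ⟨a, ha, h⟩ := exists_fixed_vector F P.rep_nonzero hc
  refine ⟨a • P.rep, a⁻¹, inv_ne_zero ha, smul_ne_zero ha P.rep_nonzero, h, ?_⟩
  rw [smul_smul, inv_mul_cancel₀ ha, one_smul]

/-- The line joining a point and its image under `σ`. -/
def sigmaSpan (M : Matrix (Fin 2) (Fin 2) K) : Submodule K (Matrix (Fin 2) (Fin 2) K) :=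
  Submodule.span K {M, sigmaMap F M}

theorem mem_sigmaSpan {M v : Matrix (Fin 2) (Fin 2) K} :
    v ∈ sigmaSpan F M ↔ ∃ x y : K, x • M + y • sigmaMap F M = v := Submodule.mem_span_pair

theorem comb_eq_zero {M : Matrix (Fin 2) (Fin 2) K} (hM : ¬ ∃ c : K, sigmaMap F M = c • M)
    {x y : K} (h : x • M + y • sigmaMap F M = 0) : x = 0 ∧ y = 0 := by
  have hM0 : M ≠ 0 := by rintro rfl; exact hM ⟨0, by simp⟩
  have hy : y = 0 := by
    by_contra hy
    refine hM ⟨-(y⁻¹ * x), ?_⟩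
    have h1 := congrArg (fun v => y⁻¹ • v) h
    simp only [smul_add, smul_smul, inv_mul_cancel₀ hy, one_smul, smul_zero] at h1
    rw [neg_smul]; exact eq_neg_of_add_eq_zero_right h1
  subst hy
  simpa [hM0] using h

theorem finrank_sigmaSpan {M : Matrix (Fin 2) (Fin 2) K}
    (hM : ¬ ∃ c : K, sigmaMap F M = c • M) : Module.finrank K (sigmaSpan F M) = 2 := by
  have hli : LinearIndependent K ![M, sigmaMap F M] := by
    rw [LinearIndependent.pair_iff]
    intro s t h
    exact comb_eq_zero F hM h
  have hfr := finrank_span_eq_card hli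
  rw [Matrix.range_cons, Matrix.range_cons, Matrix.range_empty, Set.union_empty,
    Set.singleton_union] at hfr
  exact hfr

/-- The `Σ`-points of the line joining a point outside `Σ` to its image under `σ`, counted by the
fixed vectors `x M + xᵠ σ(M)`. -/
theorem ncard_sigmaSpan {M : Matrix (Fin 2) (Fin 2) K}
    (hM : ¬ ∃ c : K, sigmaMap F M = c • M) {p : Matrix (Fin 2) (Fin 2) K → Prop}
    (hp : ∀ (c : K) M, c ≠ 0 → (p (c • M) ↔ p M)) :
    {P : Pt K | P ∈ pts (sigmaSpan F M) ∩ subgeometry F K ∧ p P.rep}.ncard *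
      (Fintype.card F - 1) = {x : K | x ≠ 0 ∧ p (x • M + conj F x • sigmaMap F M)}.ncard := by
  have h1 := ncard_fixed_vectors F (K := K) (p := fun v => v ∈ sigmaSpan F M ∧ p v) (by
    intro c v hc
    rw [hp c v hc, Submodule.smul_mem_iff _ hc])
  have h2 : {P : Pt K | P ∈ pts (sigmaSpan F M) ∩ subgeometry F K ∧ p P.rep} =
      {P : Pt K | P ∈ subgeometry F K ∧ P.rep ∈ sigmaSpan F M ∧ p P.rep} := by
    ext P
    simp only [Set.mem_inter_iff, mem_pts_iff, Set.mem_ofPred_eq]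
    tauto
  rw [h2, ← h1]
  symm
  refine Set.ncard_congr (fun x _ => x • M + conj F x • sigmaMap F M) ?_ ?_ ?_
  · rintro x ⟨hx, hpx⟩
    refine ⟨fun h0 => hx (comb_eq_zero F hM h0).1, ?_, (mem_sigmaSpan F).2 ⟨_, _, rfl⟩, hpx⟩
    rw [map_add, sigmaMap_smul, sigmaMap_smul, sigmaMap_sigmaMap, conj_conj, add_comm]
  · intro x y _ _ h
    have : (x - y) • M + (conj F x - conj F y) • sigmaMap F M = 0 := by
      rw [sub_smul, sub_smul]
      have h : x • M + conj F x • sigmaMap F M = y • M + conj F y • sigmaMap F M := h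
      rw [sub_add_sub_comm, h, sub_self]
    exact sub_eq_zero.1 (comb_eq_zero F hM this).1
  · rintro v ⟨hv, hs, hvL, hpv⟩
    obtain ⟨x, y, rfl⟩ := (mem_sigmaSpan F).1 hvL
    have h3 : (conj F y - x) • M + (conj F x - y) • sigmaMap F M = 0 := by
      rw [map_add, sigmaMap_smul, sigmaMap_smul, sigmaMap_sigmaMap, add_comm] at hs
      rw [sub_smul, sub_smul, sub_add_sub_comm, hs, sub_self]
    have hy : conj F x = y := sub_eq_zero.1 (comb_eq_zero F hM h3).2
    subst hy
    refine ⟨x, ⟨?_, hpv⟩, rfl⟩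
    rintro rfl
    simp at hv

theorem isSigmaLine_sigmaSpan {M : Matrix (Fin 2) (Fin 2) K}
    (hM : ¬ ∃ c : K, sigmaMap F M = c • M) : IsSigmaLine F (sigmaSpan F M) := by
  refine ⟨finrank_sigmaSpan F hM, ?_⟩
  have h := ncard_sigmaSpan F hM (p := fun _ => True) (by simp)
  have h1 : {x : K | x ≠ 0 ∧ True}.ncard = Fintype.card F ^ 2 - 1 := by
    classical
    have := finite_of_finrank_eq_two F (K := K)
    have := Fintype.ofFinite K
    have h2 : {x : K | x ≠ 0 ∧ True} = ((univ.erase (0 : K) : Finset K) : Set K) := by ext; simp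
    rw [h2, Set.ncard_coe_finset, card_erase_of_mem (mem_univ _), card_univ, card_eq_sq F]
  rw [h1] at h
  simp only [and_true, Set.ofPred_mem_eq] at h
  have hq : 1 < Fintype.card F := Fintype.one_lt_card
  have h3 : Fintype.card F ^ 2 - 1 = (Fintype.card F + 1) * (Fintype.card F - 1) := by
    have := Nat.sq_sub_sq (Fintype.card F) 1
    simpa using this
  rw [h3] at h
  exact Nat.eq_of_mul_eq_mul_right (by omega) h

/-- A `Σ`-line is spanned by any two of its points; here these are two `Σ`-points. -/
theorem IsSigmaLine.exists_comb {L : Submodule K (Matrix (Fin 2) (Fin 2) K)}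
    (hL : IsSigmaLine F L) {v w : Matrix (Fin 2) (Fin 2) K} (hv : v ∈ L) (hw : w ∈ L) (hv0 : v ≠ 0)
    (hvw : ¬ ∃ c : K, w = c • v) {M : Matrix (Fin 2) (Fin 2) K} (hM : M ∈ L) :
    ∃ x y : K, x • v + y • w = M := by
  have hli : LinearIndependent K ![v, w] := by
    rw [LinearIndependent.pair_iff]
    intro s t h
    have ht : t = 0 := by
      by_contra ht
      refine hvw ⟨-(t⁻¹ * s), ?_⟩
      have h1 := congrArg (fun v => t⁻¹ • v) h
      simp only [smul_add, smul_smul, inv_mul_cancel₀ ht, one_smul, smul_zero] at h1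
      rw [neg_smul]; exact eq_neg_of_add_eq_zero_right h1
    subst ht
    simpa [hv0] using h
  have hfr := finrank_span_eq_card hli
  rw [Matrix.range_cons, Matrix.range_cons, Matrix.range_empty, Set.union_empty,
    Set.singleton_union] at hfr
  have hle : Submodule.span K {v, w} ≤ L := by
    rw [Submodule.span_le]; rintro x (rfl | rfl) <;> assumption
  have heq : Submodule.span K {v, w} = L := by
    apply Submodule.eq_of_le_of_finrank_eq hle
    rw [hL.1, hfr]; rfl
  rw [← heq] at hM
  exact Submodule.mem_span_pair.1 hM

theorem IsSigmaLine.exists_ne {L : Submodule K (Matrix (Fin 2) (Fin 2) K)}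
    (hL : IsSigmaLine F L) (P : Pt K) : ∃ R ∈ pts L ∩ subgeometry F K, R ≠ P := by
  apply Set.exists_ne_of_one_lt_ncard
  rw [hL.2]
  have hq : 1 < Fintype.card F := Fintype.one_lt_card
  omega

end Lines

/-! ### The point sets in terms of the two forms -/

section PointSetDescriptions

set_option linter.unusedSectionVars false

variable (F : Type*) {K : Type*} [Field F] [Fintype F] [Field K] [Algebra F K]
  [hK : Fact (Module.finrank F K = 2)]

theorem quad_smul_eq_zero_iff {c : K} (hc : c ≠ 0) (M : Matrix (Fin 2) (Fin 2) K) :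
    quad (c • M) = 0 ↔ quad M = 0 := by
  rw [quad_smul]; simp [hc]

/-- On an extended generator, both forms vanish. -/
theorem IsExtGenerator.quad_herm {L : Submodule K (Matrix (Fin 2) (Fin 2) K)}
    (hL : IsExtGenerator F L) {M : Matrix (Fin 2) (Fin 2) K} (hM : M ∈ L) :
    quad M = 0 ∧ herm F M = 0 := by
  obtain ⟨P, hP, -⟩ := hL.1.exists_ne F (Classical.arbitrary (Pt K))
  obtain ⟨R, hR, hne⟩ := hL.1.exists_ne F P
  obtain ⟨v, a, ha, hv0, hv, hPv⟩ := exists_rep_eq_fixed F hP.2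
  obtain ⟨w, b, hb, hw0, hw, hRw⟩ := exists_rep_eq_fixed F hR.2
  have hvL : v ∈ L := by
    have := (mem_pts_iff).1 hP.1
    rwa [hPv, Submodule.smul_mem_iff _ ha] at this
  have hwL : w ∈ L := by
    have := (mem_pts_iff).1 hR.1
    rwa [hRw, Submodule.smul_mem_iff _ hb] at this
  have hvw : ¬ ∃ c : K, w = c • v := by
    rintro ⟨c, rfl⟩
    refine hne (eq_of_rep_eq_smul (c := b * c * a⁻¹) ?_)
    rw [hPv, hRw, smul_smul, smul_smul, mul_assoc, inv_mul_cancel₀ ha, mul_one]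
  -- every fixed vector of the line is singular
  have hq : ∀ u ∈ L, sigmaMap F u = u → quad u = 0 := by
    intro u huL hu
    by_cases hu0 : u = 0
    · simp [hu0, quad]
    obtain ⟨U, c, hc, hU⟩ := exists_rep_eq_smul hu0
    have hUQ := hL.2 ⟨(mem_pts_iff).2 (by rw [hU]; exact Submodule.smul_mem _ _ huL),
      mem_subgeometry_of_rep F hu hc hU⟩
    have h1 : quad U.rep = 0 := hUQ.1
    rwa [hU, quad_smul_eq_zero_iff hc] at h1
  have hqv := hq v hvL hv
  have hqw := hq w hwL hw
  have hB : polar v w = 0 := by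
    have h1 := hq ((1 : K) • v + (1 : K) • w)
      (L.add_mem (L.smul_mem _ hvL) (L.smul_mem _ hwL)) (by simp [hv, hw])
    rw [polar_comb_self, hqv, hqw] at h1
    simpa using h1
  obtain ⟨x, y, rfl⟩ := hL.1.exists_comb F hvL hwL hv0 hvw hM
  refine ⟨by rw [polar_comb_self, hqv, hqw, hB]; ring, ?_⟩
  rw [herm_eq_polar, map_add, sigmaMap_smul, sigmaMap_smul, hv, hw, polar_comb_comb, hqv, hqw, hB]
  ring

/-- A point of `𝒬 ∩ ℋ` outside `Σ` lies on an extended generator, namely on the line joining it to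
its image under `σ`. -/
theorem mem_T_iff (P : Pt K) :
    P ∈ T F K ↔ quad P.rep = 0 ∧ herm F P.rep = 0 ∧ P ∉ subgeometry F K := by
  constructor
  · rintro ⟨⟨L, hL, hP⟩, hP0⟩
    obtain ⟨hq, hh⟩ := hL.quad_herm F ((mem_pts_iff).1 hP)
    exact ⟨hq, hh, fun h => hP0 ⟨hq, h⟩⟩
  · rintro ⟨hq, hh, hP⟩
    have hM : ¬ ∃ c : K, sigmaMap F P.rep = c • P.rep := by rwa [← mem_subgeometry_iff]
    refine ⟨⟨sigmaSpan F P.rep, ⟨isSigmaLine_sigmaSpan F hM, ?_⟩, ?_⟩, fun h => hP h.2⟩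
    · rintro R ⟨hR, hRS⟩
      refine ⟨?_, hRS⟩
      obtain ⟨x, y, hxy⟩ := (mem_sigmaSpan F).1 ((mem_pts_iff).1 hR)
      change quad R.rep = 0
      rw [← hxy, polar_comb_self, hq, quad_sigmaMap, hq, ← herm_eq_polar, hh]
      simp
    · rw [mem_pts_iff, mem_sigmaSpan]
      exact ⟨1, 0, by simp⟩

/-- Off `Σ`, the points of an extended tangent satisfy `Q ≠ 0` and `H² = 4 Q ^ (q + 1)`. -/
theorem IsExtTangent.quad_herm {L : Submodule K (Matrix (Fin 2) (Fin 2) K)}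
    (hL : IsExtTangent F L) {P : Pt K} (hP : P ∈ pts L) (hPS : P ∉ subgeometry F K) :
    quad P.rep ≠ 0 ∧ herm F P.rep ^ 2 = 4 * (quad P.rep * conj F (quad P.rep)) := by
  obtain ⟨P₀, hP₀⟩ := Set.ncard_eq_one.1 hL.2
  have hP₀mem : P₀ ∈ pts L ∩ Q0 F K := by rw [hP₀]; rfl
  obtain ⟨R, hR, hne⟩ := hL.1.exists_ne F P₀
  obtain ⟨v, a, ha, hv0, hv, hPv⟩ := exists_rep_eq_fixed F hP₀mem.2.2
  obtain ⟨w, b, hb, hw0, hw, hRw⟩ := exists_rep_eq_fixed F hR.2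
  have hvL : v ∈ L := by
    have := (mem_pts_iff).1 hP₀mem.1
    rwa [hPv, Submodule.smul_mem_iff _ ha] at this
  have hwL : w ∈ L := by
    have := (mem_pts_iff).1 hR.1
    rwa [hRw, Submodule.smul_mem_iff _ hb] at this
  have hvw : ¬ ∃ c : K, w = c • v := by
    rintro ⟨c, rfl⟩
    refine hne (eq_of_rep_eq_smul (c := b * c * a⁻¹) ?_)
    rw [hPv, hRw, smul_smul, smul_smul, mul_assoc, inv_mul_cancel₀ ha, mul_one]
  -- `v` spans the only singular fixed point
  have huniq : ∀ u ∈ L, sigmaMap F u = u → quad u = 0 → ∃ c : K, u = c • v := by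
    intro u huL hu hqu
    by_cases hu0 : u = 0
    · exact ⟨0, by simp [hu0]⟩
    obtain ⟨U, c, hc, hU⟩ := exists_rep_eq_smul hu0
    have hUmem : U ∈ pts L ∩ Q0 F K := by
      refine ⟨(mem_pts_iff).2 (by rw [hU]; exact Submodule.smul_mem _ _ huL), ?_,
        mem_subgeometry_of_rep F hu hc hU⟩
      change quad U.rep = 0
      rw [hU, quad_smul_eq_zero_iff hc, hqu]
    rw [hP₀] at hUmem
    have hUP : U = P₀ := hUmem
    rw [hUP, hPv] at hU
    refine ⟨c⁻¹ * a, ?_⟩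
    rw [mul_smul, hU, smul_smul, inv_mul_cancel₀ hc, one_smul]
  have hqv : quad v = 0 := by
    have h1 : quad P₀.rep = 0 := hP₀mem.2.1
    rwa [hPv, quad_smul_eq_zero_iff ha] at h1
  have hqw : quad w ≠ 0 := fun h => hvw (huniq w hwL hw h)
  have hB : polar v w = 0 := by
    by_contra hB
    -- otherwise `v - (B(v, w) / Q(w)) w` spans a second singular point
    set t : K := -(polar v w) / quad w with ht
    have htc : conj F t = t := by
      rw [ht, map_div₀, map_neg, ← quad_sigmaMap, ← polar_sigmaMap, hv, hw]
    obtain ⟨c, hc⟩ := huniq ((1 : K) • v + t • w)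
      (L.add_mem (L.smul_mem _ hvL) (L.smul_mem _ hwL))
      (by rw [map_add, sigmaMap_smul, sigmaMap_smul, hv, hw, htc, map_one]) (by
        rw [polar_comb_self, hqv, ht]; field_simp; ring)
    have ht0 : t ≠ 0 := by rw [ht]; exact div_ne_zero (neg_ne_zero.2 hB) hqw
    refine hvw ⟨t⁻¹ * (c - 1), ?_⟩
    rw [mul_smul, sub_smul, ← hc, add_sub_cancel_left, smul_smul, inv_mul_cancel₀ ht0, one_smul]
  obtain ⟨x, y, hxy⟩ := hL.1.exists_comb F hvL hwL hv0 hvw ((mem_pts_iff).1 hP)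
  have hy : y ≠ 0 := by
    rintro rfl
    rw [zero_smul, add_zero] at hxy
    have hx : x ≠ 0 := by rintro rfl; exact P.rep_nonzero (by rw [← hxy, zero_smul])
    exact hPS (mem_subgeometry_of_rep F hv hx hxy.symm)
  have hQ : quad P.rep = y ^ 2 * quad w := by
    rw [← hxy, polar_comb_self, hqv, hB]; ring
  have hH : herm F P.rep = 2 * (y * conj F y) * quad w := by
    rw [← hxy, herm_eq_polar, map_add, sigmaMap_smul, sigmaMap_smul, hv, hw, polar_comb_comb, hqv,
      hB]
    ring
  have hcw : conj F (quad w) = quad w := by rw [← quad_sigmaMap, hw]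
  refine ⟨by rw [hQ]; exact mul_ne_zero (pow_ne_zero 2 hy) hqw, ?_⟩
  rw [hQ, hH, map_mul, map_pow, hcw]
  ring

/-- A rank one quadratic form in two variables has a single zero on the projective line. -/
theorem ncard_zeros_degenerate (hF : ringChar F ≠ 2) {m : K} (hm : m ≠ 0) {k : F}
    (hk : k ^ 2 = 4 * Algebra.norm F m) :
    {x : K | x ≠ 0 ∧ k * Algebra.norm F x + Algebra.trace F K (m * x ^ 2) = 0}.ncard =
      Fintype.card F - 1 := by
  classical
  have := finite_of_finrank_eq_two F (K := K)
  have := Fintype.ofFinite K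
  have h2 : (2 : F) ≠ 0 := Ring.two_ne_zero hF
  obtain ⟨v, hv⟩ := exists_sq_eq_of_isSquare_norm F hF (x := m) ⟨k / 2, by
    field_simp; linear_combination -hk⟩
  have hv0 : v ≠ 0 := by rintro rfl; exact hm (by rw [← hv]; simp)
  have hk' : k = 2 * Algebra.norm F v ∨ k = -2 * Algebra.norm F v := by
    rw [neg_mul, ← sq_eq_sq_iff_eq_or_eq_neg, hk, ← hv, map_pow]; ring
  have hset : {x : K | x ≠ 0 ∧ k * Algebra.norm F x + Algebra.trace F K (m * x ^ 2) = 0} =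
      (((univ.filter fun x : K => k * Algebra.norm F x + Algebra.trace F K (m * x ^ 2) = 0).erase 0
        : Finset K) : Set K) := by
    ext x; simp [and_comm]
  have hcard : (#{x : K | k * Algebra.norm F x + Algebra.trace F K (m * x ^ 2) = 0} : ℤ) =
      Fintype.card F := by
    rw [← hv]
    rcases hk' with rfl | rfl
    · rw [card_degenerate_add F hF hv0]; simp
    · rw [card_degenerate_sub F hF hv0]; simp
  rw [hset, Set.ncard_coe_finset, card_erase_of_mem (by simp [(norm_eq_zero_iff F (K := K)).2 rfl])]
  rw [Nat.cast_inj.1 hcard]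

/-- A point outside `Σ` is on an extended tangent if and only if the line joining it to its image
under `σ` is one, that is, if the restriction of `Q` to the `σ`-fixed vectors of this line has rank
one. -/
theorem mem_DTilde_iff (hF : ringChar F ≠ 2) (P : Pt K) :
    P ∈ DTilde F K ↔ quad P.rep ≠ 0 ∧
      herm F P.rep ^ 2 = 4 * (quad P.rep * conj F (quad P.rep)) ∧ P ∉ subgeometry F K := by
  constructor
  · rintro ⟨⟨L, hL, hP⟩, hP0⟩
    obtain ⟨hq, hh⟩ := hL.quad_herm F hP hP0
    exact ⟨hq, hh, hP0⟩
  · rintro ⟨hq, hh, hP⟩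
    have hM : ¬ ∃ c : K, sigmaMap F P.rep = c • P.rep := by rwa [← mem_subgeometry_iff]
    refine ⟨⟨sigmaSpan F P.rep, ⟨isSigmaLine_sigmaSpan F hM, ?_⟩, ?_⟩, hP⟩
    · have h1 := ncard_sigmaSpan F hM (p := fun v => quad v = 0)
        (fun c v hc => quad_smul_eq_zero_iff hc v)
      simp only [quad_add_sigmaMap, map_eq_zero] at h1
      rw [ncard_zeros_degenerate F hF hq ((algebraMap_sq_disc F _).1 hh)] at h1
      have h3 : pts (sigmaSpan F P.rep) ∩ Q0 F K =
          {R : Pt K | R ∈ pts (sigmaSpan F P.rep) ∩ subgeometry F K ∧ quad R.rep = 0} := by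
        ext R
        change _ ∧ _ ∧ _ ↔ (_ ∧ _) ∧ _
        rw [and_assoc, and_comm (a := R ∈ quadric K)]
        rfl
      rw [h3]
      have hq1 : 1 < Fintype.card F := Fintype.one_lt_card
      exact Nat.eq_of_mul_eq_mul_right (by omega) (h1.trans (one_mul _).symm)
    · rw [mem_pts_iff, mem_sigmaSpan]
      exact ⟨1, 0, by simp⟩

theorem mult_eq (M : Matrix (Fin 2) (Fin 2) K) (x y : K) :
    mult F M x y = x * (M 0 0 * y + M 0 1 * conj F y)
      + conj F x * (M 1 0 * y + M 1 1 * conj F y) := by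
  simp [mult, Fin.sum_univ_two, conj_apply]; ring

/-- The difference of the norms of the two components of `M (y, yᵠ)`. -/
theorem norm_sub_norm (M : Matrix (Fin 2) (Fin 2) K) (y : K) :
    Algebra.norm F (M 0 0 * y + M 0 1 * conj F y) - Algebra.norm F (M 1 0 * y + M 1 1 * conj F y) =
      (Algebra.norm F (M 0 0) + Algebra.norm F (M 0 1) - Algebra.norm F (M 1 0)
        - Algebra.norm F (M 1 1)) * Algebra.norm F y
      + Algebra.trace F K ((M 0 0 * conj F (M 0 1) - M 1 0 * conj F (M 1 1)) * y ^ 2) := by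
  apply (algebraMap F K).injective
  simp only [algebraMap_norm, algebraMap_trace, map_add, map_sub, map_mul, map_pow, conj_conj]
  ring

/-- The discriminant of the binary quadratic form in `norm_sub_norm`. -/
theorem disc_eq (M : Matrix (Fin 2) (Fin 2) K) :
    (Algebra.norm F (M 0 0) + Algebra.norm F (M 0 1) - Algebra.norm F (M 1 0)
        - Algebra.norm F (M 1 1)) ^ 2
      - 4 * Algebra.norm F (M 0 0 * conj F (M 0 1) - M 1 0 * conj F (M 1 1)) =
    hermVal F M ^ 2 - 4 * Algebra.norm F (quad M) := by
  apply (algebraMap F K).injective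
  simp only [algebraMap_norm, map_add, map_sub, map_mul, map_pow, conj_conj, map_ofNat,
    hermVal, quad]
  ring

/-- The multiplication has zero divisors if and only if `M (y, yᵠ)` is proportional to a vector of
the form `(xᵠ, -x)` for some `y ≠ 0`. -/
theorem not_nonsingular_iff {M : Matrix (Fin 2) (Fin 2) K} (hM : quad M ≠ 0) :
    ¬ Nonsingular F M ↔ ∃ y : K, y ≠ 0 ∧ Algebra.norm F (M 0 0 * y + M 0 1 * conj F y)
      - Algebra.norm F (M 1 0 * y + M 1 1 * conj F y) = 0 := by
  simp only [Nonsingular, not_forall, not_not]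
  constructor
  · rintro ⟨x, y, hx, hy, h⟩
    refine ⟨y, hy, ?_⟩
    rw [mult_eq] at h
    have h1 : x * (M 0 0 * y + M 0 1 * conj F y) = -(conj F x * (M 1 0 * y + M 1 1 * conj F y)) :=
      by linear_combination h
    have h3 := congrArg (Algebra.norm F) h1
    rw [map_mul, norm_neg, map_mul, norm_conj] at h3
    have hNx : Algebra.norm F x ≠ 0 := by rwa [Ne, norm_eq_zero_iff F]
    rw [mul_left_cancel₀ hNx h3, sub_self]
  · rintro ⟨y, hy, h⟩
    set u := M 0 0 * y + M 0 1 * conj F y with hu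
    set w := M 1 0 * y + M 1 1 * conj F y with hw
    have hw0 : w ≠ 0 := by
      intro hw0
      have hu0 : u = 0 := by
        rw [← norm_eq_zero_iff F]
        rw [(norm_eq_zero_iff F).2 hw0] at h
        linear_combination h
      have : quad M * y = 0 := by
        rw [quad]; linear_combination M 1 1 * (hu.symm.trans hu0) - M 0 1 * (hw.symm.trans hw0)
      simp [hM, hy] at this
    have hN : u * conj F u = w * conj F w := by
      rw [← algebraMap_norm, ← algebraMap_norm, sub_eq_zero.1 h]
    have hcw := conj_ne_zero F hw0
    obtain ⟨x, hx, hxc⟩ := exists_conj_eq_mul F (c := -u / w) (by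
      rw [map_div₀, map_neg]; field_simp; linear_combination hN)
    refine ⟨x, y, hx, hy, ?_⟩
    rw [mult_eq, ← hu, ← hw, hxc]
    field_simp
    ring

/-- By `not_nonsingular_iff`, a singular point amounts to a nontrivial zero of the binary quadratic
form of `norm_sub_norm`, whose discriminant is computed in `disc_eq`. -/
theorem nonsingular_iff [DecidableEq F] (hF : ringChar F ≠ 2) {M : Matrix (Fin 2) (Fin 2) K}
    (hM : quad M ≠ 0) (hd : hermVal F M ^ 2 - 4 * Algebra.norm F (quad M) ≠ 0) :
    Nonsingular F M ↔ quadraticChar F (hermVal F M ^ 2 - 4 * Algebra.norm F (quad M)) = 1 := by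
  classical
  have := finite_of_finrank_eq_two F (K := K)
  have := Fintype.ofFinite K
  rw [← not_iff_not, not_nonsingular_iff F hM]
  simp only [norm_sub_norm]
  have hcard := card_norm_add_trace_eq F hF (disc_eq F M ▸ hd) (0 : F)
  rw [disc_eq, if_pos rfl] at hcard
  set k := Algebra.norm F (M 0 0) + Algebra.norm F (M 0 1) - Algebra.norm F (M 1 0)
        - Algebra.norm F (M 1 1) with hk
  set m := M 0 0 * conj F (M 0 1) - M 1 0 * conj F (M 1 1) with hm
  have hq : 1 < Fintype.card F := Fintype.one_lt_card
  have h0 : (0 : K) ∈ (univ.filter fun x : K =>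
      k * Algebra.norm F x + Algebra.trace F K (m * x ^ 2) = 0) := by
    simp [(norm_eq_zero_iff F (K := K)).2 rfl]
  constructor
  · rintro ⟨y, hy, h⟩ h1
    rw [h1] at hcard
    have h3 : #{x : K | k * Algebra.norm F x + Algebra.trace F K (m * x ^ 2) = 0} = 1 := by
      have : (#{x : K | k * Algebra.norm F x + Algebra.trace F K (m * x ^ 2) = 0} : ℤ) = 1 := by
        rw [hcard]; ring
      exact_mod_cast this
    obtain ⟨z, hz⟩ := Finset.card_eq_one.1 h3
    have hy' : y ∈ ({z} : Finset K) := by rw [← hz]; simpa using h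
    rw [hz] at h0
    rw [mem_singleton] at hy' h0
    exact hy (hy'.trans h0.symm)
  · intro h1
    rw [← quadraticChar_eq_neg_one_iff_not_one hd] at h1
    rw [h1] at hcard
    have h3 : 1 < #{x : K | k * Algebra.norm F x + Algebra.trace F K (m * x ^ 2) = 0} := by
      have : (1 : ℤ) < #{x : K | k * Algebra.norm F x + Algebra.trace F K (m * x ^ 2) = 0} := by
        have : (1 : ℤ) < Fintype.card F := by exact_mod_cast hq
        rw [hcard]
        linarith
      exact_mod_cast this
    obtain ⟨y, hy, hne⟩ := Finset.exists_mem_ne h3 0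
    exact ⟨y, hne, by simpa using hy⟩

end PointSetDescriptions

/-! ### Normal form of a point of an elliptic line -/

section NormalForm

set_option linter.unusedSectionVars false

variable (F : Type*) {K : Type*} [Field F] [Fintype F] [Field K] [Algebra F K]
  [hK : Fact (Module.finrank F K = 2)]

theorem sigmaMap_mul (A B : Matrix (Fin 2) (Fin 2) K) :
    sigmaMap F (A * B) = sigmaMap F A * sigmaMap F B := by
  ext i j
  fin_cases i <;> fin_cases j <;>
    simp [sigmaMap_eq, Matrix.mul_apply, Fin.sum_univ_two, add_comm]

theorem quad_eq_det (A : Matrix (Fin 2) (Fin 2) K) : quad A = A.det := (Matrix.det_fin_two A).symm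

theorem polar_mul_mul (A B M N : Matrix (Fin 2) (Fin 2) K) :
    polar (A * M * B) (A * N * B) = quad A * quad B * polar M N := by
  simp [polar, quad, Matrix.mul_apply, Fin.sum_univ_two]; ring

/-- The matrix fixed by `σ` with first column `(a, b)`; every matrix fixed by `σ` is of this
form. -/
def fixedMatrix (a b : K) : Matrix (Fin 2) (Fin 2) K := !![a, conj F b; b, conj F a]

theorem sigmaMap_fixedMatrix (a b : K) : sigmaMap F (fixedMatrix F a b) = fixedMatrix F a b := by
  ext i j
  fin_cases i <;> fin_cases j <;> simp [sigmaMap_eq, fixedMatrix]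

theorem quad_fixedMatrix (a b : K) :
    quad (fixedMatrix F a b) = algebraMap F K (Algebra.norm F a - Algebra.norm F b) := by
  simp [quad, fixedMatrix, algebraMap_norm]; ring

/-- Left normalisation. The first column of the factor is an eigenvector of `M adj(σ(M))`, whose
characteristic polynomial has discriminant `s²`. -/
theorem exists_left_normal_form (hF : ringChar F ≠ 2) (M : Matrix (Fin 2) (Fin 2) K) {s : F}
    (hs : s ≠ 0) (hd : hermVal F M ^ 2 - 4 * Algebra.norm F (quad M) = s ^ 2) :
    ∃ A N : Matrix (Fin 2) (Fin 2) K, sigmaMap F A = A ∧ quad A = 1 ∧ M = A * N ∧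
      N 0 0 * conj F (N 1 0) = N 0 1 * conj F (N 1 1) := by
  have h2 : (2 : F) ≠ 0 := Ring.two_ne_zero hF
  have h2K := two_ne_zero_ext F (K := K) hF
  set z : K := M 1 0 * conj F (M 0 0) - M 1 1 * conj F (M 0 1) with hz
  set t : F := Algebra.norm F (M 0 0) - Algebra.norm F (M 0 1) + Algebra.norm F (M 1 0)
    - Algebra.norm F (M 1 1) with ht
  have htz : t ^ 2 - 4 * Algebra.norm F z = s ^ 2 := by
    rw [← hd]
    apply (algebraMap F K).injective
    simp only [ht, hz, algebraMap_norm, map_add, map_sub, map_mul, map_pow, conj_conj, map_ofNat,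
      hermVal, quad]
    ring
  -- the sign of `s` is chosen such that the eigenvector is not isotropic
  obtain ⟨s, hs, htz, hst⟩ : ∃ s : F, s ≠ 0 ∧ t ^ 2 - 4 * Algebra.norm F z = s ^ 2 ∧ s + t ≠ 0 := by
    by_cases h : s + t = 0
    · refine ⟨-s, neg_ne_zero.2 hs, by rw [htz]; ring, ?_⟩
      intro h'
      have : 2 * s = 0 := by linear_combination h - h'
      simp [h2, hs] at this
    · exact ⟨s, hs, htz, h⟩
  obtain ⟨k, hk⟩ := norm_surj F (K := K) (2 / (s * (s + t)))
  have hkK : k * conj F k * (algebraMap F K s * (algebraMap F K s + algebraMap F K t)) = 2 := by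
    have hsK : algebraMap F K (s * (s + t)) ≠ 0 := by
      rw [Ne, map_eq_zero]; exact mul_ne_zero hs hst
    rw [← algebraMap_norm, hk, map_div₀, map_ofNat, ← map_add, ← map_mul]
    field_simp
  have htzK : algebraMap F K t ^ 2 - 4 * (z * conj F z) = algebraMap F K s ^ 2 := by
    rw [← algebraMap_norm, ← map_pow, ← map_pow, ← htz]
    simp only [map_sub, map_mul, map_pow, map_ofNat]
  set p : K := (algebraMap F K t + algebraMap F K s) / 2 with hp
  have hpc : conj F p = p := by
    rw [hp]; simp only [map_div₀, map_add, conj_algebraMap, map_ofNat]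
  have h2p : 2 * p = algebraMap F K t + algebraMap F K s := by rw [hp]; field_simp
  set a : K := k * p with ha
  set b : K := k * z with hb
  have hac : conj F a = conj F k * p := by rw [ha, map_mul, hpc]
  have hbc : conj F b = conj F k * conj F z := by rw [hb, map_mul]
  have hpz : 4 * (p ^ 2 - z * conj F z) =
      2 * (algebraMap F K s * (algebraMap F K s + algebraMap F K t)) := by
    linear_combination (2 * p + algebraMap F K t + algebraMap F K s) * h2p + htzK
  have h4K : (4 : K) ≠ 0 := by rw [show (4 : K) = 2 * 2 by norm_num]; exact mul_ne_zero h2K h2K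
  have hq : a * conj F a - conj F b * b = 1 := by
    rw [hac, hbc, ha, hb]
    apply mul_left_cancel₀ h4K
    linear_combination (k * conj F k) * hpz + 2 * hkK
  refine ⟨fixedMatrix F a b, !![conj F a, -conj F b; -b, a] * M, sigmaMap_fixedMatrix F a b, ?_,
    ?_, ?_⟩
  · simpa [quad, fixedMatrix] using hq
  · rw [← Matrix.mul_assoc]
    have : fixedMatrix F a b * !![conj F a, -conj F b; -b, a] = 1 := by
      ext i j
      fin_cases i <;> fin_cases j <;>
        simp [fixedMatrix, Matrix.mul_apply, Fin.sum_univ_two] <;>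
        first | linear_combination hq | ring
    rw [this, Matrix.one_mul]
  · have htK : algebraMap F K t = M 0 0 * conj F (M 0 0) - M 0 1 * conj F (M 0 1)
        + M 1 0 * conj F (M 1 0) - M 1 1 * conj F (M 1 1) := by
      rw [ht]; simp [algebraMap_norm]
    have hzc : conj F z = conj F (M 1 0) * M 0 0 - conj F (M 1 1) * M 0 1 := by
      rw [hz]; simp
    have hmain : conj F a * conj F b * algebraMap F K t - conj F a ^ 2 * conj F z
        - conj F b ^ 2 * z = 0 := by
      rw [hac, hbc]
      apply mul_left_cancel₀ h4K
      linear_combination (conj F k ^ 2 * conj F z) *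
        ((2 * algebraMap F K t - 2 * p - algebraMap F K t - algebraMap F K s) * h2p + htzK)
    simp only [Matrix.mul_apply, Fin.sum_univ_two, Matrix.of_apply, Matrix.cons_val',
      Matrix.cons_val_zero, Matrix.cons_val_one, Matrix.cons_val_fin_one, map_add, map_mul, map_neg]
    rw [htK, hzc, hz] at hmain
    linear_combination -hmain

/-- Right normalisation. By hypothesis the first row of `N` is proportional to the image of the
second one under the action of `σ` on rows, and `B` is the `σ`-fixed matrix of determinant one whose
second row is proportional to that of `N`. -/
theorem exists_right_normal_form {N : Matrix (Fin 2) (Fin 2) K} (hN : quad N ≠ 0)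
    (h : N 0 0 * conj F (N 1 0) = N 0 1 * conj F (N 1 1)) :
    ∃ (B : Matrix (Fin 2) (Fin 2) K) (u v : K), sigmaMap F B = B ∧ quad B = 1 ∧
      N = !![u, 0; 0, v] * B := by
  set n : F := Algebra.norm F (N 1 1) - Algebra.norm F (N 1 0) with hn
  have hnK : algebraMap F K n = N 1 1 * conj F (N 1 1) - N 1 0 * conj F (N 1 0) := by
    rw [hn]; simp [algebraMap_norm]
  have h00 : N 0 0 * algebraMap F K n = quad N * conj F (N 1 1) := by
    rw [hnK, quad]; linear_combination (-N 1 0) * h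
  have h01 : N 0 1 * algebraMap F K n = quad N * conj F (N 1 0) := by
    rw [hnK, quad]; linear_combination (-N 1 1) * h
  have hn0 : n ≠ 0 := by
    intro hn0
    rw [hn0, map_zero, mul_zero, eq_comm, mul_eq_zero] at h00 h01
    have h11 : N 1 1 = 0 := by
      by_contra h0; exact h00.elim hN (conj_ne_zero F h0)
    have h10 : N 1 0 = 0 := by
      by_contra h0; exact h01.elim hN (conj_ne_zero F h0)
    exact hN (by rw [quad, h11, h10]; ring)
  have hn0K : algebraMap F K n ≠ 0 := by simpa using hn0
  obtain ⟨r, hr⟩ := norm_surj F (K := K) (1 / n)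
  have hrn : r * conj F r * algebraMap F K n = 1 := by
    rw [← algebraMap_norm, hr, map_div₀, map_one]; field_simp
  have hr0 : r ≠ 0 := by rintro rfl; simp at hrn
  have hrc := conj_ne_zero F hr0
  refine ⟨fixedMatrix F (conj F (r * N 1 1)) (r * N 1 0),
    quad N / (algebraMap F K n * conj F r), r⁻¹, sigmaMap_fixedMatrix F _ _, ?_, ?_⟩
  · rw [quad_fixedMatrix, norm_conj, map_mul, map_mul, ← mul_sub, ← hn, hr]
    field_simp
    simp
  · ext i j
    fin_cases i <;> fin_cases j <;>
      simp [fixedMatrix, Matrix.mul_apply, Fin.sum_univ_two] <;> field_simp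
    · linear_combination h00
    · linear_combination h01

/-- Coordinates on the plane `P^⊥`, for a point `P = ⟨M⟩` with `Q ≠ 0` such that
`H² - 4 Q ^ (q + 1)` is a nonzero square of `F`. -/
theorem exists_plane_coordinates (hF : ringChar F ≠ 2) {M : Matrix (Fin 2) (Fin 2) K} {s : F}
    (hM : quad M ≠ 0) (hs : s ≠ 0)
    (hd : hermVal F M ^ 2 - 4 * Algebra.norm F (quad M) = s ^ 2) :
    ∃ (u d : K) (f : K × K × K → Matrix (Fin 2) (Fin 2) K), u ≠ 0 ∧
      hermVal F M = Algebra.norm F u * (1 + Algebra.norm F d) ∧ quad M = u ^ 2 * d ∧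
      Function.Injective f ∧ f 0 = 0 ∧ (∀ N, hermForm F N M = 0 ↔ ∃ p, f p = N) ∧
      (∀ p, quad (f p) = -(conj F d * p.1 ^ 2) - p.2.1 * p.2.2) ∧
      (∀ p, hermVal F (f p) = (1 + Algebra.norm F d) * Algebra.norm F p.1
        - Algebra.norm F p.2.1 - Algebra.norm F p.2.2) ∧
      (∀ p, sigmaMap F (f p) = f p ↔
        conj F p.1 = -(conj F d * p.1) ∧ p.2.2 = conj F p.2.1) := by
  obtain ⟨A, M', hA, hA1, hMA, hM'⟩ := exists_left_normal_form F hF M hs hd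
  have hquadmul : ∀ X Y : Matrix (Fin 2) (Fin 2) K, quad (X * Y) = quad X * quad Y := by
    intro X Y; rw [quad_eq_det, quad_eq_det, quad_eq_det, Matrix.det_mul]
  have hM'0 : quad M' ≠ 0 := by
    rw [hMA, hquadmul, hA1, one_mul] at hM; exact hM
  obtain ⟨B, u, v, hB, hB1, rfl⟩ := exists_right_normal_form F hM'0 hM'
  rw [← Matrix.mul_assoc] at hMA
  have hu : u ≠ 0 := by
    rintro rfl
    apply hM'0
    rw [hquadmul]; simp [quad]
  have huc := conj_ne_zero F hu
  have hAu : IsUnit A.det := by rw [← quad_eq_det, hA1]; exact isUnit_one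
  have hBu : IsUnit B.det := by rw [← quad_eq_det, hB1]; exact isUnit_one
  have hsig : ∀ X, sigmaMap F (A * X * B) = A * sigmaMap F X * B := by
    intro X; rw [sigmaMap_mul, sigmaMap_mul, hA, hB]
  have hquad : ∀ X, quad (A * X * B) = quad X := by
    intro X; rw [hquadmul, hquadmul, hA1, hB1]; ring
  have hform : ∀ X Y, hermForm F (A * X * B) (A * Y * B) = hermForm F X Y := by
    intro X Y
    rw [hermForm_eq_polar, hermForm_eq_polar, hsig, polar_mul_mul, hA1, hB1]; ring
  have hval : ∀ X, hermVal F (A * X * B) = hermVal F X := by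
    intro X
    apply (algebraMap F K).injective
    rw [algebraMap_hermVal, algebraMap_hermVal, herm_eq_hermForm, herm_eq_hermForm, hform]
  have hinj : ∀ X Y, A * X * B = A * Y * B → X = Y := by
    intro X Y h
    have h1 : A * X = A * Y := by
      have := congrArg (fun Z => Z * B⁻¹) h
      simpa [Matrix.mul_assoc, Matrix.mul_nonsing_inv B hBu] using this
    have := congrArg (fun Z => A⁻¹ * Z) h1
    simpa [← Matrix.mul_assoc, Matrix.nonsing_inv_mul A hAu] using this
  let g : K × K × K → Matrix (Fin 2) (Fin 2) K := fun p =>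
    !![-(conj F (v / u) * p.1), p.2.1; p.2.2, p.1]
  have hg : ∀ X, hermForm F X !![u, 0; 0, v] = 0 ↔ ∃ p, g p = X := by
    intro X
    have h1 : hermForm F X !![u, 0; 0, v] = X 0 0 * conj F u + X 1 1 * conj F v := by
      simp [hermForm, conj_apply]
    rw [h1]
    constructor
    · intro h
      refine ⟨(X 1 1, X 0 1, X 1 0), ?_⟩
      ext i j
      fin_cases i <;> fin_cases j <;> simp [g]
      field_simp
      linear_combination -h
    · rintro ⟨p, rfl⟩
      simp [g]
      field_simp
      ring
  refine ⟨u, v / u, fun p => A * g p * B, hu, ?_, ?_, ?_, ?_, ?_, ?_, ?_, ?_⟩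
  · rw [hMA, hval]
    have h1 := map_mul (Algebra.norm F) u (v / u)
    rw [mul_div_cancel₀ _ hu] at h1
    rw [mul_add, ← h1]
    simp [hermVal, (norm_eq_zero_iff F (K := K)).2 rfl]
  · rw [hMA, hquad]
    simp [quad]
    field_simp
  · intro p p' h
    have h1 := hinj _ _ h
    have e0 := congrFun (congrFun h1 1) 1
    have e1 := congrFun (congrFun h1 0) 1
    have e2 := congrFun (congrFun h1 1) 0
    simp [g] at e0 e1 e2
    ext <;> assumption
  · have : g 0 = 0 := by
      ext i j
      fin_cases i <;> fin_cases j <;> simp [g]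
    simp [this]
  · intro X
    have hX : X = A * (A⁻¹ * X * B⁻¹) * B := by
      rw [← Matrix.mul_assoc, ← Matrix.mul_assoc, Matrix.mul_nonsing_inv A hAu, Matrix.one_mul,
        Matrix.mul_assoc, Matrix.nonsing_inv_mul B hBu, Matrix.mul_one]
    conv_lhs => rw [hX, hMA, hform, hg]
    constructor
    · rintro ⟨p, hp⟩
      exact ⟨p, by change A * g p * B = X; rw [hp, ← hX]⟩
    · rintro ⟨p, hp⟩
      exact ⟨p, hinj _ _ (by rw [← hX]; exact hp)⟩
  · intro p
    rw [hquad]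
    simp [quad, g]
    ring
  · intro p
    rw [hval]
    simp only [hermVal, g, Matrix.of_apply, Matrix.cons_val', Matrix.cons_val_zero,
      Matrix.cons_val_one, Matrix.cons_val_fin_one, norm_neg]
    rw [map_mul, norm_conj]
    ring
  · intro p
    change sigmaMap F (A * g p * B) = A * g p * B ↔ _
    rw [hsig]
    constructor
    · intro h
      have h1 := hinj _ _ h
      have e0 := congrFun (congrFun h1 0) 0
      have e2 := congrFun (congrFun h1 1) 0
      simp [g, sigmaMap_eq] at e0 e2
      refine ⟨by rw [e0, map_div₀], e2.symm⟩
    · rintro ⟨h0, h1⟩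
      have : sigmaMap F (g p) = g p := by
        have h3 := congrArg (conj F) h0
        rw [map_neg, map_mul, conj_conj, conj_conj] at h3
        rw [map_div₀] at h0
        ext i j
        fin_cases i <;> fin_cases j <;> simp [g, sigmaMap_eq, h1]
        · rw [h0]
        · exact h3.symm
      rw [this]

end NormalForm

/-! ### Counting the points of the plane -/

section PlanePoints

set_option linter.unusedSectionVars false

variable (F : Type*) {K : Type*} [Field F] [Fintype F] [Field K] [Algebra F K]
  [hK : Fact (Module.finrank F K = 2)]

theorem hermVal_smul (c : K) (M : Matrix (Fin 2) (Fin 2) K) :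
    hermVal F (c • M) = Algebra.norm F c * hermVal F M := by
  simp [hermVal]; ring

/-- Points of a plane and the coordinate vectors of their representatives. -/
theorem ncard_plane_points [Fintype K] [DecidableEq K] {P₀ : Pt K} {d : K}
    {f : K × K × K → Matrix (Fin 2) (Fin 2) K}
    (hf : Function.Injective f) (hf0 : f 0 = 0)
    (hmem : ∀ N, hermForm F N P₀.rep = 0 ↔ ∃ p, f p = N)
    (hquad : ∀ p, quad (f p) = -(conj F d * p.1 ^ 2) - p.2.1 * p.2.2)
    (hherm : ∀ p, hermVal F (f p) = (1 + Algebra.norm F d) * Algebra.norm F p.1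
        - Algebra.norm F p.2.1 - Algebra.norm F p.2.2)
    {r : K → F → Prop} [∀ c, DecidablePred (r c)]
    (hr : ∀ a c h, a ≠ 0 → (r (a ^ 2 * c) (Algebra.norm F a * h) ↔ r c h)) :
    {P | P ∈ perp F P₀ ∧ r (quad P.rep) (hermVal F P.rep)}.ncard * (Fintype.card F ^ 2 - 1) =
      #{p : K × K × K | p ≠ 0 ∧ r (-(conj F d * p.1 ^ 2) - p.2.1 * p.2.2)
        ((1 + Algebra.norm F d) * Algebra.norm F p.1
          - Algebra.norm F p.2.1 - Algebra.norm F p.2.2)} := by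
  have h := ncard_vectors F (p := fun M : Matrix (Fin 2) (Fin 2) K =>
    hermForm F M P₀.rep = 0 ∧ r (quad M) (hermVal F M)) (by
      intro a M ha
      rw [hermForm_smul_left, quad_smul, hermVal_smul, hr _ _ _ ha]
      simp [ha])
  rw [show {P | P ∈ perp F P₀ ∧ r (quad P.rep) (hermVal F P.rep)} =
    {P : Pt K | hermForm F P.rep P₀.rep = 0 ∧ r (quad P.rep) (hermVal F P.rep)} from rfl, ← h,
    ← Set.ncard_coe_finset]
  symm
  refine Set.ncard_congr (fun p _ => f p) ?_ ?_ ?_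
  · intro p hp
    simp only [coe_filter, mem_univ, true_and, Set.mem_ofPred_eq] at hp
    refine ⟨fun h0 => hp.1 (hf (h0.trans hf0.symm)), (hmem _).2 ⟨p, rfl⟩, ?_⟩
    rw [hquad, hherm]; exact hp.2
  · intro p p' _ _ h; exact hf h
  · rintro M ⟨hM, hM1, hM2⟩
    obtain ⟨p, rfl⟩ := (hmem M).1 hM1
    refine ⟨p, ?_, rfl⟩
    simp only [coe_filter, mem_univ, true_and, Set.mem_ofPred_eq]
    refine ⟨?_, by rwa [hquad, hherm] at hM2⟩
    rintro rfl; exact hM hf0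

theorem pow_half_sq (hodd : Odd (Fintype.card F)) (c : K) :
    (c ^ ((Fintype.card F + 1) / 2)) ^ 2 = c * conj F c := by
  rw [← pow_mul, Nat.div_mul_cancel (by obtain ⟨k, hk⟩ := hodd; omega), pow_card_add_one]

variable [Fintype K] [DecidableEq F] [DecidableEq K]

/-- Summation of `card_plane_vectors` over a set of pairs `(c, h)` on which the quadratic character
of `h² - 4 N(c)` is constant. -/
theorem card_plane_vectors_rel (hF : ringChar F ≠ 2) {d : K} (hd : Algebra.norm F d ≠ 0)
    (hd1 : Algebra.norm F d ≠ 1) (hA : 1 + Algebra.norm F d ≠ 0)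
    (r : K → F → Prop) [∀ c, DecidablePred (r c)] {ε : ℤ}
    (hr : ∀ c h, r c h → c ≠ 0 ∧ quadraticChar F (h ^ 2 - 4 * Algebra.norm F c) = ε) :
    (#{p : K × K × K | p ≠ 0 ∧ r (-(conj F d * p.1 ^ 2) - p.2.1 * p.2.2)
        ((1 + Algebra.norm F d) * Algebra.norm F p.1
          - Algebra.norm F p.2.1 - Algebra.norm F p.2.2)} : ℤ) =
    #{x : K × F | r x.1 x.2} * ((Fintype.card F + 1) * (Fintype.card F ^ 2 - Fintype.card F - 1
      - Fintype.card F * ε))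
    + Fintype.card F ^ 2 *
      #{x : K | r (-(conj F d * x ^ 2)) ((1 + Algebra.norm F d) * Algebra.norm F x)} := by
  have h1 : #{p : K × K × K | p ≠ 0 ∧ r (-(conj F d * p.1 ^ 2) - p.2.1 * p.2.2)
        ((1 + Algebra.norm F d) * Algebra.norm F p.1
          - Algebra.norm F p.2.1 - Algebra.norm F p.2.2)} =
      ∑ x : K × F with r x.1 x.2, #{p : K × K × K | -(conj F d * p.1 ^ 2) - p.2.1 * p.2.2 = x.1 ∧
        (1 + Algebra.norm F d) * Algebra.norm F p.1 - Algebra.norm F p.2.1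
          - Algebra.norm F p.2.2 = x.2} := by
    rw [Finset.card_eq_sum_card_fiberwise (t := univ.filter fun x : K × F => r x.1 x.2)
      (f := fun p : K × K × K => (-(conj F d * p.1 ^ 2) - p.2.1 * p.2.2,
        (1 + Algebra.norm F d) * Algebra.norm F p.1 - Algebra.norm F p.2.1
          - Algebra.norm F p.2.2)) (by intro p hp; simpa using (mem_filter.1 hp).2.2)]
    refine sum_congr rfl fun x hx => ?_
    congr 1
    ext p
    simp only [mem_filter, mem_univ, true_and, Prod.ext_iff]
    constructor
    · exact fun h => h.2
    · rintro ⟨e1, e2⟩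
      refine ⟨⟨?_, by rw [e1, e2]; simpa using hx⟩, e1, e2⟩
      rintro rfl
      refine (hr _ _ (mem_filter.1 hx).2).1 (e1.symm.trans ?_)
      simp
  have h3 : ∑ x : K × F with r x.1 x.2, #{y : K | (1 + Algebra.norm F d) * Algebra.norm F y - x.2 = 0
        ∧ x.1 + conj F d * y ^ 2 = 0} =
      #{x : K | r (-(conj F d * x ^ 2)) ((1 + Algebra.norm F d) * Algebra.norm F x)} := by
    rw [Finset.card_eq_sum_card_fiberwise (t := univ.filter fun x : K × F => r x.1 x.2)
      (f := fun y : K => (-(conj F d * y ^ 2), (1 + Algebra.norm F d) * Algebra.norm F y))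
      (by intro p hp; simpa using (mem_filter.1 hp).2)]
    refine sum_congr rfl fun x hx => ?_
    congr 1
    ext y
    simp only [mem_filter, mem_univ, true_and, Prod.ext_iff, sub_eq_zero, add_eq_zero_iff_eq_neg]
    constructor
    · rintro ⟨e1, e2⟩
      refine ⟨?_, e2.symm, e1⟩
      rw [e1, ← e2]
      exact (mem_filter.1 hx).2
    · rintro ⟨-, e1, e2⟩
      exact ⟨e2, e1.symm⟩
  rw [h1, ← h3, Nat.cast_sum, Nat.cast_sum]
  rw [Finset.sum_congr rfl (fun x hx => card_plane_vectors F hF x.2 rfl hd hd1 hA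
    (hr _ _ (mem_filter.1 hx).2).1)]
  rw [sum_add_distrib]
  congr 1
  · rw [Finset.sum_congr rfl (fun x hx => by rw [(hr _ _ (mem_filter.1 hx).2).2]), sum_const,
      nsmul_eq_mul]
  · rw [mul_sum]

theorem card_ne_zero_eq : #{c : K | c ≠ 0} = Fintype.card F ^ 2 - 1 := by
  rw [Finset.filter_ne', card_erase_of_mem (mem_univ _), card_univ, card_eq_sq F]

/-- Multiplication by an element whose norm is a nonsquare exchanges the two classes of `c`. -/
theorem card_pairs_zero (hF : ringChar F ≠ 2) {ε : ℤ} (hε : ε = 1 ∨ ε = -1) :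
    2 * #{x : K × F | x.1 ≠ 0 ∧ x.2 = 0 ∧
      quadraticChar F (x.2 ^ 2 - 4 * Algebra.norm F x.1) = ε} = Fintype.card F ^ 2 - 1 := by
  have h4 := four_ne_zero' F hF
  obtain ⟨g, hg⟩ := quadraticChar_exists_neg_one hF
  obtain ⟨y, hy⟩ := norm_surj F (K := K) g
  have hy0 : y ≠ 0 := by
    rintro rfl
    rw [(norm_eq_zero_iff F).2 rfl] at hy
    rw [← hy] at hg; simp at hg
  have hproj : ∀ δ : ℤ, #{x : K × F | x.1 ≠ 0 ∧ x.2 = 0 ∧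
      quadraticChar F (x.2 ^ 2 - 4 * Algebra.norm F x.1) = δ} =
      #{c : K | c ≠ 0 ∧ quadraticChar F (-4 * Algebra.norm F c) = δ} := by
    intro δ
    refine Finset.card_nbij' (fun x => x.1) (fun c => (c, 0)) ?_ ?_ ?_ ?_
    · rintro ⟨c, h⟩ hx
      simp only [coe_filter, mem_univ, true_and, Set.mem_ofPred_eq] at hx ⊢
      obtain ⟨h1, rfl, h3⟩ := hx
      exact ⟨h1, by rw [← h3]; congr 1; ring⟩
    · rintro c hx
      simp only [coe_filter, mem_univ, true_and, Set.mem_ofPred_eq] at hx ⊢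
      exact ⟨hx.1, by rw [← hx.2]; congr 1; ring⟩
    · rintro ⟨c, h⟩ hx
      simp only [coe_filter, mem_univ, true_and, Set.mem_ofPred_eq] at hx
      rw [hx.2.1]
    · rintro c -; rfl
  have hswap : ∀ δ : ℤ, #{c : K | c ≠ 0 ∧ quadraticChar F (-4 * Algebra.norm F c) = δ} =
      #{c : K | c ≠ 0 ∧ quadraticChar F (-4 * Algebra.norm F c) = -δ} := by
    intro δ
    refine Finset.card_equiv (Equiv.mulLeft₀ y hy0) ?_
    intro c
    simp only [mem_filter, mem_univ, true_and, Equiv.mulLeft₀_apply, map_mul (Algebra.norm F), hy]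
    rw [show -4 * (g * Algebra.norm F c) = g * (-4 * Algebra.norm F c) by ring,
      map_mul (quadraticChar F) g, hg]
    simp [hy0]
  have hsum : #{c : K | c ≠ 0 ∧ quadraticChar F (-4 * Algebra.norm F c) = ε} +
      #{c : K | c ≠ 0 ∧ quadraticChar F (-4 * Algebra.norm F c) = -ε} = #{c : K | c ≠ 0} := by
    rw [← Finset.card_union_of_disjoint]
    · congr 1
      ext c
      simp only [mem_union, mem_filter, mem_univ, true_and, ← and_or_left, and_iff_left_iff_imp]
      intro hc
      have h0 : -4 * Algebra.norm F c ≠ 0 :=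
        mul_ne_zero (neg_ne_zero.2 h4) (by rwa [Ne, norm_eq_zero_iff F])
      rcases quadraticChar_dichotomy h0 with h | h <;> rcases hε with rfl | rfl <;> rw [h] <;> norm_num
    · rw [Finset.disjoint_filter]
      rintro c - ⟨-, h1⟩ ⟨-, h3⟩
      rw [h1] at h3
      rcases hε with rfl | rfl <;> norm_num at h3
  rw [hproj, two_mul]
  nth_rewrite 2 [hswap]
  rw [hsum, card_ne_zero_eq F]

/-- Each nonzero `h` belongs to the `q + 1` elements `c` of norm `h² / (4 u)`. -/
theorem card_pairs_sq {u : F} (hF : ringChar F ≠ 2) (hu : u ≠ 0) :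
    #{x : K × F | x.2 ≠ 0 ∧ x.2 ^ 2 = 4 * u * Algebra.norm F x.1} = Fintype.card F ^ 2 - 1 := by
  have h4 := four_ne_zero' F hF
  have h1 : #{x : K × F | x.2 ≠ 0 ∧ x.2 ^ 2 = 4 * u * Algebra.norm F x.1} =
      ∑ h : F, #{c : K | h ≠ 0 ∧ h ^ 2 = 4 * u * Algebra.norm F c} := by
    rw [← card_filter_prod_eq_sum (fun (h : F) (c : K) => h ≠ 0 ∧ h ^ 2 = 4 * u * Algebra.norm F c)]
    exact Finset.card_equiv (Equiv.prodComm _ _) (by simp)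
  have h3 : ∀ h ∈ univ.erase (0 : F), #{c : K | h ≠ 0 ∧ h ^ 2 = 4 * u * Algebra.norm F c} =
      Fintype.card F + 1 := by
    intro h hh
    have hh : h ≠ 0 := by simpa using hh
    rw [← card_norm_eq F (K := K) (t := h ^ 2 / (4 * u))
      (div_ne_zero (pow_ne_zero 2 hh) (mul_ne_zero h4 hu))]
    congr 1
    ext c
    simp only [mem_filter, mem_univ, true_and]
    rw [eq_div_iff (mul_ne_zero h4 hu)]
    constructor
    · rintro ⟨-, h⟩; rw [h]; ring
    · intro h0; exact ⟨hh, by rw [← h0]; ring⟩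
  rw [h1, ← Finset.add_sum_erase _ _ (mem_univ (0 : F)), Finset.sum_congr rfl h3]
  simp only [ne_eq, not_true_eq_false, false_and, filter_false, card_empty, zero_add, sum_const,
    card_erase_of_mem (mem_univ _), card_univ, smul_eq_mul]
  have := Nat.sq_sub_sq (Fintype.card F) 1
  rw [one_pow] at this
  rw [this, mul_comm]

/-- A change of sign of `h` exchanges the pairs belonging to `η` and to `-η`. -/
theorem card_pairs_S (hF : ringChar F ≠ 2) (hodd : Odd (Fintype.card F)) {η : K} {u : F}
    (hu : u ≠ 0) (hη : η ^ 2 = algebraMap F K u) :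
    2 * #{x : K × F | x.2 ≠ 0 ∧
      algebraMap F K x.2 = 2 * η * x.1 ^ ((Fintype.card F + 1) / 2)} = Fintype.card F ^ 2 - 1 := by
  have h2K := two_ne_zero_ext F (K := K) hF
  have hneg : #{x : K × F | x.2 ≠ 0 ∧
      algebraMap F K x.2 = 2 * η * x.1 ^ ((Fintype.card F + 1) / 2)} =
      #{x : K × F | x.2 ≠ 0 ∧
      algebraMap F K x.2 = -(2 * η * x.1 ^ ((Fintype.card F + 1) / 2))} := by
    refine Finset.card_equiv ((Equiv.refl K).prodCongr (Equiv.neg F)) ?_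
    rintro ⟨c, h⟩
    simp
  rw [two_mul]
  nth_rewrite 2 [hneg]
  rw [← card_pairs_sq F (K := K) hF hu, ← Finset.card_union_of_disjoint]
  · congr 1
    ext ⟨c, h⟩
    simp only [mem_union, mem_filter, mem_univ, true_and, ← and_or_left]
    refine and_congr_right fun hh => ?_
    rw [← sq_eq_sq_iff_eq_or_eq_neg, mul_pow, pow_half_sq F hodd, mul_pow, hη,
      ← (algebraMap F K).injective.eq_iff]
    simp only [map_pow, map_mul, map_ofNat, algebraMap_norm]
    constructor <;> intro h0 <;> linear_combination h0
  · rw [Finset.disjoint_filter]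
    rintro ⟨c, h⟩ - ⟨hh, h1⟩ ⟨-, h3⟩
    rw [← h1] at h3
    have h5 : 2 * algebraMap F K h = 0 := by linear_combination h3
    rw [mul_eq_zero, map_eq_zero] at h5
    exact h5.elim h2K hh

/-- The number of zeros of `Q` in the plane. -/
theorem card_quad_zero {d : K} (hd : d ≠ 0) :
    #{p : K × K × K | -(conj F d * p.1 ^ 2) - p.2.1 * p.2.2 = 0} = Fintype.card F ^ 4 := by
  have h1 : #{p : K × K × K | -(conj F d * p.1 ^ 2) - p.2.1 * p.2.2 = 0} =
      ∑ x : K, #{p : K × K | p.1 * p.2 = -(conj F d * x ^ 2)} := by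
    rw [← card_filter_prod_eq_sum (fun (x : K) (p : K × K) => p.1 * p.2 = -(conj F d * x ^ 2))]
    congr 1
    ext p
    simp only [mem_filter, mem_univ, true_and, sub_eq_zero]
    exact eq_comm
  have h3 : ∀ x ∈ univ.erase (0 : K), #{p : K × K | p.1 * p.2 = -(conj F d * x ^ 2)} =
      Fintype.card F ^ 2 - 1 := by
    intro x hx
    rw [card_mul_eq (neg_ne_zero.2 (mul_ne_zero (conj_ne_zero F hd)
      (pow_ne_zero 2 (by simpa using hx)))),
      card_eq_sq F (K := K)]
  have h5 : #{p : K × K | p.1 * p.2 = -(conj F d * 0 ^ 2)} =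
      Fintype.card F ^ 2 + (Fintype.card F ^ 2 - 1) := by
    rw [card_filter_prod_eq_sum (fun (a b : K) => a * b = -(conj F d * 0 ^ 2)),
      ← Finset.add_sum_erase _ _ (mem_univ (0 : K)),
      Finset.sum_congr rfl (g := fun _ => 1)]
    · simp [card_univ, card_erase_of_mem, card_eq_sq F (K := K)]
    · intro a ha
      have ha : a ≠ 0 := by simpa using ha
      rw [Finset.card_eq_one]
      exact ⟨0, by ext b; simp [ha]⟩
  rw [h1, ← Finset.add_sum_erase _ _ (mem_univ (0 : K)), Finset.sum_congr rfl h3, h5, sum_const,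
    card_erase_of_mem (mem_univ _), card_univ, card_eq_sq F (K := K), smul_eq_mul]
  obtain ⟨m, hm⟩ : ∃ m, Fintype.card F ^ 2 = m + 1 :=
    ⟨Fintype.card F ^ 2 - 1, by have := pow_pos (Fintype.card_pos (α := F)) 2; omega⟩
  rw [show Fintype.card F ^ 4 = Fintype.card F ^ 2 * Fintype.card F ^ 2 by ring, hm]
  simp
  ring

/-- The number of common zeros of `Q` and `H` in the plane. -/
theorem card_quad_herm_zero (hF : ringChar F ≠ 2) {d : K} (hd : Algebra.norm F d ≠ 0)
    (hd1 : Algebra.norm F d ≠ 1) :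
    (#{p : K × K × K | -(conj F d * p.1 ^ 2) - p.2.1 * p.2.2 = 0 ∧
        (1 + Algebra.norm F d) * Algebra.norm F p.1
          - Algebra.norm F p.2.1 - Algebra.norm F p.2.2 = 0} : ℤ) =
      1 + (Fintype.card F ^ 2 - 1) * (2 * (Fintype.card F + 1)) := by
  have hd0 : d ≠ 0 := by rwa [Ne, ← norm_eq_zero_iff F]
  have h1 : #{p : K × K × K | -(conj F d * p.1 ^ 2) - p.2.1 * p.2.2 = 0 ∧
        (1 + Algebra.norm F d) * Algebra.norm F p.1
          - Algebra.norm F p.2.1 - Algebra.norm F p.2.2 = 0} =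
      ∑ x : K, #{p : K × K | p.1 * p.2 = -(conj F d * x ^ 2) ∧
        Algebra.norm F p.1 + Algebra.norm F p.2 = (1 + Algebra.norm F d) * Algebra.norm F x} := by
    rw [← card_filter_prod_eq_sum (fun (x : K) (p : K × K) => p.1 * p.2 = -(conj F d * x ^ 2) ∧
        Algebra.norm F p.1 + Algebra.norm F p.2 = (1 + Algebra.norm F d) * Algebra.norm F x)]
    congr 1
    ext p
    simp only [mem_filter, mem_univ, true_and, sub_eq_zero, sub_sub]
    exact and_congr eq_comm eq_comm
  have hsq : ∀ x : K, ((1 + Algebra.norm F d) * Algebra.norm F x) ^ 2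
      - 4 * Algebra.norm F (-(conj F d * x ^ 2)) =
        ((1 - Algebra.norm F d) * Algebra.norm F x) ^ 2 := by
    intro x
    rw [norm_neg, map_mul, norm_conj, map_pow]; ring
  have h3 : ∀ x ∈ univ.erase (0 : K), (#{p : K × K | p.1 * p.2 = -(conj F d * x ^ 2) ∧
        Algebra.norm F p.1 + Algebra.norm F p.2 = (1 + Algebra.norm F d) * Algebra.norm F x} : ℤ) =
      2 * (Fintype.card F + 1) := by
    intro x hx
    have hx : x ≠ 0 := by simpa using hx
    have hx' : Algebra.norm F x ≠ 0 := by rwa [Ne, norm_eq_zero_iff F]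
    rw [card_mul_eq_norm_add F hF, hsq, card_sq_eq hF,
      quadraticChar_sq_one' (mul_ne_zero (sub_ne_zero.2 (Ne.symm hd1)) hx'), if_neg]
    · ring
    · rintro ⟨-, h⟩
      rw [neg_eq_zero] at h
      exact mul_ne_zero (conj_ne_zero F hd0) (pow_ne_zero 2 hx) h
  have h5 : (#{p : K × K | p.1 * p.2 = -(conj F d * 0 ^ 2) ∧
        Algebra.norm F p.1 + Algebra.norm F p.2 = (1 + Algebra.norm F d) * Algebra.norm F (0 : K)} : ℤ)
        = 1 := by
    rw [card_mul_eq_norm_add F hF, hsq, (norm_eq_zero_iff F (K := K)).2 rfl]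
    simp [Finset.filter_eq']
  rw [h1, Nat.cast_sum, ← Finset.add_sum_erase _ _ (mem_univ (0 : K)), Finset.sum_congr rfl h3, h5,
    sum_const, card_erase_of_mem (mem_univ _), card_univ, card_eq_sq F (K := K), nsmul_eq_mul,
    Nat.cast_sub (Nat.one_le_pow _ _ Fintype.card_pos)]
  push_cast
  ring

end PlanePoints

/-! ### Intersection numbers of the plane -/

section Intersections

set_option linter.unusedSectionVars false

variable (F : Type*) {K : Type*} [Field F] [Fintype F] [Field K] [Algebra F K]
  [hK : Fact (Module.finrank F K = 2)]

/-- Coordinates `f (δ, β, γ)` of the vectors of the plane `P₀^⊥`, in which the two forms are those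
of the vector `(-dᵠ δ, β, γ, δ)` and `P₀` corresponds to `(1, 0, 0, d)`. -/
structure PlaneCoordinates (P₀ : Pt K) (d : K) (f : K × K × K → Matrix (Fin 2) (Fin 2) K) :
    Prop where
  injective : Function.Injective f
  zero_eq : f 0 = 0
  mem_iff : ∀ N, hermForm F N P₀.rep = 0 ↔ ∃ p, f p = N
  quad_eq : ∀ p, quad (f p) = -(conj F d * p.1 ^ 2) - p.2.1 * p.2.2
  herm_eq : ∀ p, hermVal F (f p) = (1 + Algebra.norm F d) * Algebra.norm F p.1
        - Algebra.norm F p.2.1 - Algebra.norm F p.2.2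
  fixed_iff : ∀ p, sigmaMap F (f p) = f p ↔
        conj F p.1 = -(conj F d * p.1) ∧ p.2.2 = conj F p.2.1
  norm_ne_zero : Algebra.norm F d ≠ 0
  norm_ne_one : Algebra.norm F d ≠ 1
  one_add_norm_ne_zero : 1 + Algebra.norm F d ≠ 0

variable {F}
variable {P₀ : Pt K} {d : K} {f : K × K × K → Matrix (Fin 2) (Fin 2) K}

theorem one_lt_card_sq : 1 < Fintype.card F ^ 2 :=
  Nat.one_lt_pow two_ne_zero Fintype.one_lt_card

theorem card_sq_sub_one_cast : ((Fintype.card F ^ 2 - 1 : ℕ) : ℤ) = (Fintype.card F : ℤ) ^ 2 - 1 := by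
  rw [Nat.cast_sub one_lt_card_sq.le]; push_cast; rfl

theorem cast_card_sq_sub_one_ne_zero : (Fintype.card F : ℤ) ^ 2 - 1 ≠ 0 := by
  rw [← card_sq_sub_one_cast]
  have := one_lt_card_sq (F := F)
  exact_mod_cast (by omega : Fintype.card F ^ 2 - 1 ≠ 0)

/-- The `σ`-fixed vectors of the plane are those with `δ = 0` and `γ = βᵠ`. -/
theorem PlaneCoordinates.fixed_iff' (hc : PlaneCoordinates F P₀ d f) (p : K × K × K) :
    sigmaMap F (f p) = f p ↔ p.1 = 0 ∧ p.2.2 = conj F p.2.1 := by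
  rw [hc.fixed_iff]
  refine and_congr_left fun _ => ⟨fun h => ?_, fun h => by simp [h]⟩
  by_contra h0
  have h1 := congrArg (Algebra.norm F) h
  rw [norm_conj, norm_neg, map_mul, norm_conj] at h1
  have hN : Algebra.norm F p.1 ≠ 0 := by rwa [Ne, norm_eq_zero_iff F]
  exact hc.norm_ne_one (mul_right_cancel₀ hN (by rw [← h1, one_mul]))

theorem PlaneCoordinates.ncard_subgeometry (hc : PlaneCoordinates F P₀ d f) :
    (perp F P₀ ∩ subgeometry F K).ncard = Fintype.card F + 1 := by
  classical
  have := finite_of_finrank_eq_two F (K := K)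
  have := Fintype.ofFinite K
  have h := ncard_fixed_vectors F (p := fun M : Matrix (Fin 2) (Fin 2) K =>
    hermForm F M P₀.rep = 0) (by
      intro a M ha
      rw [hermForm_smul_left]
      simp [ha])
  have h1 : {P : Pt K | P ∈ subgeometry F K ∧ hermForm F P.rep P₀.rep = 0} =
      perp F P₀ ∩ subgeometry F K := by
    ext P; exact and_comm
  have h3 : {M : Matrix (Fin 2) (Fin 2) K | M ≠ 0 ∧ sigmaMap F M = M ∧
      hermForm F M P₀.rep = 0}.ncard = #{b : K | b ≠ 0} := by
    rw [← Set.ncard_coe_finset]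
    symm
    refine Set.ncard_congr (fun b _ => f (0, b, conj F b)) ?_ ?_ ?_
    · intro b hb
      have hb : b ≠ 0 := by simpa using hb
      refine ⟨fun h0 => hb ?_, (hc.fixed_iff' _).2 ⟨rfl, rfl⟩, (hc.mem_iff _).2 ⟨_, rfl⟩⟩
      have := hc.injective (h0.trans hc.zero_eq.symm)
      simp only [Prod.ext_iff] at this
      exact this.2.1
    · intro b b' _ _ h0
      have := hc.injective h0
      simp only [Prod.ext_iff] at this
      exact this.2.1
    · rintro M ⟨hM, hs, hM0⟩
      obtain ⟨⟨x, b, g⟩, rfl⟩ := (hc.mem_iff M).1 hM0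
      obtain ⟨h1, h2⟩ := (hc.fixed_iff' _).1 hs
      simp only at h1 h2
      subst h1 h2
      refine ⟨b, ?_, rfl⟩
      simp only [coe_filter, mem_univ, true_and, Set.mem_ofPred_eq]
      rintro rfl
      apply hM
      rw [map_zero]
      exact hc.zero_eq
  rw [h1, h3, card_ne_zero_eq F] at h
  have hq : 1 < Fintype.card F := Fintype.one_lt_card
  have h5 : Fintype.card F ^ 2 - 1 = (Fintype.card F + 1) * (Fintype.card F - 1) := by
    have := Nat.sq_sub_sq (Fintype.card F) 1
    simpa using this
  rw [h5] at h
  exact (Nat.eq_of_mul_eq_mul_right (by omega) h).symm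

/-- On the `σ`-fixed vectors of the plane, `Q` is the form `-N(β)`, which is anisotropic. -/
theorem PlaneCoordinates.inter_Q0 (hc : PlaneCoordinates F P₀ d f) :
    perp F P₀ ∩ Q0 F K = ∅ := by
  rw [Set.eq_empty_iff_forall_notMem]
  rintro P ⟨hP, hQ, hS⟩
  obtain ⟨v, a, ha, hv0, hv, hPv⟩ := exists_rep_eq_fixed F hS
  have hP : hermForm F P.rep P₀.rep = 0 := hP
  have hQ : quad P.rep = 0 := hQ
  rw [hPv, hermForm_smul_left, mul_eq_zero, or_iff_right ha] at hP
  rw [hPv, quad_smul_eq_zero_iff ha] at hQ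
  obtain ⟨⟨x, b, g⟩, rfl⟩ := (hc.mem_iff v).1 hP
  obtain ⟨h1, h2⟩ := (hc.fixed_iff' _).1 hv
  simp only at h1 h2
  subst h1 h2
  rw [hc.quad_eq] at hQ
  have hb : b = 0 := by
    by_contra hb
    refine mul_ne_zero hb (conj_ne_zero F hb) ?_
    linear_combination -hQ
  subst hb
  apply hv0
  rw [map_zero]
  exact hc.zero_eq

theorem PlaneCoordinates.inter_sigmaTilde (hc : PlaneCoordinates F P₀ d f) :
    perp F P₀ ∩ sigmaTilde F K = perp F P₀ ∩ subgeometry F K := by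
  ext P
  refine and_congr_right fun hP => ⟨fun h => h.1, fun h => ⟨h, fun h0 => ?_⟩⟩
  have : P ∈ perp F P₀ ∩ Q0 F K := ⟨hP, h0⟩
  rw [hc.inter_Q0] at this
  exact this

variable [Fintype K] [DecidableEq F] [DecidableEq K]

theorem PlaneCoordinates.ncard_points (hc : PlaneCoordinates F P₀ d f) {r : K → F → Prop}
    [∀ c, DecidablePred (r c)]
    (hr : ∀ a c h, a ≠ 0 → (r (a ^ 2 * c) (Algebra.norm F a * h) ↔ r c h)) :
    {P | P ∈ perp F P₀ ∧ r (quad P.rep) (hermVal F P.rep)}.ncard * (Fintype.card F ^ 2 - 1) =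
      #{p : K × K × K | p ≠ 0 ∧ r (-(conj F d * p.1 ^ 2) - p.2.1 * p.2.2)
        ((1 + Algebra.norm F d) * Algebra.norm F p.1
          - Algebra.norm F p.2.1 - Algebra.norm F p.2.2)} :=
  ncard_plane_points F hc.injective hc.zero_eq hc.mem_iff hc.quad_eq hc.herm_eq hr

/-- The number of points of the plane whose pair `(Q, H)` satisfies a scaling invariant condition
implying that `H² - 4 N(Q)` has quadratic character `ε`. The last term counts the representatives of
the point `β = γ = 0`. -/
theorem PlaneCoordinates.ncard_points_rel (hc : PlaneCoordinates F P₀ d f) (hF : ringChar F ≠ 2)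
    (r : K → F → Prop) [∀ c, DecidablePred (r c)]
    (hr : ∀ a c h, a ≠ 0 → (r (a ^ 2 * c) (Algebra.norm F a * h) ↔ r c h)) {ε : ℤ}
    (hε : ∀ c h, r c h → c ≠ 0 ∧ quadraticChar F (h ^ 2 - 4 * Algebra.norm F c) = ε) :
    ({P | P ∈ perp F P₀ ∧ r (quad P.rep) (hermVal F P.rep)}.ncard : ℤ) *
      ((Fintype.card F : ℤ) ^ 2 - 1) =
    #{x : K × F | r x.1 x.2} * ((Fintype.card F + 1) * (Fintype.card F ^ 2 - Fintype.card F - 1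
      - Fintype.card F * ε))
    + Fintype.card F ^ 2 *
      #{x : K | r (-(conj F d * x ^ 2)) ((1 + Algebra.norm F d) * Algebra.norm F x)} := by
  rw [← card_plane_vectors_rel F hF hc.norm_ne_zero hc.norm_ne_one hc.one_add_norm_ne_zero r hε,
    ← hc.ncard_points hr, Nat.cast_mul, card_sq_sub_one_cast]

theorem PlaneCoordinates.ncard_T (hc : PlaneCoordinates F P₀ d f) (hF : ringChar F ≠ 2) :
    (perp F P₀ ∩ T F K).ncard = 2 * (Fintype.card F + 1) := by
  have hset : perp F P₀ ∩ T F K =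
      {P | P ∈ perp F P₀ ∧ (fun c h => c = 0 ∧ h = 0) (quad P.rep) (hermVal F P.rep)} := by
    ext P
    refine and_congr_right fun hP => ?_
    rw [mem_T_iff, herm_eq_zero_iff]
    refine ⟨fun h => ⟨h.1, h.2.1⟩, fun h => ⟨h.1, h.2, fun h0 => ?_⟩⟩
    have : P ∈ perp F P₀ ∩ Q0 F K := ⟨hP, h.1, h0⟩
    rw [hc.inter_Q0] at this
    exact this
  have h1 := hc.ncard_points (r := fun c h => c = 0 ∧ h = 0) (by
    intro a c h ha
    simp [ha, norm_eq_zero_iff F])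
  rw [← hset] at h1
  have h3 := card_quad_herm_zero F hF hc.norm_ne_zero hc.norm_ne_one
  rw [← Finset.insert_erase (s := univ.filter fun p : K × K × K =>
    -(conj F d * p.1 ^ 2) - p.2.1 * p.2.2 = 0 ∧
        (1 + Algebra.norm F d) * Algebra.norm F p.1
          - Algebra.norm F p.2.1 - Algebra.norm F p.2.2 = 0) (a := 0)
    (by simp [(norm_eq_zero_iff F (K := K)).2 rfl]), card_insert_of_notMem (by simp)] at h3
  have h5 : (univ.filter fun p : K × K × K => -(conj F d * p.1 ^ 2) - p.2.1 * p.2.2 = 0 ∧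
        (1 + Algebra.norm F d) * Algebra.norm F p.1
          - Algebra.norm F p.2.1 - Algebra.norm F p.2.2 = 0).erase 0 =
      univ.filter fun p : K × K × K => p ≠ 0 ∧ (-(conj F d * p.1 ^ 2) - p.2.1 * p.2.2 = 0 ∧
        (1 + Algebra.norm F d) * Algebra.norm F p.1
          - Algebra.norm F p.2.1 - Algebra.norm F p.2.2 = 0) := by
    ext p; simp
  rw [h5, ← h1] at h3
  push_cast [card_sq_sub_one_cast] at h3
  have h7 : ((perp F P₀ ∩ T F K).ncard : ℤ) = 2 * (Fintype.card F + 1) :=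
    mul_right_cancel₀ cast_card_sq_sub_one_ne_zero (by linear_combination h3)
  exact_mod_cast h7

theorem PlaneCoordinates.ncard_quadricTilde (hc : PlaneCoordinates F P₀ d f)
    (hF : ringChar F ≠ 2) :
    ((perp F P₀ ∩ quadricTilde F K).ncard : ℤ) =
      (Fintype.card F : ℤ) ^ 2 - 2 * Fintype.card F - 1 := by
  have hd0 : d ≠ 0 := by rw [Ne, ← norm_eq_zero_iff F]; exact hc.norm_ne_zero
  have h1 := hc.ncard_points (r := fun c _ => c = 0) (by
    intro a c h ha
    simp [ha])
  have h3 := card_quad_zero F hd0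
  rw [← Finset.insert_erase (s := univ.filter fun p : K × K × K =>
    -(conj F d * p.1 ^ 2) - p.2.1 * p.2.2 = 0) (a := 0)
    (by simp), card_insert_of_notMem (by simp)] at h3
  have h5 : (univ.filter fun p : K × K × K => -(conj F d * p.1 ^ 2) - p.2.1 * p.2.2 = 0).erase 0 =
      univ.filter fun p : K × K × K => p ≠ 0 ∧ (-(conj F d * p.1 ^ 2) - p.2.1 * p.2.2 = 0) := by
    ext p; simp
  rw [h5, ← h1] at h3
  have h3' := congrArg (Nat.cast : ℕ → ℤ) h3
  push_cast [card_sq_sub_one_cast] at h3'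
  have hunion : {P | P ∈ perp F P₀ ∧ quad P.rep = 0} =
      (perp F P₀ ∩ quadricTilde F K) ∪ (perp F P₀ ∩ T F K) := by
    ext P
    change _ ↔ (_ ∧ _) ∨ (_ ∧ _)
    rw [← and_or_left]
    refine and_congr_right fun hP => ?_
    rw [mem_T_iff]
    change _ ↔ (_ ∧ ¬ (herm F P.rep = 0)) ∨ _
    constructor
    · intro h
      by_cases h0 : herm F P.rep = 0
      · refine Or.inr ⟨h, h0, fun hS => ?_⟩
        have : P ∈ perp F P₀ ∩ Q0 F K := ⟨hP, h, hS⟩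
        rw [hc.inter_Q0] at this
        exact this
      · exact Or.inl ⟨h, h0⟩
    · rintro (h | h) <;> exact h.1
  have hdisj : Disjoint (perp F P₀ ∩ quadricTilde F K) (perp F P₀ ∩ T F K) := by
    rw [Set.disjoint_left]
    rintro P ⟨-, h⟩ ⟨-, h'⟩
    exact h.2 ((mem_T_iff F P).1 h').2.1
  rw [hunion, Set.ncard_union_eq hdisj (Set.toFinite _) (Set.toFinite _), hc.ncard_T hF] at h3'
  refine mul_right_cancel₀ (cast_card_sq_sub_one_ne_zero (F := F)) ?_
  push_cast at h3'
  linear_combination h3'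

/-- The points with `H ≠ 0` and `H² = 4 N(Q)` are those of `𝒟̃` and those of `Σ ∖ 𝒬₀`. -/
theorem PlaneCoordinates.ncard_DTilde (hc : PlaneCoordinates F P₀ d f) (hF : ringChar F ≠ 2) :
    ((perp F P₀ ∩ DTilde F K).ncard : ℤ) =
      ((Fintype.card F : ℤ) - 2) * (Fintype.card F + 1) ^ 2 := by
  have h4 := four_ne_zero' F hF
  have h1 := hc.ncard_points_rel hF (fun c h => h ≠ 0 ∧ h ^ 2 = 4 * 1 * Algebra.norm F c) (by
    intro a c h ha
    have ha' : Algebra.norm F a ≠ 0 := by rwa [Ne, norm_eq_zero_iff F]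
    rw [map_mul, map_pow, mul_pow, mul_left_comm, mul_right_inj' (pow_ne_zero 2 ha')]
    simp [ha']) (ε := 0) (by
    rintro c h ⟨hh, h0⟩
    rw [mul_one] at h0
    refine ⟨?_, by rw [h0]; simp⟩
    rintro rfl
    rw [(norm_eq_zero_iff F (K := K)).2 rfl] at h0
    exact hh (by simpa using h0))
  rw [card_pairs_sq F hF one_ne_zero] at h1
  have h3 : (univ.filter fun x : K => (1 + Algebra.norm F d) * Algebra.norm F x ≠ 0 ∧
      ((1 + Algebra.norm F d) * Algebra.norm F x) ^ 2 =
        4 * 1 * Algebra.norm F (-(conj F d * x ^ 2))) = ∅ := by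
    rw [Finset.filter_eq_empty_iff]
    rintro x - ⟨hx, h0⟩
    rw [norm_neg, map_mul, norm_conj, map_pow] at h0
    have hx' : Algebra.norm F x ≠ 0 := right_ne_zero_of_mul hx
    have h5 : ((1 - Algebra.norm F d) * Algebra.norm F x) ^ 2 = 0 := by linear_combination h0
    exact pow_ne_zero 2 (mul_ne_zero (sub_ne_zero.2 (Ne.symm hc.norm_ne_one)) hx') h5
  have hunion : {P | P ∈ perp F P₀ ∧ (hermVal F P.rep ≠ 0 ∧
      hermVal F P.rep ^ 2 = 4 * 1 * Algebra.norm F (quad P.rep))} =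
      (perp F P₀ ∩ DTilde F K) ∪ (perp F P₀ ∩ subgeometry F K) := by
    ext P
    change _ ↔ (_ ∧ _) ∨ (_ ∧ _)
    rw [← and_or_left]
    refine and_congr_right fun hP => ?_
    rw [mem_DTilde_iff F hF, algebraMap_sq_disc, mul_one]
    constructor
    · rintro ⟨hh, h0⟩
      by_cases hS : P ∈ subgeometry F K
      · exact Or.inr hS
      · refine Or.inl ⟨?_, h0, hS⟩
        intro hq
        rw [hq, (norm_eq_zero_iff F (K := K)).2 rfl] at h0
        exact hh (by simpa using h0)
    · have hval : ∀ h n : F, n ≠ 0 → h ^ 2 = 4 * n → h ≠ 0 := by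
        rintro h n hn h0 rfl
        rw [zero_pow two_ne_zero, eq_comm] at h0
        exact mul_ne_zero h4 hn h0
      rintro (⟨hq, h0, -⟩ | hS)
      · exact ⟨hval _ _ (by rwa [Ne, norm_eq_zero_iff F]) h0, h0⟩
      · -- for a fixed vector `H = 2 Q`
        have hq : quad P.rep ≠ 0 := by
          intro hq
          have : P ∈ perp F P₀ ∩ Q0 F K := ⟨hP, hq, hS⟩
          rw [hc.inter_Q0] at this
          exact this
        obtain ⟨v, a, ha, hv0, hv, hPv⟩ := exists_rep_eq_fixed F hS
        have h0 : hermVal F P.rep ^ 2 = 4 * Algebra.norm F (quad P.rep) := by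
          rw [← algebraMap_sq_disc, hPv, herm_smul, quad_smul, herm_eq_polar, hv, polar_self,
            map_mul, ← quad_sigmaMap, hv, map_pow]
          ring
        exact ⟨hval _ _ (by rwa [Ne, norm_eq_zero_iff F]) h0, h0⟩
  have hdisj : Disjoint (perp F P₀ ∩ DTilde F K) (perp F P₀ ∩ subgeometry F K) := by
    rw [Set.disjoint_left]
    rintro P ⟨-, h⟩ ⟨-, h'⟩
    exact h.2 h'
  rw [h3, hunion, Set.ncard_union_eq hdisj (Set.toFinite _) (Set.toFinite _),
    hc.ncard_subgeometry, card_sq_sub_one_cast] at h1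
  refine mul_right_cancel₀ (cast_card_sq_sub_one_ne_zero (F := F)) ?_
  push_cast at h1
  simp only [card_empty, Nat.cast_zero] at h1
  linear_combination h1

/-- The points of `ℋ ∖ 𝒬`, separated by the quadratic character of `-4 N(Q)`. -/
theorem PlaneCoordinates.ncard_herm_zero (hc : PlaneCoordinates F P₀ d f) (hF : ringChar F ≠ 2)
    {ε : ℤ} (hε : ε = 1 ∨ ε = -1) :
    2 * ({P | P ∈ perp F P₀ ∧ (quad P.rep ≠ 0 ∧ hermVal F P.rep = 0 ∧
      quadraticChar F (hermVal F P.rep ^ 2 - 4 * Algebra.norm F (quad P.rep)) = ε)}.ncard : ℤ) =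
      (Fintype.card F + 1) * (Fintype.card F ^ 2 - Fintype.card F - 1 - Fintype.card F * ε) := by
  have h1 := hc.ncard_points_rel hF (fun c h => c ≠ 0 ∧ h = 0 ∧
    quadraticChar F (h ^ 2 - 4 * Algebra.norm F c) = ε) (by
    intro a c h ha
    have ha' : Algebra.norm F a ≠ 0 := by rwa [Ne, norm_eq_zero_iff F]
    rw [show (Algebra.norm F a * h) ^ 2 - 4 * Algebra.norm F (a ^ 2 * c) =
      Algebra.norm F a ^ 2 * (h ^ 2 - 4 * Algebra.norm F c) by rw [map_mul, map_pow]; ring,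
      map_mul (quadraticChar F), quadraticChar_sq_one' ha', one_mul]
    simp [ha, ha']) (ε := ε) (fun c h hh => ⟨hh.1, hh.2.2⟩)
  have h3 : (univ.filter fun x : K => -(conj F d * x ^ 2) ≠ 0 ∧
      (1 + Algebra.norm F d) * Algebra.norm F x = 0 ∧
      quadraticChar F (((1 + Algebra.norm F d) * Algebra.norm F x) ^ 2
        - 4 * Algebra.norm F (-(conj F d * x ^ 2))) = ε) = ∅ := by
    rw [Finset.filter_eq_empty_iff]
    rintro x - ⟨hx, h0, -⟩
    rw [mul_eq_zero, or_iff_right hc.one_add_norm_ne_zero, norm_eq_zero_iff F] at h0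
    exact hx (by simp [h0])
  have h5 := congrArg (Nat.cast : ℕ → ℤ) (card_pairs_zero F (K := K) hF hε)
  rw [Nat.cast_mul, card_sq_sub_one_cast] at h5
  rw [h3] at h1
  refine mul_right_cancel₀ (cast_card_sq_sub_one_ne_zero (F := F)) ?_
  simp only [card_empty, Nat.cast_zero] at h1
  push_cast at h5
  linear_combination 2 * h1 + ((Fintype.card F + 1) * (Fintype.card F ^ 2 - Fintype.card F - 1
      - Fintype.card F * ε)) * h5

theorem disc_ne_zero_of_herm_zero (hF : ringChar F ≠ 2) {M : Matrix (Fin 2) (Fin 2) K}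
    (hq : quad M ≠ 0) (hh : hermVal F M = 0) :
    hermVal F M ^ 2 - 4 * Algebra.norm F (quad M) ≠ 0 := by
  have h4 := four_ne_zero' F hF
  have : Algebra.norm F (quad M) ≠ 0 := by rwa [Ne, norm_eq_zero_iff F]
  rw [hh]
  simpa [h4] using hq

theorem PlaneCoordinates.ncard_H1 (hc : PlaneCoordinates F P₀ d f) (hF : ringChar F ≠ 2) :
    2 * ((perp F P₀ ∩ H1 F K).ncard : ℤ) =
      (Fintype.card F + 1) * (Fintype.card F ^ 2 - 2 * Fintype.card F - 1) := by
  have h := hc.ncard_herm_zero hF (ε := 1) (Or.inl rfl)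
  have hset : perp F P₀ ∩ H1 F K = {P | P ∈ perp F P₀ ∧ (quad P.rep ≠ 0 ∧ hermVal F P.rep = 0 ∧
      quadraticChar F (hermVal F P.rep ^ 2 - 4 * Algebra.norm F (quad P.rep)) = 1)} := by
    ext P
    refine and_congr_right fun hP => ?_
    change (herm F P.rep = 0 ∧ ¬ (quad P.rep = 0)) ∧ _ ↔ _
    rw [herm_eq_zero_iff, and_comm (a := hermVal F P.rep = 0), and_assoc]
    refine and_congr_right fun hq => and_congr_right fun hh => ?_
    exact nonsingular_iff F hF hq (disc_ne_zero_of_herm_zero hF hq hh)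
  rw [hset, h]
  ring

theorem PlaneCoordinates.ncard_H2 (hc : PlaneCoordinates F P₀ d f) (hF : ringChar F ≠ 2) :
    2 * ((perp F P₀ ∩ H2 F K).ncard : ℤ) =
      (Fintype.card F - 1) * (Fintype.card F + 1) ^ 2 := by
  have h := hc.ncard_herm_zero hF (ε := -1) (Or.inr rfl)
  have hset : perp F P₀ ∩ H2 F K = {P | P ∈ perp F P₀ ∧ (quad P.rep ≠ 0 ∧ hermVal F P.rep = 0 ∧
      quadraticChar F (hermVal F P.rep ^ 2 - 4 * Algebra.norm F (quad P.rep)) = -1)} := by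
    ext P
    refine and_congr_right fun hP => ?_
    change (herm F P.rep = 0 ∧ ¬ (quad P.rep = 0)) ∧ _ ↔ _
    rw [herm_eq_zero_iff, and_comm (a := hermVal F P.rep = 0), and_assoc]
    refine and_congr_right fun hq => and_congr_right fun hh => ?_
    have hd := disc_ne_zero_of_herm_zero hF hq hh
    rw [nonsingular_iff F hF hq hd, quadraticChar_eq_neg_one_iff_not_one hd]
  rw [hset, h]
  ring

/-- The points of `S̃_η` in the plane. The last term counts the representatives of the point
`β = γ = 0` if this point lies on `S̃_η`. -/
theorem PlaneCoordinates.ncard_STilde (hc : PlaneCoordinates F P₀ d f) (hF : ringChar F ≠ 2)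
    (hodd : Odd (Fintype.card F)) {η : K} (hη : η ≠ 0) {s : F}
    (hs : 1 - 1 / η ^ 2 = algebraMap F K s) {ε : ℤ} (hε : quadraticChar F s = ε) :
    2 * ((perp F P₀ ∩ STilde F η).ncard : ℤ) * ((Fintype.card F : ℤ) ^ 2 - 1) =
      ((Fintype.card F : ℤ) ^ 2 - 1) * ((Fintype.card F + 1) *
        (Fintype.card F ^ 2 - Fintype.card F - 1 - Fintype.card F * ε))
      + 2 * Fintype.card F ^ 2 * #{x : K | (1 + Algebra.norm F d) * Algebra.norm F x ≠ 0 ∧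
        algebraMap F K ((1 + Algebra.norm F d) * Algebra.norm F x) =
          2 * η * (-(conj F d * x ^ 2)) ^ ((Fintype.card F + 1) / 2)} := by
  have hs1 : (1 - algebraMap F K s) * η ^ 2 = 1 := by
    rw [← hs]; field_simp; ring
  have hs0 : 1 - s ≠ 0 := by
    intro h0
    rw [← map_one (algebraMap F K), ← map_sub, h0] at hs1
    simp at hs1
  have hs0K : 1 - algebraMap F K s ≠ 0 := left_ne_zero_of_mul (hs1 ▸ one_ne_zero)
  have hηu : η ^ 2 = algebraMap F K (1 / (1 - s)) := by
    rw [map_div₀, map_sub, map_one]; field_simp; linear_combination hs1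
  have hset : perp F P₀ ∩ STilde F η = {P | P ∈ perp F P₀ ∧ (hermVal F P.rep ≠ 0 ∧
      algebraMap F K (hermVal F P.rep) =
        2 * η * quad P.rep ^ ((Fintype.card F + 1) / 2))} := by
    ext P
    refine and_congr_right fun hP => ?_
    change (_ = 0) ∧ ¬ (herm F P.rep = 0) ↔ _
    rw [herm_eq_zero_iff, sub_eq_zero, algebraMap_hermVal]
    exact and_comm
  have h1 := hc.ncard_points_rel hF (fun c h => h ≠ 0 ∧ algebraMap F K h =
    2 * η * c ^ ((Fintype.card F + 1) / 2)) (by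
    intro a c h ha
    have ha' : Algebra.norm F a ≠ 0 := by rwa [Ne, norm_eq_zero_iff F]
    have ha2 : (a ^ 2) ^ ((Fintype.card F + 1) / 2) = algebraMap F K (Algebra.norm F a) := by
      rw [← pow_mul, mul_comm, pow_mul, pow_half_sq F hodd, algebraMap_norm]
    rw [mul_pow, ha2, map_mul, mul_left_comm,
      mul_right_inj' ((map_ne_zero (algebraMap F K)).2 ha')]
    simp [ha']) (ε := ε) (by
    rintro c h ⟨hh, h0⟩
    have hc0 : c ≠ 0 := by
      rintro rfl
      rw [zero_pow (by obtain ⟨k, hk⟩ := hodd; omega), mul_zero, map_eq_zero] at h0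
      exact hh h0
    refine ⟨hc0, ?_⟩
    have h3 : h ^ 2 - 4 * Algebra.norm F c = s * h ^ 2 := by
      apply (algebraMap F K).injective
      have h5 : algebraMap F K h ^ 2 = 4 * η ^ 2 * (c * conj F c) := by
        rw [h0, mul_pow, pow_half_sq F hodd]; ring
      rw [map_sub, map_mul, map_mul, map_pow, algebraMap_norm, map_ofNat, h5]
      linear_combination (4 * (c * conj F c)) * hs1
    rw [h3, map_mul, quadraticChar_sq_one' hh, mul_one, hε])
  have h3 := congrArg (Nat.cast : ℕ → ℤ)
    (card_pairs_S F hF hodd (one_div_ne_zero hs0) hηu)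
  rw [Nat.cast_mul, card_sq_sub_one_cast] at h3
  rw [hset]
  push_cast at h3
  linear_combination 2 * h1 + ((Fintype.card F + 1) *
        (Fintype.card F ^ 2 - Fintype.card F - 1 - Fintype.card F * ε)) * h3

end Intersections

/-! ### The surface through the exceptional point -/

section SpecialSurface

set_option linter.unusedSectionVars false

variable {F : Type*} {K : Type*} [Field F] [Fintype F] [Field K] [Algebra F K]
  [hK : Fact (Module.finrank F K = 2)]

/-- The image of `-d ^ q` under the power map `x ↦ x ^ ((q + 1) / 2)`. -/
theorem neg_conj_pow_half [DecidableEq F] (hF : ringChar F ≠ 2) (hodd : Odd (Fintype.card F))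
    {d : K} (hd : Algebra.norm F d ≠ 0) :
    (-conj F d) ^ ((Fintype.card F + 1) / 2) =
      -((quadraticChar F (-Algebra.norm F d) : ℤ) : K) * d ^ ((Fintype.card F + 1) / 2) := by
  have hdK : algebraMap F K (Algebra.norm F d) ≠ 0 := by simpa using hd
  -- `-dᵠ = -N(d) d / d²`
  have h1 : -conj F d * d ^ 2 = algebraMap F K (-Algebra.norm F d) * d := by
    rw [map_neg, algebraMap_norm]; ring
  have h3 := congrArg (fun x => x ^ ((Fintype.card F + 1) / 2)) h1
  simp only [mul_pow] at h3
  have h5 : (d ^ 2) ^ ((Fintype.card F + 1) / 2) = algebraMap F K (Algebra.norm F d) := by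
    rw [← pow_mul, mul_comm, pow_mul, pow_half_sq F hodd, algebraMap_norm]
  have h7 : (algebraMap F K (-Algebra.norm F d)) ^ ((Fintype.card F + 1) / 2) =
      ((quadraticChar F (-Algebra.norm F d) : ℤ) : K) * algebraMap F K (-Algebra.norm F d) := by
    have h := quadraticChar_eq_pow_of_char_ne_two' hF (-Algebra.norm F d)
    have hk : (Fintype.card F + 1) / 2 = Fintype.card F / 2 + 1 := by
      obtain ⟨k, hk⟩ := hodd; omega
    rw [hk, pow_succ, ← map_pow, ← h, map_intCast]
  rw [h5, h7, map_neg (algebraMap F K)] at h3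
  apply mul_right_cancel₀ hdK
  rw [h3]
  ring

/-- The surface containing the point `β = γ = 0` of the plane is the one with parameter
`special F ξ`. -/
theorem special_eq_iff [DecidableEq F] (hF : ringChar F ≠ 2) (hodd : Odd (Fintype.card F))
    {d ξ η : K} (hd : Algebra.norm F d ≠ 0) (hd1 : Algebra.norm F d ≠ 1)
    (hξ : algebraMap F K (1 + Algebra.norm F d) = 2 * ξ * d ^ ((Fintype.card F + 1) / 2)) :
    algebraMap F K (1 + Algebra.norm F d) =
      2 * η * (-conj F d) ^ ((Fintype.card F + 1) / 2) ↔ η = special F ξ := by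
  have h2K := two_ne_zero_ext F (K := K) hF
  have h2 : (2 : F) ≠ 0 := Ring.two_ne_zero hF
  have hd0 : d ≠ 0 := by rwa [Ne, ← norm_eq_zero_iff F]
  have hdK : algebraMap F K (Algebra.norm F d) ≠ 0 := by simpa using hd
  have hpow : d ^ ((Fintype.card F + 1) / 2) ≠ 0 := pow_ne_zero _ hd0
  have hsub : 1 - Algebra.norm F d ≠ 0 := sub_ne_zero.2 (Ne.symm hd1)
  have hξ2 : 1 - ξ ^ 2 = algebraMap F K
      (-Algebra.norm F d * ((1 - Algebra.norm F d) / (2 * Algebra.norm F d)) ^ 2) := by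
    have h1 := congrArg (fun x => x ^ 2) hξ
    simp only [mul_pow] at h1
    rw [pow_half_sq F hodd, ← algebraMap_norm] at h1
    simp only [map_add, map_one, map_mul, map_neg, map_pow, map_div₀, map_sub, map_ofNat] at h1 ⊢
    field_simp
    linear_combination h1
  have hsq : (∃ s : F, IsSquare s ∧ 1 - ξ ^ 2 = algebraMap F K s) ↔
      quadraticChar F (-Algebra.norm F d) = 1 := by
    have hx : (1 - Algebra.norm F d) / (2 * Algebra.norm F d) ≠ 0 :=
      div_ne_zero hsub (mul_ne_zero h2 hd)
    have h0 : -Algebra.norm F d * ((1 - Algebra.norm F d) / (2 * Algebra.norm F d)) ^ 2 ≠ 0 :=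
      mul_ne_zero (neg_ne_zero.2 hd) (pow_ne_zero 2 hx)
    have h1 : quadraticChar F (-Algebra.norm F d) = quadraticChar F
        (-Algebra.norm F d * ((1 - Algebra.norm F d) / (2 * Algebra.norm F d)) ^ 2) := by
      rw [map_mul, quadraticChar_sq_one' hx, mul_one]
    rw [h1, quadraticChar_one_iff_isSquare h0, hξ2]
    constructor
    · rintro ⟨s, hs, h⟩
      rwa [(algebraMap F K).injective h]
    · intro h; exact ⟨_, h, rfl⟩
  rw [neg_conj_pow_half hF hodd hd, hξ]
  rcases quadraticChar_dichotomy (neg_ne_zero.2 hd) with h | h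
  · rw [special, if_pos (hsq.2 h), h]
    constructor
    · intro h0
      apply mul_left_cancel₀ (mul_ne_zero h2K hpow)
      push_cast at h0
      linear_combination h0
    · rintro rfl
      push_cast
      ring
  · rw [special, if_neg (by rw [hsq, h]; norm_num), h]
    constructor
    · intro h0
      apply mul_left_cancel₀ (mul_ne_zero h2K hpow)
      push_cast at h0
      linear_combination -h0
    · rintro rfl
      push_cast
      ring

/-- The points of `S̃_ξ` with `ξ ∈ 𝒵₁` have planes with coordinates. -/
theorem exists_planeCoordinates (hF : ringChar F ≠ 2) (hodd : Odd (Fintype.card F)) {ξ : K}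
    (hξ : ξ ∈ Z1 F K) {P : Pt K} (hP : P ∈ STilde F ξ) :
    ∃ (d : K) (f : K × K × K → Matrix (Fin 2) (Fin 2) K), PlaneCoordinates F P d f ∧
      algebraMap F K (1 + Algebra.norm F d) = 2 * ξ * d ^ ((Fintype.card F + 1) / 2) := by
  obtain ⟨hξ0, -, -, s, hs0, ⟨t, rfl⟩, hs⟩ := hξ
  obtain ⟨hPS, hPH⟩ := hP
  have hPS : herm F P.rep - 2 * ξ * quad P.rep ^ ((Fintype.card F + 1) / 2) = 0 := hPS
  have hPH : herm F P.rep ≠ 0 := hPH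
  have hS := sub_eq_zero.1 hPS
  have hq : quad P.rep ≠ 0 := by
    intro h0
    rw [h0, zero_pow (by obtain ⟨k, hk⟩ := hodd; omega), mul_zero] at hS
    exact hPH hS
  have hh : hermVal F P.rep ≠ 0 := by rwa [Ne, ← herm_eq_zero_iff]
  have ht : t ≠ 0 := left_ne_zero_of_mul hs0
  have hdisc : hermVal F P.rep ^ 2 - 4 * Algebra.norm F (quad P.rep) =
      (hermVal F P.rep * t) ^ 2 := by
    apply (algebraMap F K).injective
    have h1 : herm F P.rep ^ 2 = 4 * ξ ^ 2 * (quad P.rep * conj F (quad P.rep)) := by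
      rw [hS, mul_pow, pow_half_sq F hodd]; ring
    have h3 : (1 - algebraMap F K (t * t)) * ξ ^ 2 = 1 := by
      rw [← hs]; field_simp; ring
    rw [map_mul] at h3
    simp only [map_sub, map_mul, map_pow, algebraMap_hermVal, algebraMap_norm, map_ofNat]
    linear_combination (1 - algebraMap F K t * algebraMap F K t) * h1 +
      4 * (quad P.rep * conj F (quad P.rep)) * h3
  obtain ⟨u, d, f, hu, hval, hquad, hinj, hf0, hmem, hfq, hfh, hfs⟩ :=
    exists_plane_coordinates F hF hq (mul_ne_zero hh ht) hdisc
  have hNu : Algebra.norm F u ≠ 0 := by rwa [Ne, norm_eq_zero_iff F]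
  refine ⟨d, f, ⟨hinj, hf0, hmem, hfq, hfh, hfs, ?_, ?_, ?_⟩, ?_⟩
  · rw [Ne, norm_eq_zero_iff F]
    rintro rfl
    exact hq (by rw [hquad, mul_zero])
  · intro h1
    have h3 : (hermVal F P.rep * t) ^ 2 = 0 := by
      rw [← hdisc, hval, hquad, map_mul, map_pow, h1]; ring
    exact pow_ne_zero 2 (mul_ne_zero hh ht) h3
  · intro h1
    exact hh (by rw [hval, h1, mul_zero])
  · have hNuK : algebraMap F K (Algebra.norm F u) ≠ 0 := by simpa using hNu
    have h5 : (u ^ 2) ^ ((Fintype.card F + 1) / 2) = algebraMap F K (Algebra.norm F u) := by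
      rw [← pow_mul, mul_comm, pow_mul, pow_half_sq F hodd, algebraMap_norm]
    apply mul_left_cancel₀ hNuK
    rw [← map_mul, ← hval, algebraMap_hermVal, hS, hquad, mul_pow, h5]
    ring

variable {P₀ : Pt K} {d : K} {f : K × K × K → Matrix (Fin 2) (Fin 2) K}

open Classical in
/-- The point `β = γ = 0` of the plane contributes `q²` points to the surface through it. -/
theorem PlaneCoordinates.ncard_STilde_eq [DecidableEq F] (hc : PlaneCoordinates F P₀ d f)
    (hF : ringChar F ≠ 2) (hodd : Odd (Fintype.card F)) {ξ η : K}
    (hξ : algebraMap F K (1 + Algebra.norm F d) = 2 * ξ * d ^ ((Fintype.card F + 1) / 2))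
    (hη : η ≠ 0) {s : F} (hs : 1 - 1 / η ^ 2 = algebraMap F K s) {ε : ℤ}
    (hε : quadraticChar F s = ε) :
    2 * ((perp F P₀ ∩ STilde F η).ncard : ℤ) = (Fintype.card F + 1) *
        (Fintype.card F ^ 2 - Fintype.card F - 1 - Fintype.card F * ε)
      + if η = special F ξ then 2 * (Fintype.card F : ℤ) ^ 2 else 0 := by
  have := finite_of_finrank_eq_two F (K := K)
  have := Fintype.ofFinite K
  have h := hc.ncard_STilde hF hodd hη hs hε
  have hset : (univ.filter fun x : K => (1 + Algebra.norm F d) * Algebra.norm F x ≠ 0 ∧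
        algebraMap F K ((1 + Algebra.norm F d) * Algebra.norm F x) =
          2 * η * (-(conj F d * x ^ 2)) ^ ((Fintype.card F + 1) / 2)) =
      if η = special F ξ then univ.erase 0 else ∅ := by
    ext x
    simp only [mem_filter, mem_univ, true_and]
    by_cases hx : x = 0
    · subst hx
      rw [(norm_eq_zero_iff F (K := K)).2 rfl]
      split_ifs <;> simp
    · have hNx : Algebra.norm F x ≠ 0 := by rwa [Ne, norm_eq_zero_iff F]
      have hNxK : algebraMap F K (Algebra.norm F x) ≠ 0 := by simpa using hNx
      have hx2 : (x ^ 2) ^ ((Fintype.card F + 1) / 2) = algebraMap F K (Algebra.norm F x) := by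
        rw [← pow_mul, mul_comm, pow_mul, pow_half_sq F hodd, algebraMap_norm]
      rw [← neg_mul, mul_pow, hx2, map_mul, ← mul_assoc, mul_left_inj' hNxK,
        special_eq_iff hF hodd hc.norm_ne_zero hc.norm_ne_one hξ]
      split_ifs with h1
      · simp [hx, h1, hc.one_add_norm_ne_zero]
      · simp [h1]
  rw [hset] at h
  refine mul_right_cancel₀ (cast_card_sq_sub_one_ne_zero (F := F)) ?_
  rw [h]
  split_ifs with h1
  · rw [card_erase_of_mem (mem_univ _), card_univ, card_eq_sq F (K := K), card_sq_sub_one_cast]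
    ring
  · simp
    ring

end SpecialSurface

end Tensor

theorem mainTheorem10 (F K : Type*) [Field F] [Fintype F] [Field K] [Algebra F K]
    (hK : Module.finrank F K = 2) (q : ℕ) (hq : Fintype.card F = q) (hodd : Odd q)
    (ξ : K) (hξ : ξ ∈ Tensor.Z1 F K) (P : Pt K) (hP : P ∈ Tensor.STilde F ξ) :
    (Tensor.perp F P ∩ Tensor.Q0 F K).ncard = 0 ∧
    (Tensor.perp F P ∩ Tensor.sigmaTilde F K).ncard = q + 1 ∧
    (Tensor.perp F P ∩ Tensor.T F K).ncard = 2 * (q + 1) ∧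
    ((Tensor.perp F P ∩ Tensor.quadricTilde F K).ncard : ℚ) = (q : ℚ) ^ 2 - 2 * q - 1 ∧
    ((Tensor.perp F P ∩ Tensor.DTilde F K).ncard : ℚ) = ((q : ℚ) - 2) * (q + 1) ^ 2 ∧
    ((Tensor.perp F P ∩ Tensor.H1 F K).ncard : ℚ) =
      ((q : ℚ) + 1) * ((q : ℚ) ^ 2 - 2 * q - 1) / 2 ∧
    ((Tensor.perp F P ∩ Tensor.H2 F K).ncard : ℚ) =
      ((q : ℚ) - 1) * ((q : ℚ) + 1) ^ 2 / 2 ∧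
    ((Tensor.perp F P ∩ Tensor.STilde F (Tensor.special F ξ)).ncard : ℚ) =
      ((q : ℚ) + 1) * ((q : ℚ) ^ 2 - 2 * q - 1) / 2 + (q : ℚ) ^ 2 ∧
    (∀ η ∈ Tensor.Z1 F K, η ≠ Tensor.special F ξ →
      ((Tensor.perp F P ∩ Tensor.STilde F η).ncard : ℚ) =
        ((q : ℚ) + 1) * ((q : ℚ) ^ 2 - 2 * q - 1) / 2) ∧
    (∀ η ∈ Tensor.Z2 F K,
      ((Tensor.perp F P ∩ Tensor.STilde F η).ncard : ℚ) =
        ((q : ℚ) - 1) * ((q : ℚ) + 1) ^ 2 / 2) := by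
  classical
  subst hq
  have : Fact (Module.finrank F K = 2) := ⟨hK⟩
  have := Tensor.finite_of_finrank_eq_two F (K := K)
  have := Fintype.ofFinite K
  have hF : ringChar F ≠ 2 := by
    intro h
    rw [FiniteField.even_card_iff_char_two] at h
    obtain ⟨k, hk⟩ := hodd
    omega
  obtain ⟨d, f, hc, hξd⟩ := Tensor.exists_planeCoordinates hF hodd hξ hP
  have hcast : ∀ (n : ℕ) (a : ℤ), 2 * (n : ℤ) = a → (n : ℚ) = (a : ℚ) / 2 := by
    intro n a h
    rw [← h]; push_cast; ring
  have hZ1 : ∀ η ∈ Tensor.Z1 F K, 2 * ((Tensor.perp F P ∩ Tensor.STilde F η).ncard : ℤ) =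
      (Fintype.card F + 1) * (Fintype.card F ^ 2 - Fintype.card F - 1 - Fintype.card F * 1)
      + if η = Tensor.special F ξ then 2 * (Fintype.card F : ℤ) ^ 2 else 0 := by
    rintro η ⟨hη0, -, -, s, hs0, hsq, hs⟩
    exact hc.ncard_STilde_eq hF hodd hξd hη0 hs ((quadraticChar_one_iff_isSquare hs0).2 hsq)
  have hspecial : Tensor.special F ξ ∈ Tensor.Z1 F K := by
    obtain ⟨h0, h1, h2, h3⟩ := hξ
    rw [Tensor.special]
    split_ifs
    · exact ⟨neg_ne_zero.2 h0, fun h => h2 (by rw [← h, neg_neg]),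
        fun h => h1 (neg_injective h), by simpa using h3⟩
    · exact ⟨h0, h1, h2, h3⟩
  refine ⟨?_, ?_, hc.ncard_T hF, ?_, ?_, ?_, ?_, ?_, ?_, ?_⟩
  · rw [hc.inter_Q0, Set.ncard_empty]
  · rw [hc.inter_sigmaTilde, hc.ncard_subgeometry]
  · exact_mod_cast hc.ncard_quadricTilde hF
  · exact_mod_cast hc.ncard_DTilde hF
  · rw [hcast _ _ (hc.ncard_H1 hF)]
    push_cast; rfl
  · rw [hcast _ _ (hc.ncard_H2 hF)]
    push_cast; rfl
  · rw [hcast _ _ (hZ1 _ hspecial), if_pos rfl]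
    push_cast; ring
  · intro η hη hne
    rw [hcast _ _ (hZ1 η hη), if_neg hne]
    push_cast; ring
  · rintro η ⟨hη0, s, hsq, hs⟩
    have hne : η ≠ Tensor.special F ξ := by
      rintro rfl
      obtain ⟨-, -, -, s', -, hsq', hs'⟩ := hspecial
      rw [hs] at hs'
      exact hsq ((algebraMap F K).injective hs' ▸ hsq')
    rw [hcast _ _ (hc.ncard_STilde_eq hF hodd hξd hη0 hs
      (quadraticChar_neg_one_iff_not_isSquare.2 hsq)), if_neg hne]
    push_cast; ring
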